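/- Let $G$ be a finite graph and $S\subseteq V(G)$. A vertex dominates itself and its neighbours. The domination game on the partially dominated graph $G|S$ (in which the vertices of $S$ are declared to be already dominated) is played by Dominator and Staller, who alternately choose a vertex that dominates at least one vertex not yet dominated; the game ends when no such vertex is left. Dominator wants to minimize and Staller to maximize the number of moves. Let $\gamma_g(G|S)$ (resp. $\gamma_g'(G|S)$) be the number of moves under optimal play when Dominator (resp. Staller) moves first, and write $\gamma_g(G)=\gamma_g(G|\emptyset)$, $\gamma_g'(G)=\gamma_g'(G|\emptyset)$, $G|v=G|\{v\}$. The graph $G$ is $k$-$\gamma_g$-critical if $\gamma_g(G)=k$ and $\gamma_g(G|v)<\gamma_g(G)$ for every vertex $v\in V(G)$. For integers $p,q,r\ge 1$, let $T_{p,q,r}$ be the tree obtained from disjoint paths $P_{4p+1}$, $P_{4q+1}$, $P_{4r+1}$ (where $P_n$ is the path on $n$ vertices) by identifying three end-vertices, one from each path. **Theorem.** For all integers $p,q,r\ge 1$, the tree $T_{p,q,r}$ is $(2(p+q+r)+1)$-$\gamma_g$-critical; that is, $\gamma_g(T_{p,q,r})=2(p+q+r)+1$ and $\gamma_g(T_{p,q,r}|v)\le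 2(p+q+r)$ for every vertex $v$ of $T_{p,q,r}$. Moreover, $\gamma_g'(T_{p,q,r})=2(p+q+r)+1$. -/

import Mathlib

/-! # The domination game and three-legged spiders -/

namespace DominationGame

variable {V : Type*} [Fintype V] [DecidableEq V]

/-- The closed neighbourhood of `x`: the set of vertices dominated by `x`. -/
def closedNbhd (G : SimpleGraph V) [DecidableRel G.Adj] (x : V) : Finset V :=
  Finset.univ.filter fun y => y = x ∨ G.Adj x y

/-- The legal moves in the partially dominated graph `G|S`: the vertices that dominate at least
one vertex outside the set `S` of vertices that are already dominated. -/
def legalMoves (G : SimpleGraph V) [DecidableRel G.Adj] (S : Finset V) : Finset V :=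
  Finset.univ.filter fun x => ∃ y ∈ closedNbhd G x, y ∉ S

/-- A legal move makes the set of undominated vertices strictly smaller. -/
theorem card_compl_lt {G : SimpleGraph V} [DecidableRel G.Adj] {S : Finset V} {x : V}
    (hx : x ∈ legalMoves G S) : (S ∪ closedNbhd G x)ᶜ.card < Sᶜ.card := by
  obtain ⟨y, hy, hyS⟩ := (Finset.mem_filter.1 hx).2
  refine Finset.card_lt_card ((Finset.ssubset_iff_of_subset ?_).2 ⟨y, ?_, ?_⟩)
  · exact Finset.compl_subset_compl.2 Finset.subset_union_left
  · exact Finset.mem_compl.2 hyS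
  · simp [hy]

/-- The two players of the game. -/
inductive Player where
  | dominator
  | staller

/-- The number of moves still to be played in the domination game on `G` under optimal play, when
`S` is the set of vertices that are already dominated and the given player has the next move.
The players alternate; each move is a legal one, after which its closed neighbourhood is dominated
as well; the game ends when no legal move is left. Dominator minimizes and Staller maximizes the
number of moves. -/
def gameNumber (G : SimpleGraph V) [DecidableRel G.Adj] : Player → Finset V → ℕ
  | .dominator, S =>
    if h : (legalMoves G S).attach.Nonempty then
      1 + (legalMoves G S).attach.inf' h fun x => gameNumber G .staller (S ∪ closedNbhd G x.1)
    else 0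
  | .staller, S =>
    if h : (legalMoves G S).attach.Nonempty then
      1 + (legalMoves G S).attach.sup' h fun x => gameNumber G .dominator (S ∪ closedNbhd G x.1)
    else 0
termination_by _ S => Sᶜ.card
decreasing_by
  all_goals exact card_compl_lt x.2

/-- `γ_g(G|S)`: the number of moves of the game on `G|S` when Dominator moves first. -/
def gammaG (G : SimpleGraph V) [DecidableRel G.Adj] (S : Finset V) : ℕ :=
  gameNumber G .dominator S

/-- `γ_g'(G|S)`: the number of moves of the game on `G|S` when Staller moves first. -/
def gammaG' (G : SimpleGraph V) [DecidableRel G.Adj] (S : Finset V) : ℕ :=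
  gameNumber G .staller S

/-- `G` is domination game critical: `γ_g(G|v) < γ_g(G)` for every vertex `v`. -/
def IsCritical (G : SimpleGraph V) [DecidableRel G.Adj] : Prop :=
  ∀ v : V, gammaG G {v} < gammaG G ∅

/-- `G` is `k`-`γ_g`-critical: it is domination game critical and `γ_g(G) = k`. -/
def IsKCritical (k : ℕ) (G : SimpleGraph V) [DecidableRel G.Adj] : Prop :=
  IsCritical G ∧ gammaG G ∅ = k

/-- The vertices of the spider with three legs of `n 0`, `n 1`, `n 2` vertices besides the centre:
`none` is the centre, `some ⟨i, j⟩` is the vertex at distance `j + 1` from it on the `i`-th leg. -/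
abbrev SpiderVertex (n : Fin 3 → ℕ) : Type := Option (Σ i : Fin 3, Fin (n i))

/-- The leg to which a vertex belongs and its distance from the centre determine adjacency: the
centre is adjacent to the first vertex of every leg, and vertices on a common leg are adjacent if
they are consecutive. -/
def spiderAdj (n : Fin 3 → ℕ) : SpiderVertex n → SpiderVertex n → Prop
  | none, none => False
  | none, some y => y.2.val = 0
  | some x, none => x.2.val = 0
  | some x, some y => x.1 = y.1 ∧ (x.2.val + 1 = y.2.val ∨ y.2.val + 1 = x.2.val)

instance (n : Fin 3 → ℕ) : DecidableRel (spiderAdj n)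
  | none, none => inferInstanceAs (Decidable False)
  | none, some y => inferInstanceAs (Decidable (y.2.val = 0))
  | some x, none => inferInstanceAs (Decidable (x.2.val = 0))
  | some x, some y =>
    inferInstanceAs (Decidable (x.1 = y.1 ∧ (x.2.val + 1 = y.2.val ∨ y.2.val + 1 = x.2.val)))

/-- The tree obtained from three disjoint paths with `n 0 + 1`, `n 1 + 1`, `n 2 + 1` vertices by
identifying one end-vertex of each. -/
def spider (n : Fin 3 → ℕ) : SimpleGraph (SpiderVertex n) where
  Adj := spiderAdj n
  symm := ⟨by
    rintro (_ | x) (_ | y) h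
    · exact h
    · exact h
    · exact h
    · exact ⟨h.1.symm, h.2.symm⟩⟩
  loopless := ⟨by
    rintro (_ | x) h
    · exact h
    · have h2 := h.2
      omega⟩

instance (n : Fin 3 → ℕ) : DecidableRel (spider n).Adj :=
  inferInstanceAs (DecidableRel (spiderAdj n))

/-- The three-legged spider `T_{p,q,r}`, glued from the paths `P_{4p+1}`, `P_{4q+1}`,
`P_{4r+1}`. -/
abbrev spiderT (p q r : ℕ) : SimpleGraph (SpiderVertex ![4 * p, 4 * q, 4 * r]) :=
  spider ![4 * p, 4 * q, 4 * r]

end DominationGame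

/-! The undominated vertices are cut into runs, that is, paths in which a dominated vertex sees at
most one end. Dominator can dominate three vertices of a run in one move and Staller wants to
dominate only one, so four vertices cost two moves. The rest depends on the lengths modulo four. The
players first compete for the runs of residue 3, where Dominator clears the residue in one move and
Staller reduces it to 2; then for those of residue 2 in the same way; a residue 1 costs one move
whoever plays. Hence in `runsD` and `runsS` each nonzero residue counts once, and the terms with a
division count the runs of residue 3, and then of residue 2, that Staller reaches first.

Upper bounds. `IsRuns.gameNumber_le` says that Dominator achieves these values on any arrangement in
runs. On the spider he opens at the centre, which leaves three runs of residue 3 and gives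
2(p+q+r)+1. If Staller starts, he answers at the centre. If one vertex is already dominated, he
saves a move by opening at the centre, at the head of a leg, or at the third vertex of a leg. The
third vertex leaves the centre undominated between two whole legs; `Open.gameNumber_le` shows that
this part still behaves like a single run of residue 1.

Lower bounds. Staller needs moves that dominate a single vertex. They exist at the flanks of runs,
but a move at the centre may shorten several runs at once. `Conf.le_gameNumber` and
`Open.le_gameNumber` show that with two runs at the centre she still gets the value for disjoint
runs. For the full spider a count of vertices suffices: there are 4(p+q+r)+1 of them, and if
Dominator never dominated more than three in a move, 2(p+q+r)+1 moves would follow. Only the centre,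
with its three neighbours, can give him four. `Tri.low_le` shows that Staller can keep the lengths
such that this gains him nothing. If Staller starts, she plays the second vertex of a leg and
`Open.le_gameNumber` applies. -/

namespace DominationGame

set_option linter.unusedSectionVars false

/-! ### Arrangements of the undominated vertices in runs, and how a move changes them -/

variable {V : Type*} [Fintype V] [DecidableEq V]

/-- The vertices that occur in a multiset of lists, with multiplicity. -/
def verts (L : Multiset (List V)) : Multiset V :=
  (L.map fun l => (l : Multiset V)).sum

@[simp] theorem verts_zero : verts (0 : Multiset (List V)) = 0 := rfl

@[simp] theorem verts_cons (l : List V) (L : Multiset (List V)) :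
    verts (l ::ₘ L) = (l : Multiset V) + verts L := by
  simp [verts]

theorem verts_add (L M : Multiset (List V)) : verts (L + M) = verts L + verts M := by
  simp [verts]

theorem mem_verts {L : Multiset (List V)} {v : V} : v ∈ verts L ↔ ∃ l ∈ L, v ∈ l := by
  induction L using Multiset.induction_on with
  | empty => simp
  | cons l L ih => simp [ih]

theorem nodup_verts_cons {l : List V} {L : Multiset (List V)} :
    (verts (l ::ₘ L)).Nodup ↔
      l.Nodup ∧ (verts L).Nodup ∧ ∀ v ∈ l, ∀ k ∈ L, v ∉ k := by
  rw [verts_cons, Multiset.nodup_add, Multiset.coe_nodup, Multiset.disjoint_left]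
  refine and_congr_right fun _ => and_congr_right fun _ => forall_congr' fun v => ?_
  simp only [Multiset.mem_coe, mem_verts, not_exists, not_and]

theorem eq_of_mem_of_mem {L : Multiset (List V)} (h : (verts L).Nodup) {k l : List V} {v : V}
    (hk : k ∈ L) (hl : l ∈ L) (hvk : v ∈ k) (hvl : v ∈ l) : k = l := by
  obtain ⟨R, rfl⟩ := Multiset.exists_cons_of_mem hk
  rcases Multiset.mem_cons.1 hl with rfl | hl
  · rfl
  · exact absurd hvl ((nodup_verts_cons.1 h).2.2 v hvk l hl)

theorem nodup_of_mem {L : Multiset (List V)} (h : (verts L).Nodup) {l : List V} (hl : l ∈ L) :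
    l.Nodup := by
  obtain ⟨R, rfl⟩ := Multiset.exists_cons_of_mem hl
  exact (nodup_verts_cons.1 h).1

theorem nodup_verts_map_filter {L : Multiset (List V)} (h : (verts L).Nodup) (P : V → Bool) :
    (verts (L.map (List.filter P))).Nodup := by
  induction L using Multiset.induction_on with
  | empty => simp
  | cons l L ih =>
    rw [Multiset.map_cons, nodup_verts_cons]
    obtain ⟨h1, h2, h3⟩ := nodup_verts_cons.1 h
    refine ⟨h1.filter _, ih h2, ?_⟩
    intro v hv k hk
    obtain ⟨k', hk', rfl⟩ := Multiset.mem_map.1 hk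
    intro hvk
    exact h3 v (List.mem_filter.1 hv).1 k' hk' (List.mem_filter.1 hvk).1

/-- The set `T` contains at most one element of the list `l`, and that is the first or the last. -/
def MeetsEnd (T : Finset V) (l : List V) : Prop :=
  (∀ y ∈ l, y ∉ T) ∨ (∃ u t, l = u :: t ∧ u ∈ T ∧ ∀ y ∈ t, y ∉ T) ∨
    ∃ t u, l = t ++ [u] ∧ u ∈ T ∧ ∀ y ∈ t, y ∉ T

/-- The undominated vertices of `G|S` are arranged in the lists of `L`: an undominated vertex is
adjacent to its neighbours in its list and to no other undominated vertices, and a dominated vertex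
has at most one neighbour in each list, at one of its ends. -/
structure IsRuns (G : SimpleGraph V) [DecidableRel G.Adj] (S : Finset V)
    (L : Multiset (List V)) : Prop where
  nodup : (verts L).Nodup
  mem_iff : ∀ v, v ∈ verts L ↔ v ∉ S
  inner : ∀ p x q, p ++ x :: q ∈ L → ∀ y ∉ S,
    (y ∈ closedNbhd G x ↔ y = x ∨ y ∈ p.getLast? ∨ y ∈ q.head?)
  outer : ∀ x ∈ S, ∀ l ∈ L, MeetsEnd (closedNbhd G x) l

variable {G : SimpleGraph V} [DecidableRel G.Adj] {S : Finset V} {L R : Multiset (List V)}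

theorem mem_closedNbhd {x y : V} : y ∈ closedNbhd G x ↔ y = x ∨ G.Adj x y := by
  simp [closedNbhd]

theorem self_mem_closedNbhd (x : V) : x ∈ closedNbhd G x := by simp [closedNbhd]

theorem mem_closedNbhd_comm {x y : V} : y ∈ closedNbhd G x ↔ x ∈ closedNbhd G y := by
  simp [closedNbhd, G.adj_comm, eq_comm]

/-- Deleting one end of a list keeps the other end in place. If the element of `U` is the deleted
one, nothing of `U` is left. -/
theorem MeetsEnd.filter {T U : Finset V} {l : List V} (hT : MeetsEnd T l) (hU : MeetsEnd U l) :
    MeetsEnd U (l.filter (· ∉ T)) := by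
  rcases hT with h | ⟨u, t, rfl, hu, ht⟩ | ⟨t, u, rfl, hu, ht⟩
  · rwa [List.filter_eq_self.2 (by simpa using h)]
  · rw [List.filter_cons_of_neg (by simpa using hu), List.filter_eq_self.2 (by simpa using ht)]
    rcases hU with h | ⟨w, s, hs, hw, h⟩ | ⟨s, w, hs, hw, h⟩
    · exact .inl fun y hy => h y (by simp [hy])
    · obtain ⟨rfl, rfl⟩ := List.cons.inj hs
      exact .inl h
    · rcases s with _ | ⟨v, s⟩
      · obtain ⟨rfl, rfl⟩ := List.cons.inj hs
        exact .inl (by simp)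
      · obtain ⟨rfl, rfl⟩ := List.cons.inj hs
        exact .inr (.inr ⟨s, w, rfl, hw, fun y hy => h y (by simp [hy])⟩)
  · rw [List.filter_append, List.filter_cons_of_neg (by simpa using hu),
      List.filter_eq_self.2 (by simpa using ht), List.filter_nil, List.append_nil]
    rcases hU with h | ⟨w, s, hs, hw, h⟩ | ⟨s, w, hs, hw, h⟩
    · exact .inl fun y hy => h y (by simp [hy])
    · rcases t with _ | ⟨v, t⟩
      · exact .inl (by simp)
      · obtain ⟨rfl, rfl⟩ := List.cons.inj hs
        exact .inr (.inl ⟨v, t, rfl, hw, fun y hy => h y (by simp [hy])⟩)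
    · obtain ⟨rfl, h2⟩ := List.append_inj' hs rfl
      exact .inl h

theorem IsRuns.exists_mem (h : IsRuns G S L) {v : V} (hv : v ∉ S) : ∃ l ∈ L, v ∈ l :=
  mem_verts.1 ((h.mem_iff v).2 hv)

theorem IsRuns.notMem (h : IsRuns G S L) {l : List V} {v : V} (hl : l ∈ L) (hv : v ∈ l) : v ∉ S :=
  (h.mem_iff v).1 (mem_verts.2 ⟨l, hl, hv⟩)

theorem IsRuns.card_compl (h : IsRuns G S L) : Sᶜ.card = (verts L).card := by
  have : Sᶜ.val = verts L := by
    rw [(Sᶜ.nodup).ext h.nodup]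
    intro v
    rw [h.mem_iff, Finset.mem_val, Finset.mem_compl]
  rw [← this, Finset.card_val]

/-- Neighbours in the list containing both. -/
theorem IsRuns.inner_of_mem (h : IsRuns G S L) {p q : List V} {x : V} (hl : p ++ x :: q ∈ L) {y : V}
    (hy : y ∉ S) (hxy : y ∈ closedNbhd G x) : y ∈ p ++ x :: q := by
  rcases (h.inner p x q hl y hy).1 hxy with rfl | h | h
  · simp
  · simp [List.mem_of_mem_getLast? h]
  · simp [List.mem_of_mem_head? h]

/-- A dominated vertex removes at most one end of each list. Such an end becomes a dominated vertex
whose only possible undominated neighbour is the new end of the same list. -/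
theorem IsRuns.play_outer (h : IsRuns G S L) {x : V} (hx : x ∈ S) :
    IsRuns G (S ∪ closedNbhd G x) (L.map (List.filter (· ∉ closedNbhd G x))) where
  nodup := nodup_verts_map_filter h.nodup _
  mem_iff v := by
    have := h.mem_iff v
    rw [mem_verts] at this ⊢
    simp only [Multiset.mem_map, Finset.mem_union, not_or, ← this]
    constructor
    · rintro ⟨_, ⟨l, hl, rfl⟩, hv⟩
      simp only [List.mem_filter, decide_eq_true_eq] at hv
      exact ⟨⟨l, hl, hv.1⟩, hv.2⟩
    · rintro ⟨⟨l, hl, hv⟩, hvx⟩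
      exact ⟨_, ⟨l, hl, rfl⟩, by simp [hv, hvx]⟩
  inner := by
    intro p z q hl y hy
    obtain ⟨l, hlL, hl⟩ := Multiset.mem_map.1 hl
    simp only [Finset.mem_union, not_or] at hy
    rcases h.outer x hx l hlL with h1 | ⟨u, t, rfl, hu, h1⟩ | ⟨t, u, rfl, hu, h1⟩
    · rw [List.filter_eq_self.2 (by simpa using h1)] at hl
      subst hl
      exact h.inner p z q hlL y hy.1
    · rw [List.filter_cons_of_neg (by simpa using hu),
        List.filter_eq_self.2 (by simpa using h1)] at hl
      subst hl
      rw [h.inner (u :: p) z q hlL y hy.1]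
      have hyu : y ≠ u := by rintro rfl; exact hy.2 hu
      rcases p with _ | ⟨w, p⟩
      · simp [hyu.symm]
      · simp
    · rw [List.filter_append, List.filter_cons_of_neg (by simpa using hu),
        List.filter_eq_self.2 (by simpa using h1), List.filter_nil, List.append_nil] at hl
      subst hl
      rw [h.inner p z (q ++ [u]) (by simpa using hlL) y hy.1]
      have hyu : y ≠ u := by rintro rfl; exact hy.2 hu
      rcases q with _ | ⟨w, q⟩
      · simp [hyu.symm]
      · simp
  outer := by
    intro z hz l' hl'
    obtain ⟨l, hl, rfl⟩ := Multiset.mem_map.1 hl'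
    by_cases hzS : z ∈ S
    · exact (h.outer x hx l hl).filter (h.outer z hzS l hl)
    · have hzx : z ∈ closedNbhd G x := by simpa [hzS] using hz
      obtain ⟨l0, hl0, hzl0⟩ := h.exists_mem hzS
      -- A newly dominated `z` was undominated before, so its undominated neighbours all lie in its
      -- own list.
      have key : ∀ y ∈ l, y ∈ closedNbhd G z → l = l0 := by
        intro y hy hyz
        obtain ⟨p, q, rfl⟩ := List.append_of_mem hzl0
        exact eq_of_mem_of_mem h.nodup hl hl0 hy (h.inner_of_mem hl0 (h.notMem hl hy) hyz)
      by_cases hll : l = l0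
      · subst hll
        have hnd := nodup_of_mem h.nodup hl
        rcases h.outer x hx l hl with h1 | ⟨u, t, rfl, hu, h1⟩ | ⟨t, u, rfl, hu, h1⟩
        · exact absurd hzx (h1 z hzl0)
        · have hzu : z = u := by
            rcases List.mem_cons.1 hzl0 with h2 | h2
            · exact h2
            · exact absurd hzx (h1 z h2)
          subst hzu
          rw [List.filter_cons_of_neg (by simpa using hu), List.filter_eq_self.2 (by simpa using h1)]
          have h3 := h.inner [] z t hl
          rcases t with _ | ⟨w, t⟩
          · exact .inl (by simp)
          · refine .inr (.inl ⟨w, t, rfl, ?_, fun y hy => ?_⟩)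
            · rw [h3 w (h.notMem hl (by simp))]; simp
            · rw [h3 y (h.notMem hl (by simp [hy]))]
              simp only [List.nodup_cons, List.mem_cons, not_or] at hnd
              simp only [List.getLast?_nil, List.head?_cons, Option.mem_def, Option.some.injEq,
                reduceCtorEq, false_or, not_or]
              refine ⟨?_, ?_⟩
              · rintro rfl; exact hnd.1.2 hy
              · rintro rfl; exact hnd.2.1 hy
        · have hzu : z = u := by
            rcases List.mem_append.1 hzl0 with h2 | h2
            · exact absurd hzx (h1 z h2)
            · simpa using h2
          subst hzu
          rw [List.filter_append, List.filter_cons_of_neg (by simpa using hu),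
            List.filter_eq_self.2 (by simpa using h1), List.filter_nil, List.append_nil]
          have h3 := h.inner t z [] hl
          rcases List.eq_nil_or_concat t with rfl | ⟨t, w, rfl⟩
          · exact .inl (by simp)
          · refine .inr (.inr ⟨t, w, by simp, ?_, fun y hy => ?_⟩)
            · rw [h3 w (h.notMem hl (by simp))]; simp
            · rw [h3 y (h.notMem hl (by simp [hy]))]
              simp only [List.concat_eq_append, List.append_assoc, List.nodup_append,
                List.cons_append, List.nil_append, List.mem_cons] at hnd
              have h4 := hnd.2.2 y hy
              simp only [List.concat_eq_append, List.getLast?_append, List.getLast?_singleton,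
                Option.some_or, List.head?_nil, Option.mem_def, Option.some.injEq,
                reduceCtorEq, or_false, not_or]
              exact ⟨h4 z (by simp), fun h5 => h4 w (by simp) h5.symm⟩
      · refine .inl fun y hy hyz => ?_
        exact hll (key y (List.mem_filter.1 hy).1 hyz)

/-- Declaring `x` dominated splits its list in two, and `x` then sees only the last vertex of `p`
and the first of `q`. This describes the passage to `G|x` and is also half of a move at `x`. -/
theorem IsRuns.predominate {p q : List V} {x : V} (h : IsRuns G S ((p ++ x :: q) ::ₘ R)) :
    IsRuns G (insert x S) (p ::ₘ q ::ₘ R) := by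
  obtain ⟨h1, h2, h3⟩ := nodup_verts_cons.1 h.nodup
  have hnd := h1
  rw [List.nodup_append, List.nodup_cons] at h1
  obtain ⟨hp, ⟨hxq, hq⟩, hpq⟩ := h1
  have hxp : x ∉ p := fun h => hpq x h x (by simp) rfl
  have hxR : ∀ k ∈ R, x ∉ k := h3 x (by simp)
  have hmem : p ++ x :: q ∈ (p ++ x :: q) ::ₘ R := Multiset.mem_cons_self _ _
  have hx := h.inner p x q hmem
  refine ⟨?_, ?_, ?_, ?_⟩
  · simp only [nodup_verts_cons, Multiset.mem_cons, forall_eq_or_imp]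
    refine ⟨hp, ⟨hq, h2, fun v hv k hk => h3 v (by simp [hv]) k hk⟩, fun v hv => ⟨fun hv' => ?_,
      fun k hk => h3 v (by simp [hv]) k hk⟩⟩
    exact hpq v hv v (by simp [hv']) rfl
  · intro v
    have := h.mem_iff v
    simp only [verts_cons, Multiset.mem_add, Multiset.mem_coe, List.mem_append,
      List.mem_cons, Finset.mem_insert, not_or] at this ⊢
    rw [← this]
    by_cases hv : v = x
    · subst hv
      have : v ∉ verts R := fun h => by
        obtain ⟨k, hk, hv⟩ := mem_verts.1 h
        exact hxR k hk hv
      simp [hxp, hxq, this]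
    · simp [hv, or_assoc]
  · intro p' z q' hl y hy
    simp only [Finset.mem_insert, not_or] at hy
    rcases Multiset.mem_cons.1 hl with rfl | hl
    · rw [h.inner p' z (q' ++ x :: q) (by simp) y hy.2]
      rcases q' with _ | ⟨w, q'⟩
      · simp [Ne.symm hy.1]
      · simp
    rcases Multiset.mem_cons.1 hl with rfl | hl
    · rw [h.inner (p ++ x :: p') z q' (by simp) y hy.2]
      rcases List.eq_nil_or_concat p' with rfl | ⟨p', w, rfl⟩
      · simp [Ne.symm hy.1]
      · simp [List.getLast?_append, List.getLast?_cons]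
    · exact h.inner p' z q' (Multiset.mem_cons_of_mem hl) y hy.2
  · intro z hz l hl
    rcases Finset.mem_insert.1 hz with rfl | hz
    · rcases Multiset.mem_cons.1 hl with rfl | hl
      · rcases List.eq_nil_or_concat l with rfl | ⟨t, w, rfl⟩
        · exact .inl (by simp)
        · refine .inr (.inr ⟨t, w, by simp, ?_, fun y hy => ?_⟩)
          · rw [hx w (h.notMem hmem (by simp))]; simp
          · rw [hx y (h.notMem hmem (by simp [hy]))]
            simp only [List.concat_eq_append, List.getLast?_append, List.getLast?_singleton,
                Option.some_or, Option.mem_def, Option.some.injEq, not_or]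
            refine ⟨?_, ?_, ?_⟩
            · rintro rfl; simp [hy] at hxp
            · rintro rfl
              simp only [List.concat_eq_append, List.nodup_append] at hp
              exact hp.2.2 w hy w (by simp) rfl
            · intro h5
              exact hpq y (by simp [hy]) y (by simp [List.mem_of_mem_head? h5]) rfl
      rcases Multiset.mem_cons.1 hl with rfl | hl
      · rcases l with _ | ⟨w, t⟩
        · exact .inl (by simp)
        · refine .inr (.inl ⟨w, t, rfl, ?_, fun y hy => ?_⟩)
          · rw [hx w (h.notMem hmem (by simp))]; simp
          · rw [hx y (h.notMem hmem (by simp [hy]))]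
            simp only [List.head?_cons, Option.mem_def, Option.some.injEq, not_or]
            refine ⟨?_, ?_, ?_⟩
            · rintro rfl; simp [hy] at hxq
            · intro h5
              exact hpq y (List.mem_of_mem_getLast? h5) y (by simp [hy]) rfl
            · rintro rfl
              simp [hy] at hq
      · refine .inl fun y hy hyz => ?_
        exact h3 y (h.inner_of_mem hmem (h.notMem (Multiset.mem_cons_of_mem hl) hy) hyz) l hl hy
    · rcases h.outer z hz _ hmem with h5 | ⟨u, t, h5, hu, ht⟩ | ⟨t, u, h5, hu, ht⟩
      · rcases Multiset.mem_cons.1 hl with rfl | hl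
        · exact .inl fun y hy => h5 y (by simp [hy])
        rcases Multiset.mem_cons.1 hl with rfl | hl
        · exact .inl fun y hy => h5 y (by simp [hy])
        · exact h.outer z hz l (Multiset.mem_cons_of_mem hl)
      · rcases Multiset.mem_cons.1 hl with rfl | hl
        · rcases l with _ | ⟨w, l⟩
          · exact .inl (by simp)
          · obtain ⟨rfl, rfl⟩ := List.cons.inj h5
            exact .inr (.inl ⟨w, l, rfl, hu, fun y hy => ht y (by simp [hy])⟩)
        rcases Multiset.mem_cons.1 hl with rfl | hl
        · refine .inl fun y hy => ht y ?_
          rcases p with _ | ⟨w, p⟩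
          · obtain ⟨rfl, rfl⟩ := List.cons.inj h5
            exact hy
          · obtain ⟨rfl, rfl⟩ := List.cons.inj h5
            simp [hy]
        · exact h.outer z hz l (Multiset.mem_cons_of_mem hl)
      · rcases Multiset.mem_cons.1 hl with rfl | hl
        · refine .inl fun y hy => ht y ?_
          rcases List.eq_nil_or_concat q with rfl | ⟨q, w, rfl⟩
          · obtain ⟨rfl, h6⟩ := List.append_inj' h5 rfl
            exact hy
          · have h5 : (l ++ x :: q) ++ [w] = t ++ [u] := by simpa using h5
            obtain ⟨rfl, h6⟩ := List.append_inj' h5 rfl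
            simp [hy]
        rcases Multiset.mem_cons.1 hl with rfl | hl
        · rcases List.eq_nil_or_concat l with rfl | ⟨q, w, rfl⟩
          · exact .inl (by simp)
          · have h5 : (p ++ x :: q) ++ [w] = t ++ [u] := by simpa using h5
            obtain ⟨rfl, h6⟩ := List.append_inj' h5 rfl
            obtain rfl : w = u := by simpa using h6
            exact .inr (.inr ⟨q, w, by simp, hu, fun y hy => ht y (by simp [hy])⟩)
        · exact h.outer z hz l (Multiset.mem_cons_of_mem hl)

/-- A move at `x` amounts to declaring `x` dominated and then playing it as a dominated vertex. -/
theorem IsRuns.play_inner {p q : List V} {x : V} (h : IsRuns G S ((p ++ x :: q) ::ₘ R)) :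
    IsRuns G (S ∪ closedNbhd G x) (p.dropLast ::ₘ q.tail ::ₘ R) := by
  obtain ⟨h1, h2, h3⟩ := nodup_verts_cons.1 h.nodup
  have hmem : p ++ x :: q ∈ (p ++ x :: q) ::ₘ R := Multiset.mem_cons_self _ _
  have hx := h.inner p x q hmem
  rw [List.nodup_append, List.nodup_cons] at h1
  obtain ⟨hp, ⟨hxq, hq⟩, hpq⟩ := h1
  have h4 := h.predominate.play_outer (Finset.mem_insert_self x S)
  have h5 : insert x S ∪ closedNbhd G x = S ∪ closedNbhd G x := by
    rw [Finset.insert_union, Finset.insert_eq_of_mem]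
    simp [self_mem_closedNbhd]
  rw [h5, Multiset.map_cons, Multiset.map_cons] at h4
  have e1 : p.filter (· ∉ closedNbhd G x) = p.dropLast := by
    rcases List.eq_nil_or_concat p with rfl | ⟨t, w, rfl⟩
    · rfl
    · have hw : w ∈ closedNbhd G x := by
        rw [hx w (h.notMem hmem (by simp))]; simp
      have ht : ∀ y ∈ t, y ∉ closedNbhd G x := by
        intro y hy hyx
        rcases (hx y (h.notMem hmem (by simp [hy]))).1 hyx with rfl | h6 | h6
        · exact hpq y (by simp [hy]) y (by simp) rfl
        · have : w = y := by simpa using h6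
          subst this
          simp only [List.concat_eq_append, List.nodup_append] at hp
          exact hp.2.2 w hy w (by simp) rfl
        · exact hpq y (by simp [hy]) y (by simp [List.mem_of_mem_head? h6]) rfl
      rw [List.concat_eq_append, List.filter_append, List.filter_cons_of_neg (by simpa using hw),
        List.filter_eq_self.2 (by simpa using ht)]
      simp
  have e2 : q.filter (· ∉ closedNbhd G x) = q.tail := by
    rcases q with _ | ⟨w, t⟩
    · rfl
    · have hw : w ∈ closedNbhd G x := by
        rw [hx w (h.notMem hmem (by simp))]; simp
      have ht : ∀ y ∈ t, y ∉ closedNbhd G x := by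
        intro y hy hyx
        rcases (hx y (h.notMem hmem (by simp [hy]))).1 hyx with rfl | h6 | h6
        · simp [hy] at hxq
        · exact hpq y (List.mem_of_mem_getLast? h6) y (by simp [hy]) rfl
        · have : w = y := by simpa using h6
          subst this
          simp [hy] at hq
      rw [List.filter_cons_of_neg (by simpa using hw), List.filter_eq_self.2 (by simpa using ht),
        List.tail_cons]
  have e3 : R.map (List.filter (· ∉ closedNbhd G x)) = R := by
    conv_rhs => rw [← Multiset.map_id R]
    refine Multiset.map_congr rfl fun l hl => ?_
    rw [id, List.filter_eq_self]
    intro y hy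
    rw [decide_eq_true_eq]
    intro hyx
    exact h3 y (h.inner_of_mem hmem (h.notMem (Multiset.mem_cons_of_mem hl) hy) hyx) l hl hy
  rwa [e1, e2, e3] at h4

/-! ### Elementary facts on the game -/

theorem mem_legalMoves {x : V} : x ∈ legalMoves G S ↔ ∃ y ∈ closedNbhd G x, y ∉ S := by
  simp [legalMoves]

theorem mem_legalMoves_of_notMem {x : V} (hx : x ∉ S) : x ∈ legalMoves G S :=
  mem_legalMoves.2 ⟨x, self_mem_closedNbhd x, hx⟩

theorem dominator_le {x : V} (hx : x ∈ legalMoves G S) :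
    gameNumber G .dominator S ≤ 1 + gameNumber G .staller (S ∪ closedNbhd G x) := by
  rw [gameNumber, dif_pos ⟨⟨x, hx⟩, Finset.mem_attach _ _⟩]
  exact Nat.add_le_add_left (Finset.inf'_le (fun x : legalMoves G S =>
    gameNumber G .staller (S ∪ closedNbhd G x.1)) (Finset.mem_attach _ ⟨x, hx⟩)) 1

theorem le_staller {x : V} (hx : x ∈ legalMoves G S) :
    1 + gameNumber G .dominator (S ∪ closedNbhd G x) ≤ gameNumber G .staller S := by
  rw [gameNumber.eq_def G .staller S]
  simp only
  rw [dif_pos ⟨⟨x, hx⟩, Finset.mem_attach _ _⟩]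
  exact Nat.add_le_add_left (Finset.le_sup' (fun x : legalMoves G S =>
    gameNumber G .dominator (S ∪ closedNbhd G x.1)) (Finset.mem_attach _ ⟨x, hx⟩)) 1

theorem staller_le {B : ℕ}
    (h : ∀ x ∈ legalMoves G S, 1 + gameNumber G .dominator (S ∪ closedNbhd G x) ≤ B) :
    gameNumber G .staller S ≤ B := by
  rw [gameNumber]
  split_ifs with hne
  · obtain ⟨x, -, hx⟩ := Finset.exists_mem_eq_sup' hne (fun x : legalMoves G S =>
      gameNumber G .dominator (S ∪ closedNbhd G x.1))
    rw [hx]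
    exact h x.1 x.2
  · exact Nat.zero_le _

theorem le_dominator {B : ℕ} {v : V} (hv : v ∉ S)
    (h : ∀ x ∈ legalMoves G S, B ≤ 1 + gameNumber G .staller (S ∪ closedNbhd G x)) :
    B ≤ gameNumber G .dominator S := by
  have hne : (legalMoves G S).attach.Nonempty :=
    ⟨⟨v, mem_legalMoves_of_notMem hv⟩, Finset.mem_attach _ _⟩
  rw [gameNumber, dif_pos hne]
  obtain ⟨x, -, hx⟩ := Finset.exists_mem_eq_inf' hne (fun x : legalMoves G S =>
      gameNumber G .staller (S ∪ closedNbhd G x.1))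
  rw [hx]
  exact h x.1 x.2

theorem dominator_eq_zero (h : ∀ v, v ∈ S) : gameNumber G .dominator S = 0 := by
  rw [gameNumber, dif_neg]
  rintro ⟨x, -⟩
  obtain ⟨y, -, hy⟩ := mem_legalMoves.1 x.2
  exact hy (h y)

/-! ### Run lengths modulo four -/

/-- The indicator of `k` being congruent to `i` modulo four. -/
def resInd (i k : ℕ) : ℕ := if k % 4 = i then 1 else 0

theorem resInd_spec (k : ℕ) :
    k = 4 * (k / 4) + resInd 1 k + 2 * resInd 2 k + 3 * resInd 3 k ∧
      resInd 1 k + resInd 2 k + resInd 3 k ≤ 1 := by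
  have : k % 4 < 4 := Nat.mod_lt _ (by norm_num)
  unfold resInd
  split_ifs <;> omega

theorem resInd_four_mul_add (i j k : ℕ) : resInd i (4 * j + k) = resInd i k := by
  simp [resInd]

theorem four_mul_add_div (j k : ℕ) : (4 * j + k) / 4 = j + k / 4 := by omega

theorem eq_zero_or_eq_succ (a : ℕ) : a = 0 ∨ ∃ j i, i < 4 ∧ a = 4 * j + i + 1 := by
  rcases a with _ | a
  · exact .inl rfl
  · exact .inr ⟨a / 4, a % 4, Nat.mod_lt _ (by norm_num), by omega⟩

/-- The sum of the quotients of the lengths by four. -/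
def quarters (L : Multiset (List V)) : ℕ := (L.map fun l => l.length / 4).sum

/-- The number of lists whose length is congruent to `i` modulo four. -/
def residues (i : ℕ) (L : Multiset (List V)) : ℕ := (L.map fun l => resInd i l.length).sum

@[simp] theorem quarters_zero : quarters (0 : Multiset (List V)) = 0 := rfl

@[simp] theorem residues_zero (i : ℕ) : residues i (0 : Multiset (List V)) = 0 := rfl

@[simp] theorem quarters_cons (l : List V) (L : Multiset (List V)) :
    quarters (l ::ₘ L) = l.length / 4 + quarters L := by
  simp [quarters]

@[simp] theorem residues_cons (i : ℕ) (l : List V) (L : Multiset (List V)) :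
    residues i (l ::ₘ L) = resInd i l.length + residues i L := by
  simp [residues]

@[simp] theorem quarters_singleton (l : List V) : quarters {l} = l.length / 4 := by
  simp [quarters]

@[simp] theorem residues_singleton (i : ℕ) (l : List V) : residues i {l} = resInd i l.length := by
  simp [residues]

theorem card_verts (L : Multiset (List V)) :
    (verts L).card = 4 * quarters L + residues 1 L + 2 * residues 2 L + 3 * residues 3 L := by
  induction L using Multiset.induction_on with
  | empty => simp
  | cons l L ih =>
    have := resInd_spec l.length
    simp only [verts_cons, Multiset.card_add, Multiset.coe_card, quarters_cons, residues_cons]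
    omega

theorem exists_of_residues_pos {i : ℕ} (h : 0 < residues i L) : ∃ l ∈ L, l.length % 4 = i := by
  induction L using Multiset.induction_on with
  | empty => simp at h
  | cons l L ih =>
    by_cases hl : l.length % 4 = i
    · exact ⟨l, by simp, hl⟩
    · obtain ⟨k, hk, h'⟩ := ih (by simpa [resInd, hl] using h)
      exact ⟨k, by simp [hk], h'⟩

/-- The number of moves on vertex disjoint runs when Dominator starts. -/
def runsD (m a b c : ℕ) : ℕ := 2 * m + a + b + c + c / 2 + (b + (c + 1) / 2) / 2

/-- The number of moves on vertex disjoint runs when Staller starts. -/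
def runsS (m a b c : ℕ) : ℕ := 2 * m + a + b + c + (c + 1) / 2 + (b + c / 2 + 1) / 2

/-- The number of moves on the runs of `L` when Dominator starts. -/
def valueD (L : Multiset (List V)) : ℕ :=
  runsD (quarters L) (residues 1 L) (residues 2 L) (residues 3 L)

/-- The number of moves on the runs of `L` when Staller starts. -/
def valueS (L : Multiset (List V)) : ℕ :=
  runsS (quarters L) (residues 1 L) (residues 2 L) (residues 3 L)

/-- The number `eᵢ` counts the runs of residue `i` that lose a vertex. Those of residue 0 lose a
full quarter and turn into residue 3. -/
theorem residues_map_filter (P : V → Bool)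
    (h : ∀ l ∈ L, (l.filter P).length = l.length ∨ (l.filter P).length + 1 = l.length) :
    ∃ e₀ e₁ e₂ e₃, quarters (L.map (List.filter P)) + e₀ = quarters L ∧
      residues 1 (L.map (List.filter P)) + e₁ = residues 1 L + e₂ ∧
      residues 2 (L.map (List.filter P)) + e₂ = residues 2 L + e₃ ∧
      residues 3 (L.map (List.filter P)) + e₃ = residues 3 L + e₀ := by
  induction L using Multiset.induction_on with
  | empty => exact ⟨0, 0, 0, 0, by simp⟩
  | cons l L ih =>
    obtain ⟨e₀, e₁, e₂, e₃, h1, h2, h3, h4⟩ :=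
      ih fun k hk => h k (Multiset.mem_cons_of_mem hk)
    have hl := h l (Multiset.mem_cons_self _ _)
    simp only [Multiset.map_cons, quarters_cons, residues_cons]
    rcases hl with hl | hl
    · rw [hl]
      exact ⟨e₀, e₁, e₂, e₃, by omega⟩
    · rw [← hl]
      generalize (l.filter P).length = k
      obtain ⟨j, i, hi, rfl⟩ : ∃ j i, i < 4 ∧ k = 4 * j + i :=
        ⟨k / 4, k % 4, Nat.mod_lt _ (by norm_num), by omega⟩
      rw [add_assoc]
      simp only [resInd_four_mul_add, four_mul_add_div]
      interval_cases i
      · exact ⟨e₀, e₁ + 1, e₂, e₃, by norm_num [resInd]; omega⟩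
      · exact ⟨e₀, e₁, e₂ + 1, e₃, by norm_num [resInd]; omega⟩
      · exact ⟨e₀, e₁, e₂, e₃ + 1, by norm_num [resInd]; omega⟩
      · exact ⟨e₀ + 1, e₁, e₂, e₃, by norm_num [resInd]; omega⟩

theorem MeetsEnd.length_filter {T : Finset V} {l : List V} (h : MeetsEnd T l) :
    (l.filter (· ∉ T)).length = l.length ∨ (l.filter (· ∉ T)).length + 1 = l.length := by
  rcases h with h | ⟨u, t, rfl, hu, ht⟩ | ⟨t, u, rfl, hu, ht⟩
  · rw [List.filter_eq_self.2 (by simpa using h)]; simp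
  · rw [List.filter_cons_of_neg (by simpa using hu), List.filter_eq_self.2 (by simpa using ht)]
    simp
  · rw [List.filter_append, List.filter_cons_of_neg (by simpa using hu),
      List.filter_eq_self.2 (by simpa using ht), List.filter_nil, List.append_nil]
    simp

/-! ### Dominator's strategy on runs -/

/-- A move with `a` vertices before it and `b` after it leaves pieces of lengths `a - 1` and `b -
1`. The truncated subtraction covers moves at an end of the run. Writing positive lengths as `4 * j
+ i + 1` reduces this and the similar inequalities below to a finite check of residues. -/
theorem runs_staller_inner {k a b m n₁ n₂ n₃ : ℕ} (h : a + b + 1 = k) :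
    1 + runsD ((a - 1) / 4 + ((b - 1) / 4 + m)) (resInd 1 (a - 1) + (resInd 1 (b - 1) + n₁))
        (resInd 2 (a - 1) + (resInd 2 (b - 1) + n₂)) (resInd 3 (a - 1) + (resInd 3 (b - 1) + n₃)) ≤
      runsS (k / 4 + m) (resInd 1 k + n₁) (resInd 2 k + n₂) (resInd 3 k + n₃) := by
  rcases eq_zero_or_eq_succ a with rfl | ⟨s, i, hi, rfl⟩ <;>
  rcases eq_zero_or_eq_succ b with rfl | ⟨t, j, hj, rfl⟩
  · subst h
    simp [resInd, runsD, runsS]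
    omega
  · obtain rfl : k = 4 * t + (j + 2) := by omega
    interval_cases j <;>
      simp only [Nat.add_sub_cancel, resInd_four_mul_add, four_mul_add_div] <;>
      norm_num [resInd] <;> unfold runsD runsS <;> omega
  · obtain rfl : k = 4 * s + (i + 2) := by omega
    interval_cases i <;>
      simp only [Nat.add_sub_cancel, resInd_four_mul_add, four_mul_add_div] <;>
      norm_num [resInd] <;> unfold runsD runsS <;> omega
  · obtain rfl : k = 4 * (s + t) + (i + j + 3) := by omega
    interval_cases i <;> interval_cases j <;>
      simp only [Nat.add_sub_cancel, resInd_four_mul_add, four_mul_add_div] <;>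
      norm_num [resInd] <;> unfold runsD runsS <;> omega

/-- Dominator plays the second vertex of a run of length `k`, with `n` vertices beyond it, or the
only vertex. The hypotheses `h3` and `h2` express his priorities: residue 3 before residue 2 before
the rest. -/
theorem runs_dominator {k n m n₁ n₂ n₃ : ℕ} (h : n + 2 = k ∨ n = 0 ∧ k = 1)
    (h3 : 0 < resInd 3 k + n₃ → k % 4 = 3)
    (h2 : 0 < resInd 2 k + n₂ → 0 < resInd 3 k + n₃ ∨ k % 4 = 2) :
    1 + runsS ((n - 1) / 4 + m) (resInd 1 (n - 1) + n₁) (resInd 2 (n - 1) + n₂)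
        (resInd 3 (n - 1) + n₃) ≤
      runsD (k / 4 + m) (resInd 1 k + n₁) (resInd 2 k + n₂) (resInd 3 k + n₃) := by
  rcases h with rfl | ⟨rfl, rfl⟩
  · rcases eq_zero_or_eq_succ n with rfl | ⟨s, i, hi, rfl⟩
    · norm_num [resInd] at h3 h2 ⊢
      unfold runsD runsS
      omega
    · rw [show 4 * s + i + 1 + 2 = 4 * s + (i + 3) by omega] at *
      interval_cases i <;>
        simp only [Nat.add_sub_cancel, resInd_four_mul_add, four_mul_add_div] at * <;>
        norm_num [resInd, Nat.mul_add_mod] at h3 h2 ⊢ <;> unfold runsD runsS <;> omega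
  · norm_num [resInd] at h3 h2 ⊢
    unfold runsD runsS
    omega

theorem runs_staller_outer {m n₁ n₂ n₃ m' n₁' n₂' n₃' e₀ e₁ e₂ e₃ : ℕ} (h0 : m' + e₀ = m)
    (h1 : n₁' + e₁ = n₁ + e₂) (h2 : n₂' + e₂ = n₂ + e₃) (h3 : n₃' + e₃ = n₃ + e₀)
    (h4 : 0 < e₀ + e₁ + e₂ + e₃) :
    1 + runsD m' n₁' n₂' n₃' ≤ runsS m n₁ n₂ n₃ := by
  unfold runsD runsS
  omega

/-- Dominator always plays the second vertex of a run, preferring residue 3, then residue 2. No move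
of Staller gains more than `valueS` allows, even if it shortens several runs at once. -/
theorem IsRuns.gameNumber_le (h : IsRuns G S L) :
    gameNumber G .dominator S ≤ valueD L ∧ gameNumber G .staller S ≤ valueS L := by
  induction hn : Sᶜ.card using Nat.strong_induction_on generalizing S L with
  | _ n ih =>
    subst hn
    constructor
    · by_cases hS : ∀ v, v ∈ S
      · rw [dominator_eq_zero hS]; exact Nat.zero_le _
      push Not at hS
      obtain ⟨v, hv⟩ := hS
      obtain ⟨l, hl, hl0, hl1, hl2⟩ : ∃ l ∈ L, l ≠ [] ∧
          (0 < residues 3 L → l.length % 4 = 3) ∧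
          (0 < residues 2 L → 0 < residues 3 L ∨ l.length % 4 = 2) := by
        by_cases h3 : 0 < residues 3 L
        · obtain ⟨l, hl, h'⟩ := exists_of_residues_pos h3
          exact ⟨l, hl, by rintro rfl; simp at h', fun _ => h', fun _ => .inl h3⟩
        by_cases h2 : 0 < residues 2 L
        · obtain ⟨l, hl, h'⟩ := exists_of_residues_pos h2
          exact ⟨l, hl, by rintro rfl; simp at h', fun h => absurd h h3, fun _ => .inr h'⟩
        · obtain ⟨l, hl, h'⟩ := h.exists_mem hv
          exact ⟨l, hl, List.ne_nil_of_mem h', fun h => absurd h h3, fun h => absurd h h2⟩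
      obtain ⟨R, rfl⟩ := Multiset.exists_cons_of_mem hl
      obtain ⟨p, x, q, rfl, hp⟩ : ∃ p x q, l = p ++ x :: q ∧
          ((p.length = 1) ∨ (p.length = 0 ∧ q.length = 0)) := by
        rcases l with _ | ⟨a, _ | ⟨b, l⟩⟩
        · exact absurd rfl hl0
        · exact ⟨[], a, [], rfl, .inr ⟨rfl, rfl⟩⟩
        · exact ⟨[a], b, l, rfl, .inl rfl⟩
      have hx : x ∈ legalMoves G S := mem_legalMoves_of_notMem (h.notMem hl (by simp))
      refine (dominator_le hx).trans ?_
      have := (ih _ (card_compl_lt hx) h.play_inner rfl).2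
      refine (Nat.add_le_add_left this 1).trans ?_
      simp only [residues_cons] at hl1 hl2
      simp only [valueS, valueD, quarters_cons, residues_cons, List.length_dropLast,
        List.length_tail]
      have hp0 : p.length - 1 = 0 := by omega
      rw [hp0]
      simpa [resInd] using runs_dominator (k := (p ++ x :: q).length) (n := q.length)
        (by rw [List.length_append, List.length_cons]; omega) hl1 hl2
    · refine staller_le fun x hx => ?_
      by_cases hxS : x ∈ S
      · have h1 := h.play_outer hxS
        obtain ⟨e₀, e₁, e₂, e₃, h2, h3, h4, h5⟩ :=
          residues_map_filter (· ∉ closedNbhd G x) fun l hl => (h.outer x hxS l hl).length_filter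
        refine (Nat.add_le_add_left (ih _ (card_compl_lt hx) h1 rfl).1 1).trans ?_
        refine runs_staller_outer h2 h3 h4 h5 ?_
        -- The move is legal, so at least one run is shortened and some `eᵢ` is positive.
        have := card_compl_lt hx
        rw [h.card_compl, h1.card_compl, card_verts, card_verts] at this
        omega
      · obtain ⟨l, hl, hxl⟩ := h.exists_mem hxS
        obtain ⟨R, rfl⟩ := Multiset.exists_cons_of_mem hl
        obtain ⟨p, q, rfl⟩ := List.append_of_mem hxl
        refine (Nat.add_le_add_left (ih _ (card_compl_lt hx) h.play_inner rfl).1 1).trans ?_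
        simp only [valueS, valueD, quarters_cons, residues_cons, List.length_dropLast,
          List.length_tail]
        exact runs_staller_inner (by simp; omega)

variable {A : Multiset (List V)} {c : V}

@[simp] theorem quarters_add (L M : Multiset (List V)) :
    quarters (L + M) = quarters L + quarters M := by
  simp [quarters]

@[simp] theorem residues_add (i : ℕ) (L M : Multiset (List V)) :
    residues i (L + M) = residues i L + residues i M := by
  simp [residues]

/-! ### Runs around a centre -/

/-- Some dominated vertex other than `c` dominates a vertex of the list `l`. -/
def Flanked (G : SimpleGraph V) [DecidableRel G.Adj] (S : Finset V) (c : V) (l : List V) : Prop :=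
  ∃ x ∈ S, x ≠ c ∧ ∃ y ∈ l, y ∈ closedNbhd G x

theorem Flanked.mono {T : Finset V} {l : List V} (h : Flanked G S c l) (hST : S ⊆ T) :
    Flanked G T c l := by
  obtain ⟨x, hx, h⟩ := h
  exact ⟨x, hST hx, h⟩

/-- The undominated vertices form the runs in `A` and `R`, where `c` is a dominated vertex whose
undominated neighbours are the first vertices of the runs in `A`. All other dominated vertices
dominate at most one new vertex, which is the last one if it is on a run in `A`. -/
structure Conf (G : SimpleGraph V) [DecidableRel G.Adj] (S : Finset V) (c : V)
    (A R : Multiset (List V)) : Prop where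
  runs : IsRuns G S (A + R)
  mem : c ∈ S
  nbr : ∀ y ∉ S, (y ∈ closedNbhd G c ↔ ∃ l ∈ A, y ∈ l.head?)
  single : ∀ x ∈ S, x ≠ c → ∀ y ∉ S, ∀ z ∉ S, y ∈ closedNbhd G x → z ∈ closedNbhd G x → y = z
  last : ∀ x ∈ S, x ≠ c → ∀ l ∈ A, ∀ y ∈ l, y ∈ closedNbhd G x → y ∈ l.getLast?
  flankA : ∀ l ∈ A, 4 ∣ l.length ∨ Flanked G S c l
  flankR : ∀ l ∈ R, l = [] ∨ Flanked G S c l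

/-- A newly dominated vertex has at most one undominated neighbour. -/
theorem IsRuns.eq_of_new (h : IsRuns G S L) {x z y y' : V} (hz : z ∉ S)
    (hzx : z ∈ closedNbhd G x) (hy : y ∉ S ∪ closedNbhd G x) (hy' : y' ∉ S ∪ closedNbhd G x)
    (hyz : y ∈ closedNbhd G z) (hyz' : y' ∈ closedNbhd G z) : y = y' := by
  simp only [Finset.mem_union, not_or] at hy hy'
  obtain ⟨l, hl, hzl⟩ := h.exists_mem hz
  by_cases hx : x ∈ S
  · rcases h.outer x hx l hl with h1 | ⟨u, t, rfl, hu, h1⟩ | ⟨t, u, rfl, hu, h1⟩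
    · exact absurd hzx (h1 z hzl)
    · obtain rfl : z = u := by
        rcases List.mem_cons.1 hzl with h2 | h2
        · exact h2
        · exact absurd hzx (h1 z h2)
      have h3 := h.inner [] z t hl
      have key : ∀ y, y ∉ S → y ∉ closedNbhd G x → y ∈ closedNbhd G z → t.head? = some y := by
        intro y hy hyx hyz
        rcases (h3 y hy).1 hyz with rfl | h4 | h4
        · exact absurd hzx hyx
        · simp at h4
        · exact h4
      exact Option.some.inj ((key y hy.1 hy.2 hyz).symm.trans (key y' hy'.1 hy'.2 hyz'))
    · obtain rfl : z = u := by
        rcases List.mem_append.1 hzl with h2 | h2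
        · exact absurd hzx (h1 z h2)
        · simpa using h2
      have h3 := h.inner t z [] hl
      have key : ∀ y, y ∉ S → y ∉ closedNbhd G x → y ∈ closedNbhd G z → t.getLast? = some y := by
        intro y hy hyx hyz
        rcases (h3 y hy).1 hyz with rfl | h4 | h4
        · exact absurd hzx hyx
        · exact h4
        · simp at h4
      exact Option.some.inj ((key y hy.1 hy.2 hyz).symm.trans (key y' hy'.1 hy'.2 hyz'))
  · obtain ⟨p, q, rfl⟩ := List.append_of_mem hzl
    have h3 := h.inner p z q hl
    rcases (h3 x hx).1 (mem_closedNbhd_comm.1 hzx) with rfl | h4 | h4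
    · exact absurd hyz hy.2
    · have key : ∀ y, y ∉ S → y ∉ closedNbhd G x → y ∈ closedNbhd G z → q.head? = some y := by
        intro y hy hyx hyz
        rcases (h3 y hy).1 hyz with rfl | h5 | h5
        · exact absurd hzx hyx
        · obtain rfl : x = y := Option.some.inj (h4.symm.trans h5)
          exact absurd (self_mem_closedNbhd x) hyx
        · exact h5
      exact Option.some.inj ((key y hy.1 hy.2 hyz).symm.trans (key y' hy'.1 hy'.2 hyz'))
    · have key : ∀ y, y ∉ S → y ∉ closedNbhd G x → y ∈ closedNbhd G z → p.getLast? = some y := by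
        intro y hy hyx hyz
        rcases (h3 y hy).1 hyz with rfl | h5 | h5
        · exact absurd hzx hyx
        · exact h5
        · obtain rfl : x = y := Option.some.inj (h4.symm.trans h5)
          exact absurd (self_mem_closedNbhd x) hyx
      exact Option.some.inj ((key y hy.1 hy.2 hyz).symm.trans (key y' hy'.1 hy'.2 hyz'))

theorem Conf.single_union (h : Conf G S c A R) {x : V} :
    ∀ z ∈ S ∪ closedNbhd G x, z ≠ c → ∀ y ∉ S ∪ closedNbhd G x, ∀ y' ∉ S ∪ closedNbhd G x,
      y ∈ closedNbhd G z → y' ∈ closedNbhd G z → y = y' := by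
  intro z hz hzc y hy y' hy' hyz hyz'
  by_cases hzS : z ∈ S
  · exact h.single z hzS hzc y (fun h => hy (by simp [h])) y' (fun h => hy' (by simp [h])) hyz hyz'
  · exact h.runs.eq_of_new hzS (by simpa [hzS] using hz) hy hy' hyz hyz'

theorem Conf.ne_of_notMem (h : Conf G S c A R) {v : V} (hv : v ∉ S) : v ≠ c := by
  rintro rfl
  exact hv h.mem

/-- What has to be checked to see that a move, not at the centre, leads to a configuration. -/
theorem Conf.of_move (h : Conf G S c A R) {x : V} {A' R' : Multiset (List V)}
    (hruns : IsRuns G (S ∪ closedNbhd G x) (A' + R'))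
    (hA : ∀ l ∈ A', l ∈ A ∨ ∃ u r, l ++ u :: r ∈ A ∧ u ∈ closedNbhd G x)
    (hhead : ∀ l ∈ A, ∀ y ∈ l.head?, y ∉ closedNbhd G x → ∃ l' ∈ A', y ∈ l'.head?)
    (hR : ∀ l ∈ R', l = [] ∨ l ∈ R ∨ Flanked G (S ∪ closedNbhd G x) c l) :
    Conf G (S ∪ closedNbhd G x) c A' R' where
  runs := hruns
  mem := Finset.mem_union_left _ h.mem
  nbr := by
    intro y hy
    simp only [Finset.mem_union, not_or] at hy
    rw [h.nbr y hy.1]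
    constructor
    · rintro ⟨l, hl, hyl⟩
      exact hhead l hl y hyl hy.2
    · rintro ⟨l, hl, hyl⟩
      rcases hA l hl with h1 | ⟨u, r, h1, -⟩
      · exact ⟨l, h1, hyl⟩
      · refine ⟨_, h1, ?_⟩
        rcases l with _ | ⟨a, l⟩
        · simp at hyl
        · simpa using hyl
  single := h.single_union
  last := by
    intro z hz hzc l hl y hy hyz
    have hyS' := hruns.notMem (Multiset.mem_add.2 (.inl hl)) hy
    have hyS : y ∉ S := fun h => hyS' (Finset.mem_union_left _ h)
    by_cases hzS : z ∈ S
    · rcases hA l hl with h1 | ⟨u, r, h1, -⟩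
      · exact h.last z hzS hzc l h1 y hy hyz
      · have h2 := h.last z hzS hzc _ h1 y (by simp [hy]) hyz
        have h3 := nodup_of_mem h.runs.nodup (Multiset.mem_add.2 (.inl h1))
        rw [List.getLast?_append_of_ne_nil _ (by simp)] at h2
        rw [List.nodup_append] at h3
        exact absurd rfl (h3.2.2 y hy y (List.mem_of_mem_getLast? h2))
    · have hzx : z ∈ closedNbhd G x := by simpa [hzS] using hz
      -- A newly dominated `z` that sees a vertex of the shortened run `l` lies beyond it on the old
      -- run, so it can only see the last vertex of `l`.
      obtain ⟨l0, hl0, hzl0⟩ := h.runs.exists_mem hzS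
      obtain ⟨p, q, rfl⟩ := List.append_of_mem hzl0
      have hyl0 := h.runs.inner_of_mem hl0 hyS hyz
      rcases hA l hl with h1 | ⟨u, r, h1, -⟩
      · have h1' : l ∈ A + R := Multiset.mem_add.2 (.inl h1)
        obtain rfl := eq_of_mem_of_mem h.runs.nodup h1' hl0 hy hyl0
        exact absurd hz (hruns.notMem (Multiset.mem_add.2 (.inl hl)) hzl0)
      · have h1' : l ++ u :: r ∈ A + R := Multiset.mem_add.2 (.inl h1)
        have h2 := eq_of_mem_of_mem h.runs.nodup h1' hl0 (by simp [hy]) hyl0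
        rw [← h2] at hzl0
        have hzl : z ∉ l := fun hzl => hruns.notMem (Multiset.mem_add.2 (.inl hl)) hzl hz
        have hzr : z ∈ u :: r := (List.mem_append.1 hzl0).resolve_left hzl
        obtain ⟨p2, q2, h3⟩ := List.append_of_mem hzr
        have hnd := nodup_of_mem h.runs.nodup h1'
        rw [h3] at h1' hnd
        rw [List.nodup_append] at hnd
        have h4 := h.runs.inner (l ++ p2) z q2 (by simpa using h1') y hyS
        rcases h4.1 hyz with rfl | h5 | h5
        · exact absurd hy hzl
        · rcases List.eq_nil_or_concat p2 with rfl | ⟨p2, w, rfl⟩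
          · simpa using h5
          · obtain rfl : w = y := by simpa using h5
            exact absurd rfl (hnd.2.2 w hy w (by simp))
        · exact absurd rfl (hnd.2.2 y hy y (by simp [List.mem_of_mem_head? h5]))
  flankA := by
    intro l hl
    rcases hA l hl with h1 | ⟨u, r, h1, h2⟩
    · exact (h.flankA l h1).imp id fun h => h.mono Finset.subset_union_left
    · rcases List.eq_nil_or_concat l with rfl | ⟨t, w, rfl⟩
      · exact .inl (by simp)
      · have h1' : t.concat w ++ u :: r ∈ A + R := Multiset.mem_add.2 (.inl h1)
        have hu : u ∉ S := h.runs.notMem h1' (by simp)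
        -- A run that has been shortened is flanked by the dominated vertex `u` that used to follow
        -- it.
        refine .inr ⟨u, Finset.mem_union_right _ h2, h.ne_of_notMem hu, w, by simp, ?_⟩
        rw [h.runs.inner _ u r h1' w (h.runs.notMem h1' (by simp))]
        simp
  flankR := by
    intro l hl
    rcases hR l hl with h1 | h1 | h1
    · exact .inl h1
    · exact (h.flankR l h1).imp id fun h => h.mono Finset.subset_union_left
    · exact .inr h1

theorem Conf.flanked_dropLast (h : Conf G S c A R) {p q : List V} {x : V}
    (hl : p ++ x :: q ∈ A + R) : p.dropLast = [] ∨
      Flanked G (S ∪ closedNbhd G x) c p.dropLast := by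
  rcases List.eq_nil_or_concat p with rfl | ⟨t, w, rfl⟩
  · exact .inl rfl
  rcases List.eq_nil_or_concat t with rfl | ⟨t, v, rfl⟩
  · exact .inl rfl
  have hw : w ∉ S := h.runs.notMem hl (by simp)
  refine .inr ⟨w, ?_, h.ne_of_notMem hw, v, by simp, ?_⟩
  · refine Finset.mem_union_right _ ?_
    rw [h.runs.inner _ x q hl w hw]
    simp
  · rw [h.runs.inner (t.concat v) w (x :: q) (by simpa using hl) v (h.runs.notMem hl (by simp))]
    simp

theorem Conf.flanked_tail (h : Conf G S c A R) {p q : List V} {x : V}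
    (hl : p ++ x :: q ∈ A + R) : q.tail = [] ∨
      Flanked G (S ∪ closedNbhd G x) c q.tail := by
  rcases q with _ | ⟨w, _ | ⟨v, t⟩⟩
  · exact .inl rfl
  · exact .inl rfl
  have hw : w ∉ S := h.runs.notMem hl (by simp)
  refine .inr ⟨w, ?_, h.ne_of_notMem hw, v, by simp, ?_⟩
  · refine Finset.mem_union_right _ ?_
    rw [h.runs.inner _ x _ hl w hw]
    simp
  · rw [h.runs.inner (p ++ [x]) w (v :: t) (by simpa using hl) v (h.runs.notMem hl (by simp))]
    simp

theorem Conf.play_centre_run {A₀ : Multiset (List V)} {p q : List V} {x : V}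
    (h : Conf G S c ((p ++ x :: q) ::ₘ A₀) R) :
    Conf G (S ∪ closedNbhd G x) c (p.dropLast ::ₘ A₀) (q.tail ::ₘ R) := by
  have hmem : p ++ x :: q ∈ ((p ++ x :: q) ::ₘ A₀) + R := by simp
  have hx : x ∈ closedNbhd G x := self_mem_closedNbhd x
  have hlast : ∀ y ∈ p.getLast?, y ∈ closedNbhd G x := by
    intro y hy
    rw [h.runs.inner p x q hmem y
      (h.runs.notMem hmem (by simp [List.mem_of_mem_getLast? hy]))]
    exact .inr (.inl hy)
  refine h.of_move ?_ ?_ ?_ ?_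
  · have h1 := h.runs
    rw [Multiset.cons_add] at h1
    have := h1.play_inner
    rw [Multiset.cons_add, Multiset.add_cons]
    exact this
  · intro l hl
    rcases Multiset.mem_cons.1 hl with rfl | hl
    · right
      rcases List.eq_nil_or_concat p with rfl | ⟨t, w, rfl⟩
      · exact ⟨x, q, by simp, hx⟩
      · exact ⟨w, x :: q, by simp, hlast w (by simp)⟩
    · exact .inl (Multiset.mem_cons_of_mem hl)
  · intro l hl y hy hyx
    rcases Multiset.mem_cons.1 hl with rfl | hl
    · refine ⟨_, Multiset.mem_cons_self _ _, ?_⟩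
      rcases p with _ | ⟨w, _ | ⟨v, p⟩⟩
      · obtain rfl : x = y := by simpa using hy
        exact absurd hx hyx
      · obtain rfl : w = y := by simpa using hy
        exact absurd (hlast w (by simp)) hyx
      · simpa using hy
    · exact ⟨l, Multiset.mem_cons_of_mem hl, hy⟩
  · intro l hl
    rcases Multiset.mem_cons.1 hl with rfl | hl
    · exact (h.flanked_tail hmem).imp id .inr
    · exact .inr (.inl hl)

theorem Conf.play_run {R₀ : Multiset (List V)} {p q : List V} {x : V}
    (h : Conf G S c A ((p ++ x :: q) ::ₘ R₀)) :
    Conf G (S ∪ closedNbhd G x) c A (p.dropLast ::ₘ q.tail ::ₘ R₀) := by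
  have hmem : p ++ x :: q ∈ A + ((p ++ x :: q) ::ₘ R₀) := by simp
  refine h.of_move ?_ ?_ ?_ ?_
  · have h1 := h.runs
    rw [Multiset.add_cons] at h1
    have := h1.play_inner
    rw [Multiset.add_cons, Multiset.add_cons]
    exact this
  · exact fun l hl => .inl hl
  · exact fun l hl y hy _ => ⟨l, hl, hy⟩
  · intro l hl
    rcases Multiset.mem_cons.1 hl with rfl | hl
    · exact (h.flanked_dropLast hmem).imp id .inr
    rcases Multiset.mem_cons.1 hl with rfl | hl
    · exact (h.flanked_tail hmem).imp id .inr
    · exact .inr (.inl (Multiset.mem_cons_of_mem hl))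

/-- Since `x` dominates no new vertex except `y`, the other runs are unchanged, and `MeetsEnd`
forces `y` to be an end of `l`. -/
theorem IsRuns.play_end {l : List V} {x y : V} (h : IsRuns G S (l ::ₘ R)) (hx : x ∈ S)
    (hy : y ∈ l) (hyx : y ∈ closedNbhd G x) (hs : ∀ z ∉ S, z ∈ closedNbhd G x → z = y) :
    ∃ l', IsRuns G (S ∪ closedNbhd G x) (l' ::ₘ R) ∧ (l = y :: l' ∨ l = l' ++ [y]) := by
  have h1 := h.play_outer hx
  obtain ⟨-, -, hd⟩ := nodup_verts_cons.1 h.nodup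
  have e3 : R.map (List.filter (· ∉ closedNbhd G x)) = R := by
    conv_rhs => rw [← Multiset.map_id R]
    refine Multiset.map_congr rfl fun k hk => ?_
    rw [id, List.filter_eq_self]
    intro z hz
    rw [decide_eq_true_eq]
    intro hzx
    obtain rfl := hs z (h.notMem (Multiset.mem_cons_of_mem hk) hz) hzx
    exact hd z hy k hk hz
  rw [Multiset.map_cons, e3] at h1
  refine ⟨_, h1, ?_⟩
  have hm : l ∈ l ::ₘ R := Multiset.mem_cons_self _ _
  rcases h.outer x hx l hm with h2 | ⟨u, t, rfl, hu, h2⟩ | ⟨t, u, rfl, hu, h2⟩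
  · exact absurd hyx (h2 y hy)
  · obtain rfl := hs u (h.notMem hm (by simp)) hu
    left
    rw [List.filter_cons_of_neg (by simpa using hu), List.filter_eq_self.2 (by simpa using h2)]
  · obtain rfl := hs u (h.notMem hm (by simp)) hu
    right
    rw [List.filter_append, List.filter_cons_of_neg (by simpa using hu),
      List.filter_eq_self.2 (by simpa using h2), List.filter_nil, List.append_nil]

theorem Conf.play_flank_centre {A₀ : Multiset (List V)} {l : List V} {x y : V}
    (h : Conf G S c (l ::ₘ A₀) R) (hx : x ∈ S) (hxc : x ≠ c) (hy : y ∈ l)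
    (hyx : y ∈ closedNbhd G x) :
    ∃ l', l = l' ++ [y] ∧ Conf G (S ∪ closedNbhd G x) c (l' ::ₘ A₀) R := by
  have hmem : l ∈ (l ::ₘ A₀) + R := by simp
  have hyS := h.runs.notMem hmem hy
  have h1 := h.runs
  rw [Multiset.cons_add] at h1
  obtain ⟨l', h2, h3⟩ := h1.play_end hx hy hyx
    fun z hz hzx => h.single x hx hxc z hz y hyS hzx hyx
  have hl : l = l' ++ [y] := by
    rcases h3 with h3 | h3
    · have h4 := h.last x hx hxc l (by simp) y hy hyx
      have h5 := nodup_of_mem h.runs.nodup hmem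
      subst h3
      rcases List.eq_nil_or_concat l' with rfl | ⟨t, w, rfl⟩
      · rfl
      · obtain rfl : w = y := by
          simpa [List.getLast?_cons] using h4
        simp at h5
    · exact h3
  subst hl
  refine ⟨l', rfl, h.of_move ?_ ?_ ?_ ?_⟩
  · rwa [Multiset.cons_add]
  · intro k hk
    rcases Multiset.mem_cons.1 hk with rfl | hk
    · exact .inr ⟨y, [], by simp, hyx⟩
    · exact .inl (Multiset.mem_cons_of_mem hk)
  · intro k hk z hz hzx
    rcases Multiset.mem_cons.1 hk with rfl | hk
    · refine ⟨_, Multiset.mem_cons_self _ _, ?_⟩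
      rcases l' with _ | ⟨w, l'⟩
      · obtain rfl : y = z := by simpa using hz
        exact absurd hyx hzx
      · simpa using hz
    · exact ⟨k, Multiset.mem_cons_of_mem hk, hz⟩
  · exact fun k hk => .inr (.inl hk)

theorem Conf.play_flank_run {R₀ : Multiset (List V)} {l : List V} {x y : V}
    (h : Conf G S c A (l ::ₘ R₀)) (hx : x ∈ S) (hxc : x ≠ c) (hy : y ∈ l)
    (hyx : y ∈ closedNbhd G x) :
    ∃ l', l.length = l'.length + 1 ∧ Conf G (S ∪ closedNbhd G x) c A (l' ::ₘ R₀) := by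
  have hmem : l ∈ A + (l ::ₘ R₀) := by simp
  have hyS := h.runs.notMem hmem hy
  have h1 := h.runs
  rw [Multiset.add_cons] at h1
  obtain ⟨l', h2, h3⟩ := h1.play_end hx hy hyx
    fun z hz hzx => h.single x hx hxc z hz y hyS hzx hyx
  refine ⟨l', by rcases h3 with rfl | rfl <;> simp, h.of_move ?_ ?_ ?_ ?_⟩
  · rwa [Multiset.add_cons]
  · exact fun l hl => .inl hl
  · exact fun l hl y hy _ => ⟨l, hl, hy⟩
  · intro k hk
    rcases Multiset.mem_cons.1 hk with rfl | hk
    · have key : ∀ w ∈ k, w ∈ closedNbhd G y → Flanked G (S ∪ closedNbhd G x) c k :=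
        fun w hw hwy => ⟨y, Finset.mem_union_right _ hyx, h.ne_of_notMem hyS, w, hw, hwy⟩
      rcases h3 with rfl | rfl
      · rcases k with _ | ⟨w, t⟩
        · exact .inl rfl
        · refine .inr (.inr (key w (by simp) ?_))
          rw [h.runs.inner [] y _ hmem w (h.runs.notMem hmem (by simp))]
          simp
      · rcases List.eq_nil_or_concat k with rfl | ⟨t, w, rfl⟩
        · exact .inl rfl
        · refine .inr (.inr (key w (by simp) ?_))
          rw [h.runs.inner _ y [] hmem w (h.runs.notMem hmem (by simp))]
          simp
    · exact .inr (.inl (Multiset.mem_cons_of_mem hk))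

theorem Conf.notMem_closedNbhd (h : Conf G S c A R) {l : List V} {y : V} (hl : l ∈ R) (hy : y ∈ l) :
    y ∉ closedNbhd G c := by
  intro hyc
  obtain ⟨k, hk, hyk⟩ := (h.nbr y (h.runs.notMem (Multiset.mem_add.2 (.inr hl)) hy)).1 hyc
  obtain ⟨A, rfl⟩ := Multiset.exists_cons_of_mem hk
  have h1 := h.runs.nodup
  rw [Multiset.cons_add] at h1
  exact (nodup_verts_cons.1 h1).2.2 y (List.mem_of_mem_head? hyk) l
    (Multiset.mem_add.2 (.inr hl)) hy

/-- Each run at `c` loses its head, and the head then flanks the rest. No run starts at `c` any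
more, so all of them move to the second multiset. -/
theorem Conf.play_centre (h : Conf G S c A R) :
    Conf G (S ∪ closedNbhd G c) c 0 (A.map List.tail + R) where
  runs := by
    have h1 := h.runs.play_outer h.mem
    rw [Multiset.map_add] at h1
    have e1 : A.map (List.filter (· ∉ closedNbhd G c)) = A.map List.tail := by
      refine Multiset.map_congr rfl fun l hl => ?_
      have hl' : l ∈ A + R := Multiset.mem_add.2 (.inl hl)
      rcases l with _ | ⟨w, t⟩
      · rfl
      have hw : w ∈ closedNbhd G c :=
        (h.nbr w (h.runs.notMem hl' (by simp))).2 ⟨_, hl, by simp⟩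
      have ht : ∀ y ∈ t, y ∉ closedNbhd G c := by
        intro y hy hyc
        obtain ⟨k, hk, hyk⟩ := (h.nbr y (h.runs.notMem hl' (by simp [hy]))).1 hyc
        obtain rfl := eq_of_mem_of_mem h.runs.nodup (Multiset.mem_add.2 (.inl hk)) hl'
          (List.mem_of_mem_head? hyk) (by simp [hy])
        obtain rfl : w = y := by simpa using hyk
        have := nodup_of_mem h.runs.nodup hl'
        simp [hy] at this
      rw [List.filter_cons_of_neg (by simpa using hw), List.filter_eq_self.2 (by simpa using ht),
        List.tail_cons]
    have e2 : R.map (List.filter (· ∉ closedNbhd G c)) = R := by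
      conv_rhs => rw [← Multiset.map_id R]
      refine Multiset.map_congr rfl fun l hl => ?_
      rw [id, List.filter_eq_self]
      intro y hy
      rw [decide_eq_true_eq]
      exact h.notMem_closedNbhd hl hy
    rwa [e1, e2, ← zero_add (_ + R)] at h1
  mem := Finset.mem_union_left _ h.mem
  nbr := by
    intro y hy
    simp only [Finset.mem_union, not_or] at hy
    simp [hy.2]
  single := h.single_union
  last := by simp
  flankA := by simp
  flankR := by
    intro l hl
    rcases Multiset.mem_add.1 hl with hl | hl
    · obtain ⟨k, hk, rfl⟩ := Multiset.mem_map.1 hl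
      have hk' : k ∈ A + R := Multiset.mem_add.2 (.inl hk)
      rcases k with _ | ⟨w, _ | ⟨v, t⟩⟩
      · exact .inl rfl
      · exact .inl rfl
      · have hw : w ∉ S := h.runs.notMem hk' (by simp)
        refine .inr ⟨w, Finset.mem_union_right _ ?_, h.ne_of_notMem hw, v, by simp, ?_⟩
        · rw [h.nbr w hw]
          exact ⟨_, hk, by simp⟩
        · rw [h.runs.inner [] w _ hk' v (h.runs.notMem hk' (by simp))]
          simp
    · exact (h.flankR l hl).imp id fun h => h.mono Finset.subset_union_left

/-- The possible moves in a configuration. -/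
theorem Conf.move (h : Conf G S c A R) {x : V} (hx : x ∈ legalMoves G S) (hxc : x ≠ c) :
    (∃ p q A₀, A = (p ++ x :: q) ::ₘ A₀ ∧
        Conf G (S ∪ closedNbhd G x) c (p.dropLast ::ₘ A₀) (q.tail ::ₘ R)) ∨
      (∃ p q R₀, R = (p ++ x :: q) ::ₘ R₀ ∧
        Conf G (S ∪ closedNbhd G x) c A (p.dropLast ::ₘ q.tail ::ₘ R₀)) ∨
      (x ∈ S ∧ ∃ l y A₀, A = (l ++ [y]) ::ₘ A₀ ∧
        Conf G (S ∪ closedNbhd G x) c (l ::ₘ A₀) R) ∨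
      (x ∈ S ∧ ∃ l l' R₀, R = l ::ₘ R₀ ∧ l.length = l'.length + 1 ∧
        Conf G (S ∪ closedNbhd G x) c A (l' ::ₘ R₀)) := by
  by_cases hxS : x ∈ S
  · obtain ⟨y, hyx, hyS⟩ := mem_legalMoves.1 hx
    obtain ⟨l, hl, hyl⟩ := h.runs.exists_mem hyS
    rcases Multiset.mem_add.1 hl with hl | hl
    · obtain ⟨A₀, rfl⟩ := Multiset.exists_cons_of_mem hl
      obtain ⟨l', rfl, h1⟩ := h.play_flank_centre hxS hxc hyl hyx
      exact .inr (.inr (.inl ⟨hxS, l', y, A₀, rfl, h1⟩))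
    · obtain ⟨R₀, rfl⟩ := Multiset.exists_cons_of_mem hl
      obtain ⟨l', h1, h2⟩ := h.play_flank_run hxS hxc hyl hyx
      exact .inr (.inr (.inr ⟨hxS, l, l', R₀, rfl, h1, h2⟩))
  · obtain ⟨l, hl, hxl⟩ := h.runs.exists_mem hxS
    obtain ⟨p, q, rfl⟩ := List.append_of_mem hxl
    rcases Multiset.mem_add.1 hl with hl | hl
    · obtain ⟨A₀, rfl⟩ := Multiset.exists_cons_of_mem hl
      exact .inl ⟨p, q, A₀, rfl, h.play_centre_run⟩
    · obtain ⟨R₀, rfl⟩ := Multiset.exists_cons_of_mem hl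
      exact .inr (.inl ⟨p, q, R₀, rfl, h.play_run⟩)

theorem Conf.exists_flank_centre {A₀ : Multiset (List V)} {l : List V}
    (h : Conf G S c (l ::ₘ A₀) R) (hl : Flanked G S c l) :
    ∃ x ∈ S, x ≠ c ∧ x ∈ legalMoves G S ∧ ∃ l' y, l = l' ++ [y] ∧
      Conf G (S ∪ closedNbhd G x) c (l' ::ₘ A₀) R := by
  obtain ⟨x, hx, hxc, y, hy, hyx⟩ := hl
  obtain ⟨l', h1, h2⟩ := h.play_flank_centre hx hxc hy hyx
  exact ⟨x, hx, hxc, mem_legalMoves.2 ⟨y, hyx, h.runs.notMem (by simp) hy⟩, l', y, h1, h2⟩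

theorem Conf.exists_flank_run {R₀ : Multiset (List V)} {l : List V}
    (h : Conf G S c A (l ::ₘ R₀)) (hl : l ≠ []) :
    ∃ x ∈ S, x ≠ c ∧ x ∈ legalMoves G S ∧ ∃ l', l.length = l'.length + 1 ∧
      Conf G (S ∪ closedNbhd G x) c A (l' ::ₘ R₀) := by
  obtain ⟨x, hx, hxc, y, hy, hyx⟩ := (h.flankR l (by simp)).resolve_left hl
  obtain ⟨l', h1, h2⟩ := h.play_flank_run hx hxc hy hyx
  exact ⟨x, hx, hxc, mem_legalMoves.2 ⟨y, hyx, h.runs.notMem (by simp) hy⟩, l', h1, h2⟩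

/-- An empty run at the centre is irrelevant. -/
theorem Conf.of_nil_cons (h : Conf G S c ([] ::ₘ A) R) : Conf G S c A R where
  runs := by
    have h1 := h.runs
    rw [Multiset.cons_add] at h1
    refine ⟨?_, ?_, ?_, ?_⟩
    · have := h1.nodup
      rwa [verts_cons, Multiset.coe_nil, zero_add] at this
    · intro v
      have := h1.mem_iff v
      rwa [verts_cons, Multiset.coe_nil, zero_add] at this
    · exact fun p x q hl => h1.inner p x q (Multiset.mem_cons_of_mem hl)
    · exact fun x hx l hl => h1.outer x hx l (Multiset.mem_cons_of_mem hl)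
  mem := h.mem
  nbr := by
    intro y hy
    rw [h.nbr y hy]
    simp
  single := h.single
  last := fun x hx hxc l hl => h.last x hx hxc l (Multiset.mem_cons_of_mem hl)
  flankA := fun l hl => h.flankA l (Multiset.mem_cons_of_mem hl)
  flankR := h.flankR

/-- Padding with empty runs lets the results on two runs at `c` apply when fewer are left. -/
theorem Conf.nil_cons (h : Conf G S c A R) : Conf G S c ([] ::ₘ A) R where
  runs := by
    rw [Multiset.cons_add]
    refine ⟨?_, ?_, ?_, ?_⟩
    · rw [verts_cons, Multiset.coe_nil, zero_add]
      exact h.runs.nodup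
    · intro v
      rw [verts_cons, Multiset.coe_nil, zero_add]
      exact h.runs.mem_iff v
    · exact fun p x q hl => h.runs.inner p x q (by simpa using hl)
    · intro x hx l hl
      rcases Multiset.mem_cons.1 hl with rfl | hl
      · exact .inl (by simp)
      · exact h.runs.outer x hx l hl
  mem := h.mem
  nbr := by
    intro y hy
    rw [h.nbr y hy]
    simp
  single := h.single
  last := by
    intro x hx hxc l hl
    rcases Multiset.mem_cons.1 hl with rfl | hl
    · simp
    · exact h.last x hx hxc l hl
  flankA := by
    intro l hl
    rcases Multiset.mem_cons.1 hl with rfl | hl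
    · exact .inl (by simp)
    · exact h.flankA l hl
  flankR := h.flankR

/-! ### Runs around an undominated centre -/

/-- The vertex `c` is not dominated, dominating it would lead to a configuration, and the
dominated neighbours of `c` dominate no new vertices other than `c`. -/
structure Open (G : SimpleGraph V) [DecidableRel G.Adj] (S : Finset V) (c : V)
    (A R : Multiset (List V)) : Prop where
  notMem : c ∉ S
  conf : Conf G (insert c S) c A R
  adj : ∀ x ∈ S, c ∈ closedNbhd G x → closedNbhd G x ⊆ insert c S

theorem insert_union_closedNbhd (c x : V) :
    insert c S ∪ closedNbhd G x = insert c (S ∪ closedNbhd G x) := by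
  rw [Finset.insert_union]

theorem insert_union_closedNbhd_of_mem {x : V} (hx : c ∈ closedNbhd G x) :
    insert c S ∪ closedNbhd G x = S ∪ closedNbhd G x := by
  rw [Finset.insert_union, Finset.insert_eq_of_mem]
  exact Finset.mem_union_right _ hx

theorem Open.of_move (h : Open G S c A R) {x : V} (hx : c ∉ closedNbhd G x)
    {A' R' : Multiset (List V)} (h' : Conf G (insert c S ∪ closedNbhd G x) c A' R') :
    Open G (S ∪ closedNbhd G x) c A' R' where
  notMem := by simp [h.notMem, hx]
  conf := by rwa [← insert_union_closedNbhd]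
  adj := by
    have hxc : x ≠ c := by rintro rfl; exact hx (self_mem_closedNbhd x)
    intro z hz hcz
    by_cases hzS : z ∈ S
    · exact (h.adj z hzS hcz).trans (Finset.insert_subset_insert _ Finset.subset_union_left)
    have hzx : z ∈ closedNbhd G x := by simpa [hzS] using hz
    have hzc : z ≠ c := by rintro rfl; exact hx hzx
    have hzS' : z ∉ insert c S := by simp [hzS, hzc]
    -- A newly dominated neighbour `z` of `c` is the head of a run at `c`. Either a dominated `x`
    -- sees it, and then it is also the last vertex of the run, or `x` is the second vertex. In both
    -- cases nothing undominated remains next to `z` except `c`.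
    obtain ⟨l, hl, hzl⟩ := (h.conf.nbr z hzS').1 (mem_closedNbhd_comm.1 hcz)
    rcases l with _ | ⟨w, t⟩
    · simp at hzl
    obtain rfl : w = z := by simpa using hzl
    have hl' := Multiset.mem_add.2 (.inl hl : w :: t ∈ A ∨ w :: t ∈ R)
    have hnd := nodup_of_mem h.conf.runs.nodup hl'
    intro y hyz
    by_contra hy
    rw [← insert_union_closedNbhd, Finset.mem_union, not_or] at hy
    rcases (h.conf.runs.inner [] w t hl' y hy.1).1 hyz with rfl | h1 | h1
    · exact hy.2 hzx
    · simp at h1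
    · by_cases hxS : x ∈ insert c S
      · have h2 := h.conf.last x hxS hxc _ hl w (by simp) hzx
        rcases List.eq_nil_or_concat t with rfl | ⟨t, v, rfl⟩
        · simp at h1
        · obtain rfl : v = w := by simpa [List.getLast?_cons] using h2
          simp at hnd
      · rcases (h.conf.runs.inner [] w t hl' x hxS).1 (mem_closedNbhd_comm.1 hzx) with rfl | h2 | h2
        · exact hy.2 hyz
        · simp at h2
        · obtain rfl : x = y := Option.some.inj (h2.symm.trans h1)
          exact hy.2 (self_mem_closedNbhd x)

theorem mem_legalMoves_of_insert {x : V} (h : x ∈ legalMoves G (insert c S)) :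
    x ∈ legalMoves G S := by
  obtain ⟨y, hy, hyS⟩ := mem_legalMoves.1 h
  exact mem_legalMoves.2 ⟨y, hy, fun h => hyS (Finset.mem_insert_of_mem h)⟩

theorem mem_legalMoves_insert {x : V} (h : x ∈ legalMoves G S) (hx : c ∉ closedNbhd G x) :
    x ∈ legalMoves G (insert c S) := by
  obtain ⟨y, hy, hyS⟩ := mem_legalMoves.1 h
  refine mem_legalMoves.2 ⟨y, hy, ?_⟩
  rw [Finset.mem_insert, not_or]
  exact ⟨fun h => hx (h ▸ hy), hyS⟩

theorem Open.notMem_of_legal (h : Open G S c A R) {x : V} (hx : x ∈ S)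
    (hl : x ∈ legalMoves G (insert c S)) : c ∉ closedNbhd G x := by
  intro hc
  obtain ⟨y, hy, hyS⟩ := mem_legalMoves.1 hl
  exact hyS (h.adj x hx hc hy)

/-- The possible moves around an undominated centre. -/
theorem Open.move (h : Open G S c A R) {x : V} (hx : x ∈ legalMoves G S) :
    x = c ∧ Conf G (S ∪ closedNbhd G x) c 0 (A.map List.tail + R) ∨
      (x ∈ S ∧ c ∈ closedNbhd G x ∧ Conf G (S ∪ closedNbhd G x) c A R) ∨
      (∃ q A₀, A = (x :: q) ::ₘ A₀ ∧
        Conf G (S ∪ closedNbhd G x) c ([] ::ₘ A₀) (q.tail ::ₘ R)) ∨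
      (∃ p q A₀, p ≠ [] ∧ A = (p ++ x :: q) ::ₘ A₀ ∧
        Open G (S ∪ closedNbhd G x) c (p.dropLast ::ₘ A₀) (q.tail ::ₘ R)) ∨
      (∃ p q R₀, R = (p ++ x :: q) ::ₘ R₀ ∧
        Open G (S ∪ closedNbhd G x) c A (p.dropLast ::ₘ q.tail ::ₘ R₀)) ∨
      (x ∈ S ∧ ∃ l y A₀, A = (l ++ [y]) ::ₘ A₀ ∧
        Open G (S ∪ closedNbhd G x) c (l ::ₘ A₀) R) ∨
      (x ∈ S ∧ ∃ l l' R₀, R = l ::ₘ R₀ ∧ l.length = l'.length + 1 ∧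
        Open G (S ∪ closedNbhd G x) c A (l' ::ₘ R₀)) := by
  by_cases hxc : x = c
  · subst hxc
    refine .inl ⟨rfl, ?_⟩
    rw [← insert_union_closedNbhd_of_mem (self_mem_closedNbhd x)]
    exact h.conf.play_centre
  right
  by_cases hcx : c ∈ closedNbhd G x
  · by_cases hxS : x ∈ S
    · refine .inl ⟨hxS, hcx, ?_⟩
      have : S ∪ closedNbhd G x = insert c S := by
        rw [← insert_union_closedNbhd_of_mem hcx]
        exact Finset.union_eq_left.2 (h.adj x hxS hcx)
      rw [this]
      exact h.conf
    · refine .inr (.inl ?_)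
      have hxS' : x ∉ insert c S := by simp [hxS, hxc]
      obtain ⟨l, hl, hxl⟩ := (h.conf.nbr x hxS').1 (mem_closedNbhd_comm.1 hcx)
      rcases l with _ | ⟨w, t⟩
      · simp at hxl
      obtain rfl : w = x := by simpa using hxl
      obtain ⟨A₀, rfl⟩ := Multiset.exists_cons_of_mem hl
      refine ⟨t, A₀, rfl, ?_⟩
      rw [← insert_union_closedNbhd_of_mem hcx]
      exact Conf.play_centre_run (p := []) h.conf
  · refine .inr (.inr ?_)
    rcases h.conf.move (mem_legalMoves_insert hx hcx) hxc with
      ⟨p, q, A₀, rfl, h1⟩ | ⟨p, q, R₀, rfl, h1⟩ | ⟨hxS, l, y, A₀, rfl, h1⟩ |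
        ⟨hxS, l, l', R₀, rfl, h0, h1⟩
    · refine .inl ⟨p, q, A₀, ?_, rfl, h.of_move hcx h1⟩
      rintro rfl
      have hl : x :: q ∈ ((([] : List V) ++ x :: q) ::ₘ A₀) := by simp
      have := (h.conf.nbr x (h.conf.runs.notMem (Multiset.mem_add.2 (.inl hl)) (by simp))).2
        ⟨_, hl, by simp⟩
      exact hcx (mem_closedNbhd_comm.1 this)
    · exact .inr (.inl ⟨p, q, R₀, rfl, h.of_move hcx h1⟩)
    · exact .inr (.inr (.inl ⟨(Finset.mem_insert.1 hxS).resolve_left hxc, l, y, A₀, rfl,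
        h.of_move hcx h1⟩))
    · exact .inr (.inr (.inr ⟨(Finset.mem_insert.1 hxS).resolve_left hxc, l, l', R₀, rfl, h0,
        h.of_move hcx h1⟩))

theorem Open.exists_flank_centre {A₀ : Multiset (List V)} {l : List V}
    (h : Open G S c (l ::ₘ A₀) R) (hl : Flanked G (insert c S) c l) :
    ∃ x ∈ legalMoves G S, ∃ l' y, l = l' ++ [y] ∧
      Open G (S ∪ closedNbhd G x) c (l' ::ₘ A₀) R := by
  obtain ⟨x, hx, hxc, hx', l', y, h1, h2⟩ :=
    h.conf.exists_flank_centre hl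
  exact ⟨x, mem_legalMoves_of_insert hx', l', y, h1, h.of_move
    (h.notMem_of_legal ((Finset.mem_insert.1 hx).resolve_left hxc) hx') h2⟩

theorem Open.exists_flank_run {R₀ : Multiset (List V)} {l : List V}
    (h : Open G S c A (l ::ₘ R₀)) (hl : l ≠ []) :
    ∃ x ∈ legalMoves G S, ∃ l', l.length = l'.length + 1 ∧
      Open G (S ∪ closedNbhd G x) c A (l' ::ₘ R₀) := by
  obtain ⟨x, hx, hxc, hx', l', h1, h2⟩ := h.conf.exists_flank_run hl
  exact ⟨x, mem_legalMoves_of_insert hx', l', h1, h.of_move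
    (h.notMem_of_legal ((Finset.mem_insert.1 hx).resolve_left hxc) hx') h2⟩

theorem Open.of_nil_cons (h : Open G S c ([] ::ₘ A) R) : Open G S c A R :=
  ⟨h.notMem, h.conf.of_nil_cons, h.adj⟩

theorem Open.card_compl (h : Open G S c A R) : Sᶜ.card = (verts (A + R)).card + 1 := by
  rw [← h.conf.runs.card_compl, ← Finset.insert_erase (Finset.mem_compl.2 h.notMem),
    Finset.card_insert_of_notMem (Finset.notMem_erase _ _), Finset.compl_insert]

theorem resInd_four_mul (i j : ℕ) : resInd i (4 * j) = resInd i 0 := resInd_four_mul_add i j 0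

theorem resInd_zero (i : ℕ) : resInd (i + 1) 0 = 0 := by
  simp [resInd]

theorem residues_eq_zero {i : ℕ} (h : ∀ l ∈ L, 4 ∣ l.length) (hi : 0 < i) : residues i L = 0 := by
  by_contra h0
  obtain ⟨l, hl, h1⟩ := exists_of_residues_pos (Nat.pos_of_ne_zero h0)
  have := h l hl
  omega

theorem cons_singleton_of_card_eq_two {α : Type*} {A A₀ : Multiset α} {l : α} (hA : A.card = 2)
    (h : A = l ::ₘ A₀) : ∃ k, A₀ = {k} := by
  subst h
  exact Multiset.card_eq_one.1 (by simpa using hA)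

/-! ### Dominator's strategy around an undominated centre -/

/-- Staller has broken a run of length `4 * s` at the centre into `a` vertices next to the centre
and `b` vertices beyond; the other run has length `4 * t`. Dominator answers at the centre. -/
theorem open_respond_centre {a b s t m n₁ n₂ n₃ : ℕ}
    (h : a + b + 3 = 4 * s) (ha : a % 4 = 0 ∨ a % 4 = 1) :
    2 + runsS ((a - 1) / 4 + ((4 * t - 1) / 4 + (b / 4 + m)))
        (resInd 1 (a - 1) + (resInd 1 (4 * t - 1) + (resInd 1 b + n₁)))
        (resInd 2 (a - 1) + (resInd 2 (4 * t - 1) + (resInd 2 b + n₂)))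
        (resInd 3 (a - 1) + (resInd 3 (4 * t - 1) + (resInd 3 b + n₃))) ≤
      runsS (s + (t + m)) (n₁ + 1) n₂ n₃ := by
  have hb : ∃ j, b = 4 * j + (5 - a % 4) % 4 := ⟨b / 4, by omega⟩
  obtain ⟨j, hj⟩ := hb
  obtain rfl | ⟨t, rfl⟩ : t = 0 ∨ ∃ t', t = t' + 1 := by
    rcases t with _ | t
    · simp
    · exact .inr ⟨t, rfl⟩
  · rcases ha with ha | ha
    · rw [ha] at hj
      subst hj
      obtain rfl | ⟨i, rfl⟩ : a = 0 ∨ ∃ i, a = 4 * i + 3 + 1 := by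
        by_cases h0 : a = 0
        · exact .inl h0
        · exact .inr ⟨a / 4 - 1, by omega⟩
      · simp only [resInd_four_mul_add, four_mul_add_div]
        norm_num [resInd]
        unfold runsS
        omega
      · simp only [Nat.add_sub_cancel, resInd_four_mul_add, four_mul_add_div]
        norm_num [resInd]
        unfold runsS
        omega
    · rw [ha] at hj
      subst hj
      obtain ⟨i, rfl⟩ : ∃ i, a = 4 * i + 0 + 1 := ⟨a / 4, by omega⟩
      simp only [Nat.add_sub_cancel, resInd_four_mul_add, four_mul_add_div]
      norm_num [resInd]
      unfold runsS
      omega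
  · rw [show 4 * (t + 1) - 1 = 4 * t + 3 by omega]
    rcases ha with ha | ha
    · rw [ha] at hj
      subst hj
      obtain rfl | ⟨i, rfl⟩ : a = 0 ∨ ∃ i, a = 4 * i + 3 + 1 := by
        by_cases h0 : a = 0
        · exact .inl h0
        · exact .inr ⟨a / 4 - 1, by omega⟩
      · simp only [resInd_four_mul_add, four_mul_add_div]
        norm_num [resInd]
        unfold runsS
        omega
      · simp only [Nat.add_sub_cancel, resInd_four_mul_add, four_mul_add_div]
        norm_num [resInd]
        unfold runsS
        omega
    · rw [ha] at hj
      subst hj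
      obtain ⟨i, rfl⟩ : ∃ i, a = 4 * i + 0 + 1 := ⟨a / 4, by omega⟩
      simp only [Nat.add_sub_cancel, resInd_four_mul_add, four_mul_add_div]
      norm_num [resInd]
      unfold runsS
      omega

/-- For the remaining residues of `a`, Dominator answers at the head of the shortened run, which
dominates the centre and two vertices of the run. In the case `b = 0`, Staller played the last
vertex (`a + 2`) or the vertex flanking it (`a + 1`). -/
theorem open_respond_head {a b s t m n₁ n₂ n₃ : ℕ}
    (h : a + b + 3 = 4 * s ∨ b = 0 ∧ (a + 2 = 4 * s ∨ a + 1 = 4 * s))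
    (ha : a % 4 = 2 ∨ a % 4 = 3) :
    2 + runsS (t + ((a - 2) / 4 + (b / 4 + m)))
        (resInd 1 (a - 2) + (resInd 1 b + n₁))
        (resInd 2 (a - 2) + (resInd 2 b + n₂))
        (resInd 3 (a - 2) + (resInd 3 b + n₃)) ≤
      runsS (s + (t + m)) (n₁ + 1) n₂ n₃ := by
  obtain ⟨i, e, he, rfl⟩ : ∃ i e, e < 2 ∧ a = 4 * i + e + 2 := ⟨a / 4, a % 4 - 2, by omega, by omega⟩
  rcases h with h | ⟨rfl, h⟩
  · obtain ⟨j, hj⟩ : ∃ j, b = 4 * j + (3 - e) := ⟨b / 4, by omega⟩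
    subst hj
    interval_cases e <;> simp only [Nat.add_sub_cancel, resInd_four_mul_add, four_mul_add_div] <;>
      norm_num [resInd] <;> unfold runsS <;> omega
  · interval_cases e <;> simp only [Nat.add_sub_cancel, resInd_four_mul_add, four_mul_add_div] <;>
      norm_num [resInd] <;> unfold runsS <;> omega

theorem Open.dominator_le_centre (h : Open G S c A R) :
    gameNumber G .dominator S ≤ 1 + valueS (A.map List.tail + R) := by
  refine (dominator_le (mem_legalMoves_of_notMem h.notMem)).trans (Nat.add_le_add_left ?_ 1)
  rw [← insert_union_closedNbhd_of_mem (self_mem_closedNbhd c)]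
  have := h.conf.play_centre.runs.gameNumber_le.2
  rwa [zero_add] at this

theorem Open.play_head {A₀ : Multiset (List V)} {t : List V} {x : V}
    (h : Open G S c ((x :: t) ::ₘ A₀) R) :
    x ∉ S ∧ Conf G (S ∪ closedNbhd G x) c ([] ::ₘ A₀) (t.tail ::ₘ R) := by
  have hx : x ∉ insert c S := h.conf.runs.notMem (by simp) (List.mem_cons_self (a := x) (l := t))
  have hcx : c ∈ closedNbhd G x := by
    rw [mem_closedNbhd_comm, h.conf.nbr x hx]
    exact ⟨_, Multiset.mem_cons_self _ _, by simp⟩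
  refine ⟨fun h => hx (Finset.mem_insert_of_mem h), ?_⟩
  rw [← insert_union_closedNbhd_of_mem hcx]
  exact Conf.play_centre_run (p := []) h.conf

theorem Open.dominator_le_head {A₀ : Multiset (List V)} {l : List V} (hl : l ≠ [])
    (h : Open G S c (l ::ₘ A₀) R) :
    gameNumber G .dominator S ≤ 1 + valueS (A₀ + (l.tail.tail ::ₘ R)) := by
  rcases l with _ | ⟨x, t⟩
  · exact absurd rfl hl
  obtain ⟨hx, h1⟩ := h.play_head
  refine (dominator_le (mem_legalMoves_of_notMem hx)).trans (Nat.add_le_add_left ?_ 1)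
  exact h1.of_nil_cons.runs.gameNumber_le.2

theorem open_staller_centre {s t m n₁ n₂ n₃ : ℕ} :
    1 + runsD ((4 * s - 1) / 4 + ((4 * t - 1) / 4 + m))
        (resInd 1 (4 * s - 1) + (resInd 1 (4 * t - 1) + n₁))
        (resInd 2 (4 * s - 1) + (resInd 2 (4 * t - 1) + n₂))
        (resInd 3 (4 * s - 1) + (resInd 3 (4 * t - 1) + n₃)) ≤
      runsS (s + (t + m)) (n₁ + 1) n₂ n₃ := by
  rcases s with _ | s <;> rcases t with _ | t
  · norm_num [resInd]; unfold runsS runsD; omega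
  · rw [show 4 * (t + 1) - 1 = 4 * t + 3 by omega, resInd_four_mul_add, four_mul_add_div]
    norm_num [resInd, resInd_four_mul_add]; unfold runsS runsD; omega
  · rw [show 4 * (s + 1) - 1 = 4 * s + 3 by omega, resInd_four_mul_add, four_mul_add_div]
    norm_num [resInd, resInd_four_mul_add]; unfold runsS runsD; omega
  · rw [show 4 * (t + 1) - 1 = 4 * t + 3 by omega, show 4 * (s + 1) - 1 = 4 * s + 3 by omega]
    simp only [resInd_four_mul_add, four_mul_add_div]
    norm_num [resInd]; unfold runsS runsD; omega

theorem open_dominator_centre {s t m n₁ : ℕ} :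
    1 + runsS ((4 * s - 1) / 4 + ((4 * t - 1) / 4 + m))
        (resInd 1 (4 * s - 1) + (resInd 1 (4 * t - 1) + n₁))
        (resInd 2 (4 * s - 1) + (resInd 2 (4 * t - 1) + 0))
        (resInd 3 (4 * s - 1) + (resInd 3 (4 * t - 1) + 0)) ≤
      runsD (s + (t + m)) (n₁ + 1) 0 0 := by
  rcases s with _ | s <;> rcases t with _ | t
  · norm_num [resInd]; unfold runsS runsD; omega
  · rw [show 4 * (t + 1) - 1 = 4 * t + 3 by omega, resInd_four_mul_add, four_mul_add_div]
    norm_num [resInd, resInd_four_mul_add]; unfold runsS runsD; omega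
  · rw [show 4 * (s + 1) - 1 = 4 * s + 3 by omega, resInd_four_mul_add, four_mul_add_div]
    norm_num [resInd, resInd_four_mul_add]; unfold runsS runsD; omega
  · rw [show 4 * (t + 1) - 1 = 4 * t + 3 by omega, show 4 * (s + 1) - 1 = 4 * s + 3 by omega]
    simp only [resInd_four_mul_add, four_mul_add_div]
    norm_num [resInd]; unfold runsS runsD; omega

theorem runs_staller_sub_one {k m n₁ n₂ n₃ : ℕ} :
    1 + runsD (k / 4 + m) (resInd 1 k + n₁) (resInd 2 k + n₂) (resInd 3 k + n₃) ≤
      runsS ((k + 1) / 4 + m) (resInd 1 (k + 1) + n₁) (resInd 2 (k + 1) + n₂)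
        (resInd 3 (k + 1) + n₃) := by
  obtain ⟨j, i, hi, rfl⟩ : ∃ j i, i < 4 ∧ k = 4 * j + i :=
        ⟨k / 4, k % 4, Nat.mod_lt _ (by norm_num), by omega⟩
  rw [add_assoc]
  simp only [resInd_four_mul_add, four_mul_add_div]
  interval_cases i <;> norm_num [resInd] <;> unfold runsS runsD <;> omega

theorem runs_head {k s m n₁ n₂ n₃ : ℕ} (h : k + 1 = 4 * s) :
    1 + runsD ((k - 1) / 4 + m) (resInd 1 (k - 1) + n₁) (resInd 2 (k - 1) + n₂)
        (resInd 3 (k - 1) + n₃) ≤ runsS (s + m) (n₁ + 1) n₂ n₃ := by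
  obtain ⟨j, rfl⟩ : ∃ j, k = 4 * j + 2 + 1 := ⟨k / 4, by omega⟩
  simp only [Nat.add_sub_cancel, resInd_four_mul_add, four_mul_add_div]
  norm_num [resInd]
  unfold runsS runsD
  omega

/-- The centre and its two runs together count as one run of residue 1. It need not be a run in the
sense of `IsRuns`, as a dominated third neighbour may see `c` in its middle. As soon as Staller
disturbs this part, Dominator sees to it that `c` is dominated, and `IsRuns.gameNumber_le` takes
over. -/
theorem Open.gameNumber_le (h : Open G S c A R) (hA : A.card = 2) (h4 : ∀ l ∈ A, 4 ∣ l.length) :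
    gameNumber G .dominator S ≤ runsD (quarters A + quarters R) (residues 1 R + 1)
        (residues 2 R) (residues 3 R) ∧
      gameNumber G .staller S ≤ runsS (quarters A + quarters R) (residues 1 R + 1)
        (residues 2 R) (residues 3 R) := by
  induction hn : Sᶜ.card using Nat.strong_induction_on generalizing S A R with
  | _ n ih =>
    subst hn
    constructor
    · by_cases h23 : 0 < residues 2 R ∨ 0 < residues 3 R
      · obtain ⟨l, hl, hl0, hl1, hl2⟩ : ∃ l ∈ R, l ≠ [] ∧
            (0 < residues 3 R → l.length % 4 = 3) ∧
            (0 < residues 2 R → 0 < residues 3 R ∨ l.length % 4 = 2) := by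
          by_cases h3 : 0 < residues 3 R
          · obtain ⟨l, hl, h'⟩ := exists_of_residues_pos h3
            exact ⟨l, hl, by rintro rfl; simp at h', fun _ => h', fun _ => .inl h3⟩
          · obtain ⟨l, hl, h'⟩ := exists_of_residues_pos (h23.resolve_right h3)
            exact ⟨l, hl, by rintro rfl; simp at h', fun h => absurd h h3, fun _ => .inr h'⟩
        obtain ⟨R, rfl⟩ := Multiset.exists_cons_of_mem hl
        obtain ⟨p, x, q, rfl, hp⟩ : ∃ p x q, l = p ++ x :: q ∧
            ((p.length = 1) ∨ (p.length = 0 ∧ q.length = 0)) := by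
          rcases l with _ | ⟨a, _ | ⟨b, l⟩⟩
          · exact absurd rfl hl0
          · exact ⟨[], a, [], rfl, .inr ⟨rfl, rfl⟩⟩
          · exact ⟨[a], b, l, rfl, .inl rfl⟩
        have hxS : x ∉ insert c S := h.conf.runs.notMem (Multiset.mem_add.2 (.inr hl)) (by simp)
        have hx : x ∈ legalMoves G S :=
          mem_legalMoves_of_notMem fun h => hxS (Finset.mem_insert_of_mem h)
        have hcx : c ∉ closedNbhd G x := by
          rw [mem_closedNbhd_comm]
          exact h.conf.notMem_closedNbhd hl (by simp)
        have h1 := h.of_move hcx h.conf.play_run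
        refine (dominator_le hx).trans ?_
        refine (Nat.add_le_add_left (ih _ (card_compl_lt hx) h1 hA h4 rfl).2 1).trans ?_
        simp only [residues_cons] at hl1 hl2
        simp only [quarters_cons, residues_cons, List.length_dropLast,
          List.length_tail]
        have hp0 : p.length - 1 = 0 := by omega
        rw [hp0]
        have := runs_dominator (k := (p ++ x :: q).length) (n := q.length)
          (m := quarters A + quarters R) (n₁ := residues 1 R + 1)
          (by rw [List.length_append, List.length_cons]; omega) hl1 hl2
        simpa [resInd, add_assoc, add_left_comm] using this
      · obtain ⟨l, k, rfl⟩ := Multiset.card_eq_two.1 hA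
        refine h.dominator_le_centre.trans ?_
        obtain ⟨s, hs⟩ := h4 l (by simp)
        obtain ⟨t, ht⟩ := h4 k (by simp)
        have h2 : residues 2 R = 0 := by omega
        have h3 : residues 3 R = 0 := by omega
        have := open_dominator_centre (s := s) (t := t) (m := quarters R) (n₁ := residues 1 R)
        simpa [valueS, hs, ht, h2, h3, add_assoc] using this
    · refine staller_le fun x hx => ?_
      rcases h.move hx with ⟨-, h1⟩ | ⟨-, -, h1⟩ | ⟨q, A₀, rfl, h1⟩ | ⟨p, q, A₀, hp, rfl, h1⟩ |
        ⟨p, q, R₀, rfl, h1⟩ | ⟨-, l, y, A₀, rfl, h1⟩ | ⟨-, l, l', R₀, rfl, h0, h1⟩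
      · obtain ⟨l, k, rfl⟩ := Multiset.card_eq_two.1 hA
        obtain ⟨s, hs⟩ := h4 l (by simp)
        obtain ⟨t, ht⟩ := h4 k (by simp)
        refine (Nat.add_le_add_left h1.runs.gameNumber_le.1 1).trans ?_
        have := open_staller_centre (s := s) (t := t) (m := quarters R) (n₁ := residues 1 R)
          (n₂ := residues 2 R) (n₃ := residues 3 R)
        simpa [valueD, hs, ht, add_assoc] using this
      · refine (Nat.add_le_add_left h1.runs.gameNumber_le.1 1).trans ?_
        simp only [valueD, quarters_add, residues_add]
        rw [residues_eq_zero h4 one_pos, residues_eq_zero h4 two_pos, residues_eq_zero h4 three_pos]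
        unfold runsD runsS
        omega
      · obtain ⟨k, rfl⟩ := cons_singleton_of_card_eq_two hA rfl
        obtain ⟨s, hs⟩ := h4 (x :: q) (by simp)
        obtain ⟨t, ht⟩ := h4 k (by simp)
        rw [List.length_cons] at hs
        refine (Nat.add_le_add_left h1.runs.gameNumber_le.1 1).trans ?_
        have := runs_head (m := t + quarters R) (n₁ := residues 1 R)
          (n₂ := residues 2 R) (n₃ := residues 3 R) hs
        simpa [valueD, hs, ht, resInd_four_mul, resInd_zero, add_assoc, add_left_comm] using this
      · obtain ⟨k, rfl⟩ := cons_singleton_of_card_eq_two hA rfl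
        obtain ⟨s, hs⟩ := h4 (p ++ x :: q) (by simp)
        obtain ⟨t, ht⟩ := h4 k (by simp)
        rw [List.length_append, List.length_cons] at hs
        have hp' := List.length_pos_of_ne_nil hp
        by_cases ha : (p.length - 1) % 4 = 0 ∨ (p.length - 1) % 4 = 1
        · refine (Nat.add_le_add_left h1.dominator_le_centre 1).trans ?_
          have := open_respond_centre (a := p.length - 1) (b := q.length - 1) (s := s) (t := t)
            (m := quarters R) (n₁ := residues 1 R) (n₂ := residues 2 R) (n₃ := residues 3 R)
            (by omega) ha
          rw [← add_assoc]
          simpa [valueS, hs, ht, add_assoc, add_left_comm] using this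
        · have hne : p.dropLast ≠ [] := by
            rw [← List.length_pos_iff, List.length_dropLast]
            omega
          refine (Nat.add_le_add_left (h1.dominator_le_head hne) 1).trans ?_
          have := open_respond_head (a := p.length - 1) (b := q.length - 1) (s := s) (t := t)
            (m := quarters R) (n₁ := residues 1 R) (n₂ := residues 2 R) (n₃ := residues 3 R)
            (by omega) (by omega)
          rw [← add_assoc]
          simpa [valueS, hs, ht, resInd_four_mul, resInd_zero, Nat.sub_sub, add_assoc, add_left_comm] using this
      · refine (Nat.add_le_add_left (ih _ (card_compl_lt hx) h1 hA h4 rfl).1 1).trans ?_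
        have := runs_staller_inner (a := p.length) (b := q.length) (m := quarters A + quarters R₀)
          (n₁ := residues 1 R₀ + 1) (n₂ := residues 2 R₀) (n₃ := residues 3 R₀) rfl
        simpa [add_assoc, add_left_comm] using this
      · obtain ⟨k, rfl⟩ := cons_singleton_of_card_eq_two hA rfl
        obtain ⟨s, hs⟩ := h4 (l ++ [y]) (by simp)
        obtain ⟨t, ht⟩ := h4 k (by simp)
        rw [List.length_append, List.length_singleton] at hs
        have hne : l ≠ [] := by
          rintro rfl
          simp at hs
          omega
        refine (Nat.add_le_add_left (h1.dominator_le_head hne) 1).trans ?_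
        have := open_respond_head (a := l.length) (b := 0) (s := s) (t := t)
          (m := quarters R) (n₁ := residues 1 R) (n₂ := residues 2 R) (n₃ := residues 3 R)
          (by omega) (by omega)
        rw [← add_assoc]
        simpa [valueS, hs, ht, resInd_four_mul, resInd_zero, Nat.sub_sub, add_assoc, add_left_comm] using this
      · refine (Nat.add_le_add_left (ih _ (card_compl_lt hx) h1 hA h4 rfl).1 1).trans ?_
        have := runs_staller_sub_one (k := l'.length) (m := quarters A + quarters R₀)
          (n₁ := residues 1 R₀ + 1) (n₂ := residues 2 R₀) (n₃ := residues 3 R₀)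
        simpa [h0, add_assoc, add_left_comm] using this

/-! ### Staller's strategy on runs -/

/-- The counterpart of `runs_staller_inner`: no move of Dominator on a run beats the priorities in
`runs_dominator`. -/
theorem le_runs_dominator_inner {k a b m n₁ n₂ n₃ : ℕ} (h : a + b + 1 = k) :
    runsD (k / 4 + m) (resInd 1 k + n₁) (resInd 2 k + n₂) (resInd 3 k + n₃) ≤
    1 + runsS ((a - 1) / 4 + ((b - 1) / 4 + m)) (resInd 1 (a - 1) + (resInd 1 (b - 1) + n₁))
        (resInd 2 (a - 1) + (resInd 2 (b - 1) + n₂))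
        (resInd 3 (a - 1) + (resInd 3 (b - 1) + n₃)) := by
  rcases eq_zero_or_eq_succ a with rfl | ⟨s, i, hi, rfl⟩ <;>
  rcases eq_zero_or_eq_succ b with rfl | ⟨t, j, hj, rfl⟩
  · subst h
    simp [resInd, runsD, runsS]
    omega
  · obtain rfl : k = 4 * t + (j + 2) := by omega
    interval_cases j <;>
      simp only [Nat.add_sub_cancel, resInd_four_mul_add, four_mul_add_div] <;>
      norm_num [resInd] <;> unfold runsD runsS <;> omega
  · obtain rfl : k = 4 * s + (i + 2) := by omega
    interval_cases i <;>
      simp only [Nat.add_sub_cancel, resInd_four_mul_add, four_mul_add_div] <;>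
      norm_num [resInd] <;> unfold runsD runsS <;> omega
  · obtain rfl : k = 4 * (s + t) + (i + j + 3) := by omega
    interval_cases i <;> interval_cases j <;>
      simp only [Nat.add_sub_cancel, resInd_four_mul_add, four_mul_add_div] <;>
      norm_num [resInd] <;> unfold runsD runsS <;> omega

theorem le_runs_dominator_sub_one {k m n₁ n₂ n₃ : ℕ} :
    runsD ((k + 1) / 4 + m) (resInd 1 (k + 1) + n₁) (resInd 2 (k + 1) + n₂)
        (resInd 3 (k + 1) + n₃) ≤
      1 + runsS (k / 4 + m) (resInd 1 k + n₁) (resInd 2 k + n₂) (resInd 3 k + n₃) := by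
  obtain ⟨j, i, hi, rfl⟩ : ∃ j i, i < 4 ∧ k = 4 * j + i :=
    ⟨k / 4, k % 4, Nat.mod_lt _ (by norm_num), by omega⟩
  rw [add_assoc]
  simp only [resInd_four_mul_add, four_mul_add_div]
  interval_cases i <;> norm_num [resInd] <;> unfold runsS runsD <;> omega

theorem le_runs_dominator_centre {k s m n₁ n₂ n₃ : ℕ} (h : 0 < k + s) :
    runsD (k / 4 + (s + m)) (resInd 1 k + n₁) (resInd 2 k + n₂) (resInd 3 k + n₃) ≤
      1 + runsS ((k - 1) / 4 + ((4 * s - 1) / 4 + m))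
        (resInd 1 (k - 1) + (resInd 1 (4 * s - 1) + n₁))
        (resInd 2 (k - 1) + (resInd 2 (4 * s - 1) + n₂))
        (resInd 3 (k - 1) + (resInd 3 (4 * s - 1) + n₃)) := by
  rcases eq_zero_or_eq_succ k with rfl | ⟨j, i, hi, rfl⟩ <;> rcases s with _ | s
  · omega
  · rw [show 4 * (s + 1) - 1 = 4 * s + 3 by omega]
    simp only [resInd_four_mul_add, four_mul_add_div]
    norm_num [resInd]
    unfold runsS runsD
    omega
  · rw [Nat.add_sub_cancel, add_assoc (4 * j)]
    interval_cases i <;> simp only [resInd_four_mul_add, four_mul_add_div] <;>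
      norm_num [resInd] <;> unfold runsD runsS <;> omega
  · rw [show 4 * (s + 1) - 1 = 4 * s + 3 by omega, Nat.add_sub_cancel, add_assoc (4 * j)]
    interval_cases i <;> simp only [resInd_four_mul_add, four_mul_add_div] <;>
      norm_num [resInd] <;> unfold runsD runsS <;> omega

/-- Staller removes a single vertex from a run, with the priorities: residue 3, then 2, then 1, then
0. -/
theorem le_runs_staller {k m n₁ n₂ n₃ : ℕ}
    (h3 : 0 < resInd 3 (k + 1) + n₃ → (k + 1) % 4 = 3)
    (h2 : 0 < resInd 2 (k + 1) + n₂ → 0 < resInd 3 (k + 1) + n₃ ∨ (k + 1) % 4 = 2)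
    (h1 : 0 < resInd 1 (k + 1) + n₁ →
      0 < resInd 3 (k + 1) + n₃ ∨ 0 < resInd 2 (k + 1) + n₂ ∨ (k + 1) % 4 = 1) :
    runsS ((k + 1) / 4 + m) (resInd 1 (k + 1) + n₁) (resInd 2 (k + 1) + n₂)
        (resInd 3 (k + 1) + n₃) ≤
      1 + runsD (k / 4 + m) (resInd 1 k + n₁) (resInd 2 k + n₂) (resInd 3 k + n₃) := by
  obtain ⟨j, i, hi, rfl⟩ : ∃ j i, i < 4 ∧ k = 4 * j + i :=
    ⟨k / 4, k % 4, Nat.mod_lt _ (by norm_num), by omega⟩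
  rw [add_assoc] at *
  simp only [resInd_four_mul_add, four_mul_add_div] at *
  interval_cases i <;> norm_num [resInd, Nat.mul_add_mod] at h1 h2 h3 ⊢ <;>
    unfold runsS runsD <;> omega

theorem le_runs_staller_centre {s t : ℕ} (h : 0 < s + t) :
    runsS (s + t) 0 0 0 ≤
      1 + runsD ((4 * s - 1) / 4 + (4 * t - 1) / 4)
        (resInd 1 (4 * s - 1) + resInd 1 (4 * t - 1))
        (resInd 2 (4 * s - 1) + resInd 2 (4 * t - 1))
        (resInd 3 (4 * s - 1) + resInd 3 (4 * t - 1)) := by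
  rcases s with _ | s <;> rcases t with _ | t
  · omega
  · rw [show 4 * (t + 1) - 1 = 4 * t + 3 by omega, resInd_four_mul_add, four_mul_add_div]
    norm_num [resInd, resInd_four_mul_add, runsS, runsD]; omega
  · rw [show 4 * (s + 1) - 1 = 4 * s + 3 by omega, resInd_four_mul_add, four_mul_add_div]
    norm_num [resInd, resInd_four_mul_add, runsS, runsD]; omega
  · rw [show 4 * (t + 1) - 1 = 4 * t + 3 by omega, show 4 * (s + 1) - 1 = 4 * s + 3 by omega]
    simp only [resInd_four_mul_add, four_mul_add_div]
    norm_num [resInd, runsS, runsD]; omega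

/-- Dominator has broken a run of length `4 * s` into `a` and `b`, and Staller removes one vertex
from the other run at `c`, of length `k + 1`. In the next two lemmas she instead shortens the piece
at `c`, or plays `c` itself. -/
theorem le_respond_other {a b s k m n₁ n₂ n₃ : ℕ}
    (h : a + b + 3 = 4 * s ∨ b = 0 ∧ (a + 2 = 4 * s ∨ a + 1 = 4 * s)) (hk : k % 4 = 0) :
    runsD (s + ((k + 1) / 4 + m)) (resInd 1 (k + 1) + n₁) (resInd 2 (k + 1) + n₂)
        (resInd 3 (k + 1) + n₃) ≤
      2 + runsD (a / 4 + (k / 4 + (b / 4 + m)))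
        (resInd 1 a + (resInd 1 k + (resInd 1 b + n₁)))
        (resInd 2 a + (resInd 2 k + (resInd 2 b + n₂)))
        (resInd 3 a + (resInd 3 k + (resInd 3 b + n₃))) := by
  obtain ⟨t, rfl⟩ : ∃ t, k = 4 * t + 0 := ⟨k / 4, by omega⟩
  obtain ⟨j, i, hi, rfl⟩ : ∃ j i, i < 4 ∧ a = 4 * j + i :=
    ⟨a / 4, a % 4, Nat.mod_lt _ (by norm_num), by omega⟩
  rcases h with h | ⟨rfl, h⟩
  · obtain ⟨j', hj⟩ : ∃ j', b = 4 * j' + (5 - i) % 4 := ⟨b / 4, by omega⟩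
    subst hj
    rw [add_assoc]
    interval_cases i <;> simp only [resInd_four_mul_add, four_mul_add_div] <;>
      norm_num [resInd] <;> unfold runsD <;> omega
  · rw [add_assoc]
    interval_cases i <;> simp only [resInd_four_mul_add, four_mul_add_div] <;>
      norm_num [resInd] <;> unfold runsD <;> omega

theorem le_respond_self {a b s k m n₁ n₂ n₃ : ℕ}
    (h : a + 1 + b + 3 = 4 * s ∨ b = 0 ∧ (a + 1 + 2 = 4 * s ∨ a + 1 + 1 = 4 * s))
    (ha : a % 4 = 0) :
    runsD (s + (k / 4 + m)) (resInd 1 k + n₁) (resInd 2 k + n₂) (resInd 3 k + n₃) ≤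
      2 + runsD (a / 4 + (k / 4 + (b / 4 + m)))
        (resInd 1 a + (resInd 1 k + (resInd 1 b + n₁)))
        (resInd 2 a + (resInd 2 k + (resInd 2 b + n₂)))
        (resInd 3 a + (resInd 3 k + (resInd 3 b + n₃))) := by
  obtain ⟨j, rfl⟩ : ∃ j, a = 4 * j + 0 := ⟨a / 4, by omega⟩
  obtain ⟨j', rfl⟩ : ∃ j', b = 4 * j' + 0 := ⟨b / 4, by omega⟩
  simp only [resInd_four_mul_add, four_mul_add_div]
  norm_num [resInd]
  unfold runsD
  omega

theorem le_respond_centre {a b s k m n₁ n₂ n₃ : ℕ}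
    (h : a + b + 3 = 4 * s ∨ b = 0 ∧ (a + 2 = 4 * s ∨ a + 1 = 4 * s))
    (ha : a % 4 = 2 ∨ a % 4 = 3) (hk : k % 4 = 2 ∨ k % 4 = 3) :
    runsD (s + (k / 4 + m)) (resInd 1 k + n₁) (resInd 2 k + n₂) (resInd 3 k + n₃) ≤
      2 + runsD ((a - 1) / 4 + ((k - 1) / 4 + (b / 4 + m)))
        (resInd 1 (a - 1) + (resInd 1 (k - 1) + (resInd 1 b + n₁)))
        (resInd 2 (a - 1) + (resInd 2 (k - 1) + (resInd 2 b + n₂)))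
        (resInd 3 (a - 1) + (resInd 3 (k - 1) + (resInd 3 b + n₃))) := by
  obtain ⟨t, e, he, rfl⟩ : ∃ t e, e < 2 ∧ k = 4 * t + (e + 1) + 1 :=
    ⟨k / 4, k % 4 - 2, by omega, by omega⟩
  obtain ⟨j, i, hi, rfl⟩ : ∃ j i, i < 2 ∧ a = 4 * j + (i + 1) + 1 :=
    ⟨a / 4, a % 4 - 2, by omega, by omega⟩
  rcases h with h | ⟨rfl, h⟩
  · obtain ⟨j', hj⟩ : ∃ j', b = 4 * j' + (3 - i) := ⟨b / 4, by omega⟩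
    subst hj
    rw [Nat.add_sub_cancel, Nat.add_sub_cancel, add_assoc (4 * t)]
    interval_cases i <;> interval_cases e <;>
      simp only [resInd_four_mul_add, four_mul_add_div] <;>
      norm_num [resInd] <;> unfold runsD <;> omega
  · rw [Nat.add_sub_cancel, Nat.add_sub_cancel, add_assoc (4 * t)]
    interval_cases i <;> interval_cases e <;>
      simp only [resInd_four_mul_add, four_mul_add_div] <;>
      norm_num [resInd] <;> unfold runsD <;> omega

theorem four_dvd_of_residues (h1 : residues 1 L = 0) (h2 : residues 2 L = 0)
    (h3 : residues 3 L = 0) : ∀ l ∈ L, 4 ∣ l.length := by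
  intro l hl
  obtain ⟨M, rfl⟩ := Multiset.exists_cons_of_mem hl
  rw [residues_cons] at h1 h2 h3
  have := resInd_spec l.length
  omega

theorem Conf.exists_flank (h : Conf G S c A R) {l : List V} (hl : l ∈ A + R) (hne : l ≠ [])
    (hf : l ∈ A → Flanked G S c l) :
    ∃ x ∈ legalMoves G S, ∃ l' A' R' M, l.length = l'.length + 1 ∧ A + R = l ::ₘ M ∧
      A' + R' = l' ::ₘ M ∧ Conf G (S ∪ closedNbhd G x) c A' R' ∧ A'.card = A.card ∧
      (A' = A ∨ ∃ A₀, A = l ::ₘ A₀ ∧ A' = l' ::ₘ A₀) := by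
  rcases Multiset.mem_add.1 hl with hl | hl
  · replace hf := hf hl
    obtain ⟨A₀, rfl⟩ := Multiset.exists_cons_of_mem hl
    obtain ⟨x, -, -, hx, l', y, h1, h2⟩ := h.exists_flank_centre hf
    exact ⟨x, hx, l', l' ::ₘ A₀, R, A₀ + R, by simp [h1], by simp, by simp, h2, by simp,
      .inr ⟨A₀, rfl, rfl⟩⟩
  · obtain ⟨R₀, rfl⟩ := Multiset.exists_cons_of_mem hl
    obtain ⟨x, -, -, hx, l', h1, h2⟩ := h.exists_flank_run hne
    exact ⟨x, hx, l', A, l' ::ₘ R₀, A + R₀, h1, by simp, by simp, h2, rfl, .inl rfl⟩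

theorem Conf.exists_flank_of_mod (h : Conf G S c A R) {l : List V} (hl : l ∈ A + R)
    (h4 : ¬ 4 ∣ l.length) :
    ∃ x ∈ legalMoves G S, ∃ l' A' R' M, l.length = l'.length + 1 ∧ A + R = l ::ₘ M ∧
      A' + R' = l' ::ₘ M ∧ Conf G (S ∪ closedNbhd G x) c A' R' ∧ A'.card = A.card ∧
      (A' = A ∨ ∃ A₀, A = l ::ₘ A₀ ∧ A' = l' ::ₘ A₀) :=
  h.exists_flank hl (by rintro rfl; simp at h4) fun hlA => (h.flankA l hlA).resolve_left h4

theorem Conf.legal_centre (h : Conf G S c A R) {l : List V} (hl : l ∈ A) (hne : l ≠ []) :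
    c ∈ legalMoves G S := by
  rcases l with _ | ⟨y, t⟩
  · exact absurd rfl hne
  have hy : y ∉ S := h.runs.notMem (Multiset.mem_add.2 (.inl hl)) (by simp)
  exact mem_legalMoves.2 ⟨y, (h.nbr y hy).2 ⟨_, hl, by simp⟩, hy⟩

/-- The optimal number of moves with two runs at `c`, one of them of length divisible by four, is at
least the number for disjoint runs. -/
def JoinedBound (G : SimpleGraph V) [DecidableRel G.Adj] (c : V) (S : Finset V) : Prop :=
  ∀ A R, Conf G S c A R → A.card = 2 → (∃ l ∈ A, 4 ∣ l.length) →
    valueD (A + R) ≤ gameNumber G .dominator S ∧ valueS (A + R) ≤ gameNumber G .staller S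

theorem JoinedBound.of_zero (h : JoinedBound G c S) (h' : Conf G S c 0 R) :
    valueD R ≤ gameNumber G .dominator S ∧ valueS R ≤ gameNumber G .staller S := by
  have := h _ R h'.nil_cons.nil_cons (by simp) ⟨[], by simp, by simp⟩
  simpa [valueD, valueS, resInd_zero] using this

/-- Staller's answer to a move of Dominator on a run at `c` that has become too short. -/
theorem Conf.respond {l k : List V} {T : Multiset (List V)} {s : ℕ}
    (ih : ∀ x ∈ legalMoves G S, JoinedBound G c (S ∪ closedNbhd G x))
    (h : Conf G S c (l ::ₘ {k}) (T + R)) {b : ℕ} (hT : ∀ i, residues (i + 1) T = resInd (i + 1) b)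
    (hT' : quarters T = b / 4) (hl : ¬ 4 ∣ l.length) (hk : ¬ 4 ∣ k.length)
    (hs : l.length + b + 3 = 4 * s ∨ b = 0 ∧ (l.length + 2 = 4 * s ∨ l.length + 1 = 4 * s)) :
    runsD (s + (k.length / 4 + quarters R)) (resInd 1 k.length + residues 1 R)
      (resInd 2 k.length + residues 2 R) (resInd 3 k.length + residues 3 R) ≤
        1 + gameNumber G .staller S := by
  -- `T` stands for the piece cut off by Dominator, with `b = 0` if there is none. A run at `c` of
  -- residue 1 is shortened so that one length is again divisible by four. Otherwise both residues
  -- are 2 or 3; then a move at `c` that shortens both runs is good enough and separates them from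
  -- `c`.
  by_cases hk1 : k.length % 4 = 1
  · obtain ⟨x, -, -, hx, k', y, h1, h2⟩ := Conf.exists_flank_centre (l := k) (A₀ := {l})
      (by rwa [show k ::ₘ {l} = l ::ₘ {k} from Multiset.pair_comm k l]) ((h.flankA k (by simp)).resolve_left hk)
    have hk' : k.length = k'.length + 1 := by simp [h1]
    have h3 := (ih x hx _ _ h2 (by simp) ⟨k', by simp, by omega⟩).1
    have h4 := le_staller hx
    have := le_respond_other (k := k'.length) (m := quarters R) (n₁ := residues 1 R)
      (n₂ := residues 2 R) (n₃ := residues 3 R) hs (by omega)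
    rw [hk']
    refine this.trans ?_
    have h5 : 1 + (1 + valueD (k' ::ₘ {l} + (T + R))) ≤ 1 + gameNumber G .staller S :=
      Nat.add_le_add_left ((Nat.add_le_add_left h3 1).trans h4) 1
    rw [← add_assoc] at h5
    simpa [valueD, hT, hT', add_assoc, add_left_comm] using h5
  by_cases hl1 : l.length % 4 = 1
  · obtain ⟨x, -, -, hx, l', y, h1, h2⟩ := h.exists_flank_centre
      ((h.flankA l (by simp)).resolve_left hl)
    have hl' : l.length = l'.length + 1 := by simp [h1]
    have h3 := (ih x hx _ _ h2 (by simp) ⟨l', by simp, by omega⟩).1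
    have h4 := le_staller hx
    rw [hl'] at hs
    have := le_respond_self (k := k.length) (m := quarters R) (n₁ := residues 1 R)
      (n₂ := residues 2 R) (n₃ := residues 3 R) hs (by omega)
    refine this.trans ?_
    have h5 : 1 + (1 + valueD (l' ::ₘ {k} + (T + R))) ≤ 1 + gameNumber G .staller S :=
      Nat.add_le_add_left ((Nat.add_le_add_left h3 1).trans h4) 1
    rw [← add_assoc] at h5
    simpa [valueD, hT, hT', add_assoc, add_left_comm] using h5
  · have hx := h.legal_centre (l := l) (by simp) (by rintro rfl; simp at hl)
    have h3 := ((ih c hx).of_zero h.play_centre).1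
    have h4 := le_staller hx
    have := le_respond_centre (k := k.length) (m := quarters R) (n₁ := residues 1 R)
      (n₂ := residues 2 R) (n₃ := residues 3 R) hs (by omega) (by omega)
    refine this.trans ?_
    have h5 : 1 + (1 + valueD (Multiset.map List.tail (l ::ₘ {k}) + (T + R))) ≤
        1 + gameNumber G .staller S :=
      Nat.add_le_add_left ((Nat.add_le_add_left h3 1).trans h4) 1
    rw [← add_assoc] at h5
    simpa [valueD, hT, hT', add_assoc, add_left_comm] using h5

/-- Runs whose length is not divisible by four are flanked, so Staller can remove a single vertex
from them in the order of `le_runs_staller`. A run at `c` of length divisible by four may be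
reachable only through `c`. Keeping one of the two runs at `c` of such length prevents this from
costing her anything; `Conf.respond` restores the property when Dominator destroys it. -/
theorem Conf.le_gameNumber (h : Conf G S c A R) (hA : A.card = 2) (h4 : ∃ l ∈ A, 4 ∣ l.length) :
    valueD (A + R) ≤ gameNumber G .dominator S ∧
      valueS (A + R) ≤ gameNumber G .staller S := by
  induction hn : Sᶜ.card using Nat.strong_induction_on generalizing S A R with
  | _ n ih =>
    subst hn
    replace ih : ∀ T : Finset V, Tᶜ.card < Sᶜ.card → JoinedBound G c T :=
      fun T hT A R h1 h2 h3 => ih _ hT h1 h2 h3 rfl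
    -- `Conf.respond` looks one pair of moves ahead.
    have ih2 : ∀ x ∈ legalMoves G S, ∀ y ∈ legalMoves G (S ∪ closedNbhd G x),
        JoinedBound G c (S ∪ closedNbhd G x ∪ closedNbhd G y) :=
      fun x hx y hy => ih _ ((card_compl_lt hy).trans (card_compl_lt hx))
    replace ih : ∀ x ∈ legalMoves G S, JoinedBound G c (S ∪ closedNbhd G x) :=
      fun x hx => ih _ (card_compl_lt hx)
    by_cases hS : ∀ v, v ∈ S
    · have h0 : Sᶜ.card = 0 := by
        rw [Finset.card_eq_zero, Finset.eq_empty_iff_forall_notMem]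
        intro v
        simp [hS v]
      rw [h.runs.card_compl, card_verts] at h0
      have : quarters (A + R) = 0 ∧ residues 1 (A + R) = 0 ∧ residues 2 (A + R) = 0 ∧
          residues 3 (A + R) = 0 := by omega
      simp only [valueD, valueS, this]
      exact ⟨Nat.zero_le _, Nat.zero_le _⟩
    push Not at hS
    obtain ⟨v, hv⟩ := hS
    constructor
    · refine le_dominator hv fun x hx => ?_
      by_cases hxc : x = c
      · subst hxc
        refine le_trans ?_ (Nat.add_le_add_left ((ih x hx).of_zero h.play_centre).2 1)
        obtain ⟨k, hk, s, hs⟩ := h4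
        obtain ⟨A₀, rfl⟩ := Multiset.exists_cons_of_mem hk
        obtain ⟨l, rfl⟩ := cons_singleton_of_card_eq_two hA rfl
        have hpos : 0 < l.length + s := by
          obtain ⟨y, hy, hyS⟩ := mem_legalMoves.1 hx
          obtain ⟨j, hj, hyj⟩ := (h.nbr y hyS).1 hy
          have := List.length_pos_of_mem (List.mem_of_mem_head? hyj)
          simp only [Multiset.mem_cons, Multiset.mem_singleton] at hj
          rcases hj with rfl | rfl <;> omega
        have := le_runs_dominator_centre (m := quarters R) (n₁ := residues 1 R)
          (n₂ := residues 2 R) (n₃ := residues 3 R) hpos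
        simpa [valueD, valueS, hs, resInd_four_mul, resInd_zero, add_assoc, add_left_comm]
          using this
      rcases h.move hx hxc with ⟨p, q, A₀, rfl, h1⟩ | ⟨p, q, R₀, rfl, h1⟩ |
        ⟨-, l, y, A₀, rfl, h1⟩ | ⟨-, l, l', R₀, rfl, h0, h1⟩
      · obtain ⟨k, rfl⟩ := cons_singleton_of_card_eq_two hA rfl
        by_cases h5 : 4 ∣ p.dropLast.length ∨ 4 ∣ k.length
        · refine le_trans ?_ (Nat.add_le_add_left
            (ih x hx _ _ h1 (by simp) (by simpa using h5)).2 1)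
          have := le_runs_dominator_inner (a := p.length) (b := q.length) (m := k.length / 4 + quarters R)
            (n₁ := resInd 1 k.length + residues 1 R) (n₂ := resInd 2 k.length + residues 2 R)
            (n₃ := resInd 3 k.length + residues 3 R) rfl
          simpa [valueD, valueS, add_assoc, add_left_comm] using this
        · push Not at h5
          obtain ⟨s, hs⟩ : 4 ∣ (p ++ x :: q).length := by
            obtain ⟨j, hj, hj4⟩ := h4
            simp only [Multiset.mem_cons, Multiset.mem_singleton] at hj
            rcases hj with rfl | rfl
            · exact hj4
            · exact absurd hj4 h5.2
          have hs' := hs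
          rw [List.length_append, List.length_cons] at hs'
          rw [List.length_dropLast] at h5
          rw [← Multiset.singleton_add q.tail] at h1
          have := Conf.respond (s := s) (b := q.length - 1) (ih2 x hx) h1 (by simp) (by simp)
            (by simpa using h5.1) h5.2 (by rw [List.length_dropLast]; omega)
          simpa [-List.length_append, valueD, hs, resInd_four_mul, resInd_zero, add_assoc]
            using this
      · refine le_trans ?_ (Nat.add_le_add_left (ih x hx _ _ h1 hA h4).2 1)
        have := le_runs_dominator_inner (a := p.length) (b := q.length)
          (m := quarters A + quarters R₀)
          (n₁ := residues 1 A + residues 1 R₀) (n₂ := residues 2 A + residues 2 R₀)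
          (n₃ := residues 3 A + residues 3 R₀) rfl
        simpa [valueD, valueS, add_assoc, add_left_comm] using this
      · obtain ⟨k, rfl⟩ := cons_singleton_of_card_eq_two hA rfl
        by_cases h5 : 4 ∣ l.length ∨ 4 ∣ k.length
        · refine le_trans ?_ (Nat.add_le_add_left
            (ih x hx _ _ h1 (by simp) (by simpa using h5)).2 1)
          have := le_runs_dominator_sub_one (k := l.length) (m := k.length / 4 + quarters R)
            (n₁ := resInd 1 k.length + residues 1 R) (n₂ := resInd 2 k.length + residues 2 R)
            (n₃ := resInd 3 k.length + residues 3 R)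
          simpa [valueD, valueS, add_assoc, add_left_comm] using this
        · push Not at h5
          obtain ⟨s, hs⟩ : 4 ∣ (l ++ [y]).length := by
            obtain ⟨j, hj, hj4⟩ := h4
            simp only [Multiset.mem_cons, Multiset.mem_singleton] at hj
            rcases hj with rfl | rfl
            · exact hj4
            · exact absurd hj4 h5.2
          have hs' := hs
          rw [List.length_append, List.length_singleton] at hs'
          rw [← zero_add R] at h1
          have := Conf.respond (s := s) (b := 0) (ih2 x hx) h1 (by simp [resInd_zero]) (by simp)
            h5.1 h5.2 (by omega)
          simpa [-List.length_append, valueD, hs, resInd_four_mul, resInd_zero, add_assoc]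
            using this
      · refine le_trans ?_ (Nat.add_le_add_left (ih x hx _ _ h1 hA h4).2 1)
        have := le_runs_dominator_sub_one (k := l'.length) (m := quarters A + quarters R₀)
          (n₁ := residues 1 A + residues 1 R₀) (n₂ := residues 2 A + residues 2 R₀)
          (n₃ := residues 3 A + residues 3 R₀)
        simpa [valueD, valueS, h0, add_assoc, add_left_comm] using this
    · have key : ∀ l ∈ A + R, l ≠ [] → (l ∈ A → Flanked G S c l) →
          (0 < residues 3 (A + R) → l.length % 4 = 3) →
          (0 < residues 2 (A + R) → 0 < residues 3 (A + R) ∨ l.length % 4 = 2) →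
          (0 < residues 1 (A + R) → 0 < residues 3 (A + R) ∨ 0 < residues 2 (A + R) ∨
            l.length % 4 = 1) → valueS (A + R) ≤ gameNumber G .staller S := by
        intro l hl hne hf c3 c2 c1
        obtain ⟨x, hx, l', A', R', M, h1, h2, h3, h5, h6, h7⟩ := h.exists_flank hl hne hf
        have h8 : ∃ k ∈ A', 4 ∣ k.length := by
          rcases h7 with rfl | ⟨A₀, rfl, rfl⟩
          · exact h4
          · obtain ⟨k, rfl⟩ := cons_singleton_of_card_eq_two hA rfl
            refine ⟨k, by simp, ?_⟩
            obtain ⟨j, hj, hj4⟩ := h4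
            simp only [Multiset.mem_cons, Multiset.mem_singleton] at hj
            rcases hj with rfl | rfl
            -- By the priorities, a run of length divisible by four is shortened only if there are
            -- no others, so `k` has such a length too.
            · exact four_dvd_of_residues (L := (j ::ₘ {k}) + R) (by omega) (by omega) (by omega) k
                (Multiset.mem_add.2 (.inl (by simp)))
            · exact hj4
        refine le_trans ?_ (le_staller hx)
        refine le_trans ?_ (Nat.add_le_add_left (ih x hx _ _ h5 (h6.trans hA) h8).1 1)
        rw [h2] at c1 c2 c3
        rw [h2, h3]
        simp only [residues_cons, h1] at c1 c2 c3
        simp only [valueS, valueD, quarters_cons, residues_cons, h1]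
        exact le_runs_staller c3 c2 c1
      by_cases r3 : 0 < residues 3 (A + R)
      · obtain ⟨l, hl, h'⟩ := exists_of_residues_pos r3
        exact key l hl (by rintro rfl; simp at h')
          (fun hlA => (h.flankA l hlA).resolve_left (by omega)) (fun _ => h') (fun _ => .inl r3)
          (fun _ => .inl r3)
      by_cases r2 : 0 < residues 2 (A + R)
      · obtain ⟨l, hl, h'⟩ := exists_of_residues_pos r2
        exact key l hl (by rintro rfl; simp at h')
          (fun hlA => (h.flankA l hlA).resolve_left (by omega)) (fun h => absurd h r3)
          (fun _ => .inr h') (fun _ => .inr (.inl r2))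
      by_cases r1 : 0 < residues 1 (A + R)
      · obtain ⟨l, hl, h'⟩ := exists_of_residues_pos r1
        exact key l hl (by rintro rfl; simp at h')
          (fun hlA => (h.flankA l hlA).resolve_left (by omega)) (fun h => absurd h r3)
          (fun h => absurd h r2) (fun _ => .inr (.inr h'))
      by_cases hf : ∃ l ∈ A + R, l ≠ [] ∧ (l ∈ A → Flanked G S c l)
      · obtain ⟨l, hl, hne, hf⟩ := hf
        exact key l hl hne hf (fun h => absurd h r3) (fun h => absurd h r2) (fun h => absurd h r1)
      · push Not at hf
        -- Without flanks only unflanked runs at `c` are left, all of length divisible by four, and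
        -- Staller has to play `c`.
        have hR : ∀ l ∈ R, l = [] := by
          intro l hl
          by_contra hne
          obtain ⟨hlA, hlf⟩ := hf l (Multiset.mem_add.2 (.inr hl)) hne
          exact hlf ((h.flankR l hl).resolve_left hne)
        obtain ⟨l, hl, hvl⟩ := h.runs.exists_mem hv
        have hlA : l ∈ A := (Multiset.mem_add.1 hl).resolve_right
          fun hl => List.ne_nil_of_mem hvl (hR l hl)
        have hd := four_dvd_of_residues (L := A + R) (by omega) (by omega) (by omega)
        obtain ⟨A₀, rfl⟩ := Multiset.exists_cons_of_mem hlA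
        obtain ⟨k, rfl⟩ := cons_singleton_of_card_eq_two hA rfl
        obtain ⟨s, hs⟩ := hd l hl
        obtain ⟨t, ht⟩ := hd k (by simp)
        have hx := h.legal_centre hlA (List.ne_nil_of_mem hvl)
        refine le_trans ?_ (le_staller hx)
        refine le_trans ?_ (Nat.add_le_add_left ((ih c hx).of_zero h.play_centre).1 1)
        have hq : quarters R = 0 ∧ ∀ i, residues (i + 1) R = 0 := by
          rw [Multiset.eq_replicate_of_mem hR]
          simp [quarters, residues, resInd_zero]
        have := le_runs_staller_centre (s := s) (t := t)
          (by have := List.length_pos_of_mem hvl; omega)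
        simpa [valueS, valueD, hs, ht, hq, resInd_four_mul, resInd_zero, add_assoc] using this

/-! ### Staller's strategy around an undominated centre -/

theorem le_open_dominator_centre {s t m n₁ n₂ n₃ : ℕ} :
    runsD (s + (t + m)) (n₁ + 1) n₂ n₃ ≤
      1 + runsS ((4 * s - 1) / 4 + ((4 * t - 1) / 4 + m))
        (resInd 1 (4 * s - 1) + (resInd 1 (4 * t - 1) + n₁))
        (resInd 2 (4 * s - 1) + (resInd 2 (4 * t - 1) + n₂))
        (resInd 3 (4 * s - 1) + (resInd 3 (4 * t - 1) + n₃)) := by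
  rcases s with _ | s <;> rcases t with _ | t
  · norm_num [resInd]; unfold runsS runsD; omega
  · rw [show 4 * (t + 1) - 1 = 4 * t + 3 by omega, resInd_four_mul_add, four_mul_add_div]
    norm_num [resInd, resInd_four_mul_add]; unfold runsS runsD; omega
  · rw [show 4 * (s + 1) - 1 = 4 * s + 3 by omega, resInd_four_mul_add, four_mul_add_div]
    norm_num [resInd, resInd_four_mul_add]; unfold runsS runsD; omega
  · rw [show 4 * (t + 1) - 1 = 4 * t + 3 by omega, show 4 * (s + 1) - 1 = 4 * s + 3 by omega]
    simp only [resInd_four_mul_add, four_mul_add_div]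
    norm_num [resInd]; unfold runsS runsD; omega

theorem le_runs_head {k s m n₁ n₂ n₃ : ℕ} (h : k + 1 = 4 * s) :
    runsD (s + m) (n₁ + 1) n₂ n₃ ≤ 1 + runsS ((k - 1) / 4 + m) (resInd 1 (k - 1) + n₁)
      (resInd 2 (k - 1) + n₂) (resInd 3 (k - 1) + n₃) := by
  obtain ⟨j, rfl⟩ : ∃ j, k = 4 * j + 2 + 1 := ⟨k / 4, by omega⟩
  simp only [Nat.add_sub_cancel, resInd_four_mul_add, four_mul_add_div]
  norm_num [resInd]
  unfold runsS runsD
  omega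

/-- After Dominator has broken a run at the centre, Staller dominates the centre alone. The
untouched run has length divisible by four, so `Conf.le_gameNumber` gives the value of what remains.
-/
theorem le_open_respond {a b s m n₁ n₂ n₃ : ℕ}
    (h : a + b + 3 = 4 * s ∨ b = 0 ∧ (a + 2 = 4 * s ∨ a + 1 = 4 * s)) :
    runsD (s + m) (n₁ + 1) n₂ n₃ ≤
      2 + runsD (a / 4 + (b / 4 + m)) (resInd 1 a + (resInd 1 b + n₁))
        (resInd 2 a + (resInd 2 b + n₂)) (resInd 3 a + (resInd 3 b + n₃)) := by
  obtain ⟨j, i, hi, rfl⟩ : ∃ j i, i < 4 ∧ a = 4 * j + i :=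
    ⟨a / 4, a % 4, Nat.mod_lt _ (by norm_num), by omega⟩
  rcases h with h | ⟨rfl, h⟩
  · obtain ⟨j', hj⟩ : ∃ j', b = 4 * j' + (5 - i) % 4 := ⟨b / 4, by omega⟩
    subst hj
    interval_cases i <;> simp only [resInd_four_mul_add, four_mul_add_div] <;>
      norm_num [resInd] <;> unfold runsD <;> omega
  · interval_cases i <;> simp only [resInd_four_mul_add, four_mul_add_div] <;>
      norm_num [resInd] <;> unfold runsD <;> omega

theorem Open.union_closedNbhd (h : Open G S c A R) {x : V} (hx : x ∈ S)
    (hcx : c ∈ closedNbhd G x) : S ∪ closedNbhd G x = insert c S := by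
  rw [← insert_union_closedNbhd_of_mem hcx]
  exact Finset.union_eq_left.2 (h.adj x hx hcx)

/-- A dominated neighbour of `c` is a move for Staller that dominates `c` and nothing else new. -/
theorem Open.le_staller (h : Open G S c A R) (h0 : ∃ x ∈ S, c ∈ closedNbhd G x) :
    1 + gameNumber G .dominator (insert c S) ≤ gameNumber G .staller S := by
  obtain ⟨x, hx, hcx⟩ := h0
  rw [← h.union_closedNbhd hx hcx]
  exact DominationGame.le_staller (mem_legalMoves.2 ⟨c, hcx, h.notMem⟩)

theorem exists_mem_union {x : V} (h0 : ∃ x ∈ S, c ∈ closedNbhd G x) :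
    ∃ y ∈ S ∪ closedNbhd G x, c ∈ closedNbhd G y := by
  obtain ⟨y, hy, hc⟩ := h0
  exact ⟨y, Finset.mem_union_left _ hy, hc⟩

theorem Conf.le_gameNumber_zero (h : Conf G S c 0 R) :
    valueD R ≤ gameNumber G .dominator S ∧ valueS R ≤ gameNumber G .staller S :=
  JoinedBound.of_zero (fun _ _ h h1 h2 => h.le_gameNumber h1 h2) h

/-- Staller's strategy around an undominated centre that has a dominated neighbour. -/
theorem Open.le_gameNumber (h : Open G S c A R) (hA : A.card = 2) (h4 : ∀ l ∈ A, 4 ∣ l.length)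
    (h0 : ∃ x ∈ S, c ∈ closedNbhd G x) :
    runsD (quarters A + quarters R) (residues 1 R + 1) (residues 2 R) (residues 3 R) ≤
        gameNumber G .dominator S ∧
      runsS (quarters A + quarters R) (residues 1 R + 1) (residues 2 R) (residues 3 R) ≤
        gameNumber G .staller S := by
  induction hn : Sᶜ.card using Nat.strong_induction_on generalizing S R with
  | _ n ih =>
    subst hn
    have hA1 : ∃ l ∈ A, 4 ∣ l.length := by
      obtain ⟨l, k, rfl⟩ := Multiset.card_eq_two.1 hA
      exact ⟨l, by simp, h4 l (by simp)⟩
    have hrA : ∀ i, residues (i + 1) A = 0 := fun i => residues_eq_zero h4 i.succ_pos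
    constructor
    · refine le_dominator h.notMem fun x hx => ?_
      rcases h.move hx with ⟨-, h1⟩ | ⟨-, -, h1⟩ | ⟨q, A₀, rfl, h1⟩ | ⟨p, q, A₀, hp, rfl, h1⟩ |
        ⟨p, q, R₀, rfl, h1⟩ | ⟨-, l, y, A₀, rfl, h1⟩ | ⟨-, l, l', R₀, rfl, h0', h1⟩
      · obtain ⟨l, k, rfl⟩ := Multiset.card_eq_two.1 hA
        obtain ⟨s, hs⟩ := h4 l (by simp)
        obtain ⟨t, ht⟩ := h4 k (by simp)
        refine le_trans ?_ (Nat.add_le_add_left h1.le_gameNumber_zero.2 1)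
        have := le_open_dominator_centre (s := s) (t := t) (m := quarters R)
          (n₁ := residues 1 R) (n₂ := residues 2 R) (n₃ := residues 3 R)
        simpa [valueS, hs, ht, add_assoc] using this
      · refine le_trans ?_ (Nat.add_le_add_left (h1.le_gameNumber hA hA1).2 1)
        simp only [valueS, quarters_add, residues_add, hrA]
        unfold runsD runsS
        omega
      · obtain ⟨k, rfl⟩ := cons_singleton_of_card_eq_two hA rfl
        obtain ⟨s, hs⟩ := h4 (x :: q) (by simp)
        obtain ⟨t, ht⟩ := h4 k (by simp)
        rw [List.length_cons] at hs
        refine le_trans ?_ (Nat.add_le_add_left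
          (h1.le_gameNumber (by simp) ⟨[], by simp, by simp⟩).2 1)
        have := le_runs_head (m := t + quarters R) (n₁ := residues 1 R)
          (n₂ := residues 2 R) (n₃ := residues 3 R) hs
        simpa [valueS, hs, ht, resInd_four_mul, resInd_zero, add_assoc, add_left_comm] using this
      · obtain ⟨k, rfl⟩ := cons_singleton_of_card_eq_two hA rfl
        obtain ⟨s, hs⟩ := h4 (p ++ x :: q) (by simp)
        obtain ⟨t, ht⟩ := h4 k (by simp)
        have hs' := hs
        rw [List.length_append, List.length_cons] at hs'
        have hp' := List.length_pos_of_ne_nil hp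
        have h2 := h1.le_staller (exists_mem_union h0)
        have h3 := (h1.conf.le_gameNumber (by simp) ⟨k, by simp, ⟨t, ht⟩⟩).1
        have := le_open_respond (a := p.length - 1) (b := q.length - 1) (s := s)
          (m := t + quarters R) (n₁ := residues 1 R) (n₂ := residues 2 R) (n₃ := residues 3 R)
          (by omega)
        refine le_trans ?_ (Nat.add_le_add_left ((Nat.add_le_add_left h3 1).trans h2) 1)
        rw [← add_assoc]
        simpa [-List.length_append, valueD, hs, ht, resInd_four_mul, resInd_zero, add_assoc,
          add_left_comm] using this
      · refine le_trans ?_ (Nat.add_le_add_left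
          (ih _ (card_compl_lt hx) h1 (exists_mem_union h0) rfl).2 1)
        have := le_runs_dominator_inner (a := p.length) (b := q.length)
          (m := quarters A + quarters R₀) (n₁ := residues 1 R₀ + 1) (n₂ := residues 2 R₀)
          (n₃ := residues 3 R₀) rfl
        simpa [add_assoc, add_left_comm] using this
      · obtain ⟨k, rfl⟩ := cons_singleton_of_card_eq_two hA rfl
        obtain ⟨s, hs⟩ := h4 (l ++ [y]) (by simp)
        obtain ⟨t, ht⟩ := h4 k (by simp)
        have hs' := hs
        rw [List.length_append, List.length_singleton] at hs'
        have h2 := h1.le_staller (exists_mem_union h0)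
        have h3 := (h1.conf.le_gameNumber (by simp) ⟨k, by simp, ⟨t, ht⟩⟩).1
        have := le_open_respond (a := l.length) (b := 0) (s := s)
          (m := t + quarters R) (n₁ := residues 1 R) (n₂ := residues 2 R) (n₃ := residues 3 R)
          (by omega)
        refine le_trans ?_ (Nat.add_le_add_left ((Nat.add_le_add_left h3 1).trans h2) 1)
        rw [← add_assoc]
        simpa [-List.length_append, valueD, hs, ht, resInd_four_mul, resInd_zero, add_assoc,
          add_left_comm] using this
      · refine le_trans ?_ (Nat.add_le_add_left
          (ih _ (card_compl_lt hx) h1 (exists_mem_union h0) rfl).2 1)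
        have := le_runs_dominator_sub_one (k := l'.length)
          (m := quarters A + quarters R₀) (n₁ := residues 1 R₀ + 1) (n₂ := residues 2 R₀)
          (n₃ := residues 3 R₀)
        simpa [h0', add_assoc, add_left_comm] using this
    · have key : ∀ l ∈ R, l ≠ [] →
          (0 < residues 3 R → l.length % 4 = 3) →
          (0 < residues 2 R → 0 < residues 3 R ∨ l.length % 4 = 2) →
          (0 < residues 3 R ∨ 0 < residues 2 R ∨ l.length % 4 = 1) →
          runsS (quarters A + quarters R) (residues 1 R + 1) (residues 2 R) (residues 3 R) ≤
            gameNumber G .staller S := by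
        intro l hl hne c3 c2 c1
        obtain ⟨R₀, rfl⟩ := Multiset.exists_cons_of_mem hl
        obtain ⟨x, hx, l', h1, h2⟩ := h.exists_flank_run hne
        refine le_trans ?_ (DominationGame.le_staller hx)
        refine le_trans ?_ (Nat.add_le_add_left
          (ih _ (card_compl_lt hx) h2 (exists_mem_union h0) rfl).1 1)
        simp only [residues_cons, h1] at c1 c2 c3
        have := le_runs_staller (m := quarters A + quarters R₀) (n₁ := residues 1 R₀ + 1) c3 c2
          (fun _ => c1)
        simpa [h1, add_assoc, add_left_comm] using this
      by_cases r3 : 0 < residues 3 R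
      · obtain ⟨l, hl, h'⟩ := exists_of_residues_pos r3
        exact key l hl (by rintro rfl; simp at h') (fun _ => h') (fun _ => .inl r3) (.inl r3)
      by_cases r2 : 0 < residues 2 R
      · obtain ⟨l, hl, h'⟩ := exists_of_residues_pos r2
        exact key l hl (by rintro rfl; simp at h') (fun h => absurd h r3)
          (fun _ => .inr h') (.inr (.inl r2))
      by_cases r1 : 0 < residues 1 R
      · obtain ⟨l, hl, h'⟩ := exists_of_residues_pos r1
        exact key l hl (by rintro rfl; simp at h') (fun h => absurd h r3)
          (fun h => absurd h r2) (.inr (.inr h'))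
      refine le_trans ?_ (h.le_staller h0)
      refine le_trans ?_ (Nat.add_le_add_left (h.conf.le_gameNumber hA hA1).1 1)
      simp only [valueD, quarters_add, residues_add, hrA]
      unfold runsD runsS
      omega

/-! ### Lower bounds from the number of undominated vertices -/

/-- The number of moves, starting with Dominator, needed to dominate `n` vertices if Dominator
dominates three of them with each move and Staller one. -/
def low (n : ℕ) : ℕ := n / 4 + (n + 3) / 4

/-- A move of Dominator that dominates at most three vertices. If none are left, no bound on the
rest is needed, since `low n ≤ 1` for `n ≤ 3`. -/
theorem low_le_of_step {n n' g : ℕ} (h : n ≤ n' + 3) (hg : 0 < n' → 1 + low (n' - 1) ≤ g) :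
    low n ≤ 1 + g := by
  unfold low at *
  omega

theorem low_mono {m n : ℕ} (h : m ≤ n) : low m ≤ low n := by
  unfold low
  omega

theorem low_le_runsS {n m a b c : ℕ} (h : n + 1 = 4 * m + a + 2 * b + 3 * c) :
    1 + low n ≤ runsS m a b c := by
  obtain ⟨t, e, he, rfl⟩ : ∃ t e, e < 4 ∧ c = 4 * t + e :=
    ⟨c / 4, c % 4, Nat.mod_lt _ (by norm_num), by omega⟩
  obtain ⟨u, f, hf, rfl⟩ : ∃ t e, e < 2 ∧ b = 2 * t + e :=
    ⟨b / 2, b % 2, Nat.mod_lt _ (by norm_num), by omega⟩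
  unfold runsS low
  interval_cases e <;> interval_cases f <;> omega

/-- With two runs at `c` no move dominates more than three vertices. If some run at `c` has length
divisible by four, Staller's bound follows from `Conf.le_gameNumber`; otherwise both are flanked and
she can dominate a single vertex. -/
theorem Conf.low_le (h : Conf G S c A R) (hA : A.card = 2) :
    low Sᶜ.card ≤ gameNumber G .dominator S ∧
      (0 < Sᶜ.card → 1 + low (Sᶜ.card - 1) ≤ gameNumber G .staller S) := by
  induction hn : Sᶜ.card using Nat.strong_induction_on generalizing S A R with
  | _ n ih =>
    subst hn
    by_cases hS : Sᶜ.card = 0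
    · simp [hS, low]
    obtain ⟨v, hv⟩ := Finset.card_pos.1 (Nat.pos_of_ne_zero hS)
    rw [Finset.mem_compl] at hv
    have e := h.runs.card_compl
    constructor
    · refine le_dominator hv fun x hx => ?_
      by_cases hxc : x = c
      · subst hxc
        have h1 := h.play_centre
        refine low_le_of_step ?_
          (ih _ (card_compl_lt hx) h1.nil_cons.nil_cons (by simp) rfl).2
        obtain ⟨l, k, rfl⟩ := Multiset.card_eq_two.1 hA
        rw [e, h1.runs.card_compl]
        simp [verts]
        omega
      rcases h.move hx hxc with ⟨p, q, A₀, rfl, h1⟩ | ⟨p, q, R₀, rfl, h1⟩ |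
        ⟨-, l, y, A₀, rfl, h1⟩ | ⟨-, l, l', R₀, rfl, h0, h1⟩ <;>
      · refine low_le_of_step ?_ (ih _ (card_compl_lt hx) h1 (by simpa using hA) rfl).2
        rw [e, h1.runs.card_compl]
        simp [verts_add]
        omega
    · intro _
      by_cases h4 : ∃ l ∈ A, 4 ∣ l.length
      · refine le_trans ?_ (h.le_gameNumber hA h4).2
        have hc := card_verts (A + R)
        rw [← e] at hc
        exact low_le_runsS (by omega)
      · push Not at h4
        obtain ⟨l, k, rfl⟩ := Multiset.card_eq_two.1 hA
        obtain ⟨x, hx, l', A', R', M, h1, h2, h3, h5, h6, -⟩ :=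
          h.exists_flank_of_mod (l := l) (by simp) (h4 l (by simp))
        refine le_trans ?_ (le_staller hx)
        refine le_trans ?_ (Nat.add_le_add_left
          (ih _ (card_compl_lt hx) h5 (h6.trans hA) rfl).1 1)
        rw [e, h5.runs.card_compl, h2, h3]
        simp [h1, add_right_comm _ 1]

theorem Open.low_le (h : Open G S c A R) (hA : A.card = 2) (h0 : ∃ x ∈ S, c ∈ closedNbhd G x) :
    low Sᶜ.card ≤ gameNumber G .dominator S ∧
      1 + low (Sᶜ.card - 1) ≤ gameNumber G .staller S := by
  induction hn : Sᶜ.card using Nat.strong_induction_on generalizing S A R with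
  | _ n ih =>
    subst hn
    have e := h.card_compl
    constructor
    · refine le_dominator h.notMem fun x hx => ?_
      rcases h.move hx with ⟨-, h1⟩ | ⟨-, -, h1⟩ | ⟨q, A₀, rfl, h1⟩ | ⟨p, q, A₀, hp, rfl, h1⟩ |
        ⟨p, q, R₀, rfl, h1⟩ | ⟨-, l, y, A₀, rfl, h1⟩ | ⟨-, l, l', R₀, rfl, h0', h1⟩
      · refine low_le_of_step ?_ (h1.nil_cons.nil_cons.low_le (by simp)).2
        obtain ⟨l, k, rfl⟩ := Multiset.card_eq_two.1 hA
        rw [e, h1.runs.card_compl]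
        simp [verts]
        omega
      · refine low_le_of_step ?_ (h1.low_le hA).2
        rw [e, h1.runs.card_compl]
        omega
      · refine low_le_of_step ?_ (h1.low_le (by simpa using hA)).2
        rw [e, h1.runs.card_compl]
        simp [verts_add]
        omega
      all_goals
        refine low_le_of_step ?_ (fun _ => (ih _ (card_compl_lt hx) h1 (by simpa using hA)
          (exists_mem_union h0) rfl).2)
        rw [e, h1.card_compl]
        simp [verts_add]
        omega
    · refine le_trans ?_ (h.le_staller h0)
      refine le_trans ?_ (Nat.add_le_add_left (h.conf.low_le hA).1 1)
      rw [e, h.conf.runs.card_compl]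
      simp

/-! ### Three runs around an undominated centre -/

/-- Neither `c` nor any of its neighbours are dominated, and `c` has three neighbours. -/
structure Tri (G : SimpleGraph V) [DecidableRel G.Adj] (S : Finset V) (c : V)
    (A R : Multiset (List V)) : Prop extends Open G S c A R where
  card : A.card = 3
  ne_nil : ∀ l ∈ A, l ≠ []
  free : ∀ x ∈ S, c ∉ closedNbhd G x

theorem Conf.flanked_left (h : Conf G S c A R) {p q : List V} {x y : V} (hl : p ++ y :: q ∈ A + R)
    (hp : p ≠ []) (hy : y ∈ closedNbhd G x) : Flanked G (S ∪ closedNbhd G x) c p := by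
  rcases List.eq_nil_or_concat p with rfl | ⟨t, w, rfl⟩
  · exact absurd rfl hp
  refine ⟨y, Finset.mem_union_right _ hy, h.ne_of_notMem (h.runs.notMem hl (by simp)), w, by simp,
    ?_⟩
  rw [h.runs.inner _ y q hl w (h.runs.notMem hl (by simp))]
  simp

theorem Open.flanked_left (h : Open G S c A R) {p q : List V} {x y : V} (hl : p ++ y :: q ∈ A + R)
    (hp : p ≠ []) (hy : y ∈ closedNbhd G x) :
    Flanked G (insert c (S ∪ closedNbhd G x)) c p := by
  rw [← insert_union_closedNbhd]
  exact h.conf.flanked_left hl hp hy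

theorem Tri.of_open (h : Tri G S c A R) {x : V} {A' R' : Multiset (List V)}
    (h' : Open G (S ∪ closedNbhd G x) c A' R') (hA : A'.card = 3) (hne : ∀ l ∈ A', l ≠ [])
    (hhead : ∀ l ∈ A, ∃ l' ∈ A', ∀ y ∈ l.head?, y ∈ l') :
    Tri G (S ∪ closedNbhd G x) c A' R' where
  toOpen := h'
  card := hA
  ne_nil := hne
  free := by
    intro z hz hcz
    have hzS : z ∉ S := fun hzS => h.free z hzS hcz
    have hzc : z ≠ c := by
      rintro rfl
      exact h'.notMem hz
    obtain ⟨l, hl, hzl⟩ := (h.conf.nbr z (by simp [hzS, hzc])).1 (mem_closedNbhd_comm.1 hcz)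
    obtain ⟨l', hl', hy⟩ := hhead l hl
    exact h'.conf.runs.notMem (Multiset.mem_add.2 (.inl hl')) (hy z hzl)
      (Finset.mem_insert_of_mem hz)

theorem Tri.of_cons {A₀ : Multiset (List V)} {l l' r : List V} {u : V} {R' : Multiset (List V)}
    {x : V} (h : Tri G S c (l ::ₘ A₀) R) (h' : Open G (S ∪ closedNbhd G x) c (l' ::ₘ A₀) R')
    (hl : l = l' ++ u :: r) (hl' : l' ≠ []) : Tri G (S ∪ closedNbhd G x) c (l' ::ₘ A₀) R' := by
  refine h.of_open h' (by simpa using h.card) ?_ ?_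
  · intro k hk
    rcases Multiset.mem_cons.1 hk with rfl | hk
    · exact hl'
    · exact h.ne_nil k (by simp [hk])
  · intro k hk
    rcases Multiset.mem_cons.1 hk with rfl | hk
    · refine ⟨l', by simp, fun y hy => ?_⟩
      subst hl
      rcases l' with _ | ⟨w, l'⟩
      · exact absurd rfl hl'
      · obtain rfl : w = y := by simpa using hy
        simp
    · exact ⟨k, by simp [hk], fun y hy => List.mem_of_mem_head? hy⟩

theorem Tri.of_same {R' : Multiset (List V)} {x : V} (h : Tri G S c A R)
    (h' : Open G (S ∪ closedNbhd G x) c A R') : Tri G (S ∪ closedNbhd G x) c A R' :=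
  h.of_open h' h.card h.ne_nil fun l hl => ⟨l, hl, fun _ hy => List.mem_of_mem_head? hy⟩

/-- Once the whole of a run at `c` is dominated, its head is a dominated neighbour of `c`. Two runs
remain and `Open.low_le` applies. -/
theorem Tri.of_nil {A₀ : Multiset (List V)} {u : V} {r : List V} {R' : Multiset (List V)}
    {x : V} (h : Tri G S c ((u :: r) ::ₘ A₀) R)
    (h' : Open G (S ∪ closedNbhd G x) c ([] ::ₘ A₀) R') (hu : u ∈ closedNbhd G x) :
    Open G (S ∪ closedNbhd G x) c A₀ R' ∧ A₀.card = 2 ∧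
      ∃ z ∈ S ∪ closedNbhd G x, c ∈ closedNbhd G z := by
  refine ⟨h'.of_nil_cons, by simpa using h.card, u, Finset.mem_union_right _ hu, ?_⟩
  rw [mem_closedNbhd_comm, h.conf.nbr u (h.conf.runs.notMem (l := u :: r) (by simp) (by simp))]
  exact ⟨_, Multiset.mem_cons_self _ _, by simp⟩

theorem Open.last_mem {A₀ : Multiset (List V)} {l : List V} {x y : V}
    (h : Open G S c ((l ++ [y]) ::ₘ A₀) R) (h' : Open G (S ∪ closedNbhd G x) c (l ::ₘ A₀) R) :
    y ∈ closedNbhd G x := by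
  have hy := h.conf.runs.notMem (l := l ++ [y]) (by simp) (show y ∈ l ++ [y] by simp)
  by_contra hyx
  have hy' : y ∉ insert c (S ∪ closedNbhd G x) := by
    rw [← insert_union_closedNbhd, Finset.mem_union, not_or]
    exact ⟨hy, hyx⟩
  obtain ⟨k, hk, hyk⟩ := h'.conf.runs.exists_mem hy'
  have hnd := h.conf.runs.nodup
  rw [Multiset.cons_add] at hk hnd
  rw [nodup_verts_cons] at hnd
  rcases Multiset.mem_cons.1 hk with rfl | hk
  · exact (List.nodup_append.1 hnd.1).2.2 y hyk y (by simp) rfl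
  · exact hnd.2.2 y (by simp) k hk hyk

/-- The possible moves of Dominator. -/
theorem Tri.dominator_move (h : Tri G S c A R)
    (hf : R = 0 ∨ ∃ l ∈ A, Flanked G (insert c S) c l) {x : V} (hx : x ∈ legalMoves G S) :
    Conf G (S ∪ closedNbhd G x) c 0 (A.map List.tail + R) ∨
      Sᶜ.card ≤ (S ∪ closedNbhd G x)ᶜ.card + 3 ∧
        ((0 < (S ∪ closedNbhd G x)ᶜ.card → 1 + low ((S ∪ closedNbhd G x)ᶜ.card - 1) ≤
          gameNumber G .staller (S ∪ closedNbhd G x)) ∨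
        ∃ A' R', Tri G (S ∪ closedNbhd G x) c A' R' ∧
          ∃ l ∈ A', Flanked G (insert c (S ∪ closedNbhd G x)) c l) := by
  have hmono : insert c S ⊆ insert c (S ∪ closedNbhd G x) :=
    Finset.insert_subset_insert _ Finset.subset_union_left
  rcases h.toOpen.move hx with ⟨-, h1⟩ | ⟨hxS, hcx, -⟩ | ⟨q, A₀, rfl, h1⟩ |
    ⟨p, q, A₀, hp, rfl, h1⟩ | ⟨p, q, R₀, rfl, h1⟩ | ⟨hxS, l, y, A₀, rfl, h1⟩ |
    ⟨hxS, l, l', R₀, rfl, h0, h1⟩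
  · exact .inl h1
  · exact absurd hcx (h.free x hxS)
  · refine .inr ⟨?_, .inl (h1.of_nil_cons.low_le (by simpa using h.card)).2⟩
    rw [h.card_compl, h1.runs.card_compl]
    simp [verts_add]
    omega
  · refine .inr ⟨?_, ?_⟩
    · rw [h.card_compl, h1.card_compl]
      simp [verts_add]
      omega
    obtain ⟨t, w, rfl⟩ := (List.eq_nil_or_concat p).resolve_left hp
    have hm : t ++ w :: x :: q ∈ ((t.concat w ++ x :: q) ::ₘ A₀) + R := by simp
    have hwS := h.conf.runs.notMem hm (show w ∈ t ++ w :: x :: q by simp)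
    have hw : w ∈ closedNbhd G x := by
      rw [h.conf.runs.inner (t.concat w) x q (by simp) w hwS]
      simp
    simp only [List.concat_eq_append, List.append_assoc, List.cons_append, List.nil_append,
      List.dropLast_concat] at h h1 hm
    by_cases ht : t = []
    · subst ht
      obtain ⟨h2, h3, h4⟩ := h.of_nil h1 hw
      exact .inl fun _ => (h2.low_le h3 h4).2
    · exact .inr ⟨_, _, h.of_cons h1 rfl ht, t, by simp, h.flanked_left hm ht hw⟩
  -- A move on a run away from `c` shows that there is one, so a flanked run at `c` already exists.
  -- It is not touched.
  · obtain ⟨l, hl, hf⟩ := hf.resolve_left (Multiset.cons_ne_zero)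
    refine .inr ⟨?_, .inr ⟨_, _, h.of_same h1, l, hl, hf.mono hmono⟩⟩
    rw [h.card_compl, h1.card_compl]
    simp [verts_add]
    omega
  · refine .inr ⟨?_, ?_⟩
    · rw [h.card_compl, h1.card_compl]
      simp [verts_add]
      omega
    have hyx := h.toOpen.last_mem h1
    by_cases ht : l = []
    · subst ht
      obtain ⟨h2, h3, h4⟩ := h.of_nil h1 hyx
      exact .inl fun _ => (h2.low_le h3 h4).2
    · exact .inr ⟨_, _, h.of_cons h1 rfl ht, l, by simp, h.flanked_left (q := []) (by simp) ht hyx⟩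
  · obtain ⟨l, hl, hf⟩ := hf.resolve_left (Multiset.cons_ne_zero)
    refine .inr ⟨?_, .inr ⟨_, _, h.of_same h1, l, hl, hf.mono hmono⟩⟩
    rw [h.card_compl, h1.card_compl]
    simp [verts_add]
    omega

theorem Tri.exists_flank {A₀ : Multiset (List V)} {l : List V} (h : Tri G S c (l ::ₘ A₀) R)
    (hl : Flanked G (insert c S) c l) :
    ∃ x ∈ legalMoves G S, Sᶜ.card = (S ∪ closedNbhd G x)ᶜ.card + 1 ∧
      (low (S ∪ closedNbhd G x)ᶜ.card ≤ gameNumber G .dominator (S ∪ closedNbhd G x) ∨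
        ∃ l', l.length = l'.length + 1 ∧ Tri G (S ∪ closedNbhd G x) c (l' ::ₘ A₀) R ∧
          Flanked G (insert c (S ∪ closedNbhd G x)) c l') := by
  obtain ⟨x, hx, l', y, rfl, h1⟩ := h.toOpen.exists_flank_centre hl
  have hyx := h.toOpen.last_mem h1
  refine ⟨x, hx, ?_, ?_⟩
  · rw [h.card_compl, h1.card_compl]
    simp [verts_add]
    omega
  by_cases ht : l' = []
  · subst ht
    obtain ⟨h2, h3, h4⟩ := h.of_nil h1 hyx
    exact .inl (h2.low_le h3 h4).1
  · exact .inr ⟨l', by simp, h.of_cons h1 rfl ht, h.flanked_left (q := []) (by simp) ht hyx⟩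

/-- The four vertices are `c` and the three heads. -/
theorem Tri.card_tails (h : Tri G S c A R) :
    Sᶜ.card = (verts (A.map List.tail + R)).card + 4 := by
  obtain ⟨l, k, j, rfl⟩ := Multiset.card_eq_three.1 h.card
  have h1 := List.length_pos_of_ne_nil (h.ne_nil l (by simp))
  have h2 := List.length_pos_of_ne_nil (h.ne_nil k (by simp))
  have h3 := List.length_pos_of_ne_nil (h.ne_nil j (by simp))
  rw [h.card_compl]
  simp [verts]
  omega

/-- Dominator can dominate four vertices at most once, at `c`, and all his other moves dominate at
most three. So he gains at most one vertex on the count. Staller shortens a flanked run at `c` until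
`c` or one of its neighbours is dominated. -/
theorem Tri.low_sub_one_le (h : Tri G S c A R) :
    ((R = 0 ∨ ∃ l ∈ A, Flanked G (insert c S) c l) →
        low (Sᶜ.card - 1) ≤ gameNumber G .dominator S) ∧
      ((∃ l ∈ A, Flanked G (insert c S) c l) →
        1 + low (Sᶜ.card - 2) ≤ gameNumber G .staller S) := by
  induction hn : Sᶜ.card using Nat.strong_induction_on generalizing S A R with
  | _ n ih =>
    subst hn
    constructor
    · intro hf
      refine le_dominator h.notMem fun x hx => ?_
      rcases h.dominator_move hf hx with h1 | ⟨h1, h2 | ⟨A', R', h2, h3⟩⟩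
      · have h2 := (h1.nil_cons.nil_cons.low_le (by simp)).2
        rw [h1.runs.card_compl, zero_add] at h2
        rw [h.card_tails]
        exact low_le_of_step (by omega) h2
      · exact low_le_of_step (by omega) h2
      · have h4 := (ih _ (card_compl_lt hx) h2 rfl).2 h3
        have h5 := h2.card_tails
        unfold low at *
        omega
    · rintro ⟨l, hl, hf⟩
      obtain ⟨A₀, rfl⟩ := Multiset.exists_cons_of_mem hl
      obtain ⟨x, hx, h1, h2 | ⟨l', -, h2, h3⟩⟩ := h.exists_flank hf
      · refine le_trans (Nat.add_le_add_left ?_ 1) (le_staller hx)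
        exact (low_mono (by omega)).trans h2
      · refine le_trans (Nat.add_le_add_left ?_ 1) (le_staller hx)
        have h4 := (ih _ (card_compl_lt hx) h2 rfl).1 (.inr ⟨l', by simp, h3⟩)
        rwa [h1]

/-- The fourth vertex that Dominator gains at the centre is of no use to him unless the remaining
runs fill up quarters perfectly, with a single vertex left over. -/
theorem low_le_runsS_of_ne {n m a b c : ℕ} (h : n = 4 * m + a + 2 * b + 3 * c) (hn : n % 4 = 1)
    (hne : ¬ (a = 1 ∧ b = 0 ∧ c = 0)) : low (n + 4) ≤ 1 + runsS m a b c := by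
  obtain ⟨t, e, he, rfl⟩ : ∃ t e, e < 4 ∧ c = 4 * t + e :=
    ⟨c / 4, c % 4, Nat.mod_lt _ (by norm_num), by omega⟩
  obtain ⟨u, f, hf, rfl⟩ : ∃ t e, e < 2 ∧ b = 2 * t + e :=
    ⟨b / 2, b % 2, Nat.mod_lt _ (by norm_num), by omega⟩
  unfold runsS low
  interval_cases e <;> interval_cases f <;> omega

/-- The lengths of the runs in `L` are divisible by four, except for one that is congruent to one
modulo four. -/
def OneResidue (L : Multiset (List V)) : Prop :=
  residues 1 L = 1 ∧ residues 2 L = 0 ∧ residues 3 L = 0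

theorem not_oneResidue_of_mem {l : List V} (hl : l ∈ L) (h3 : l.length % 4 = 3) :
    ¬ OneResidue L := by
  rintro ⟨-, -, h⟩
  obtain ⟨M, rfl⟩ := Multiset.exists_cons_of_mem hl
  simp [resInd, h3] at h

/-- Staller chooses the run to shorten so that a subsequent move of Dominator at `c` does not meet
the exceptional case of `low_le_runsS_of_ne`. -/
theorem Tri.exists_flanked_tail (h : Tri G S c A R) (hf : ∃ l ∈ A, Flanked G (insert c S) c l) :
    ∃ l A₀, A = l ::ₘ A₀ ∧ Flanked G (insert c S) c l ∧
      ∀ l' : List V, l.length = l'.length + 1 → l' ≠ [] →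
        ¬ OneResidue ((l' ::ₘ A₀).map List.tail + R) := by
  obtain ⟨l, hl, hfl⟩ := hf
  by_cases hall : ∀ l ∈ A, Flanked G (insert c S) c l
  -- A run of residue 1, once shortened, has a tail of residue 3. If there is no such run, the tails
  -- of the two other runs both have nonzero residue. Either way exactly one residue 1 is
  -- impossible.
  · by_cases h1 : ∃ l ∈ A, l.length % 4 = 1
    · obtain ⟨l, hl, h1⟩ := h1
      have hfl := hall l hl
      obtain ⟨A₀, rfl⟩ := Multiset.exists_cons_of_mem hl
      refine ⟨l, A₀, rfl, hfl, fun l' hl' hne => not_oneResidue_of_mem (l := l'.tail) (by simp) ?_⟩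
      have := List.length_pos_of_ne_nil hne
      rw [List.length_tail]
      omega
    · push Not at h1
      obtain ⟨l, k, j, rfl⟩ := Multiset.card_eq_three.1 h.card
      refine ⟨l, {k, j}, rfl, hall l (by simp), fun l' _ _ => ?_⟩
      rintro ⟨e1, e2, e3⟩
      have hk := h1 k (by simp)
      have hj := h1 j (by simp)
      have hk' := List.length_pos_of_ne_nil (h.ne_nil k (by simp))
      have hj' := List.length_pos_of_ne_nil (h.ne_nil j (by simp))
      have hk0 := resInd_spec k.tail.length
      have hj0 := resInd_spec j.tail.length
      simp only [Multiset.insert_eq_cons, Multiset.map_cons, Multiset.map_singleton,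
        Multiset.cons_add, residues_cons, residues_add, residues_singleton] at e1 e2 e3
      have ek : k.tail.length = k.length - 1 := List.length_tail
      have ej : j.tail.length = j.length - 1 := List.length_tail
      omega
  · push Not at hall
    obtain ⟨m, hm, hfm⟩ := hall
    -- An unflanked run has length divisible by four, hence a tail of residue 3, and it is not the
    -- run that is shortened.
    have hm4 := (h.conf.flankA m hm).resolve_right hfm
    have hm' := List.length_pos_of_ne_nil (h.ne_nil m hm)
    obtain ⟨A₀, rfl⟩ := Multiset.exists_cons_of_mem hl
    have hmA : m ∈ A₀ := by
      rcases Multiset.mem_cons.1 hm with rfl | hm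
      · exact absurd hfl hfm
      · exact hm
    refine ⟨l, A₀, rfl, hfl, fun l' _ _ => not_oneResidue_of_mem (l := m.tail) ?_ ?_⟩
    · rw [Multiset.map_cons, Multiset.cons_add]
      exact Multiset.mem_cons_of_mem
        (Multiset.mem_add.2 (.inl (Multiset.mem_map_of_mem _ hmA)))
    · rw [List.length_tail]
      omega

/-- Sharpens `Tri.low_sub_one_le` for the residues that occur from the full spider on, as long as
Dominator dominates exactly three vertices and Staller one. -/
theorem Tri.low_le (h : Tri G S c A R) :
    (Sᶜ.card % 4 = 1 → ¬ OneResidue (A.map List.tail + R) →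
      (R = 0 ∨ ∃ l ∈ A, Flanked G (insert c S) c l) →
        low Sᶜ.card ≤ gameNumber G .dominator S) ∧
      (Sᶜ.card % 4 = 2 → (∃ l ∈ A, Flanked G (insert c S) c l) →
        1 + low (Sᶜ.card - 1) ≤ gameNumber G .staller S) := by
  induction hn : Sᶜ.card using Nat.strong_induction_on generalizing S A R with
  | _ n ih =>
    subst hn
    constructor
    · intro h4 hr hf
      refine le_dominator h.notMem fun x hx => ?_
      rcases h.dominator_move hf hx with h1 | ⟨h1, h2 | ⟨A', R', h2, h3⟩⟩
      · have h2 := h1.le_gameNumber_zero.2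
        rw [h.card_tails] at h4 ⊢
        exact (low_le_runsS_of_ne (card_verts _) (by omega) hr).trans (Nat.add_le_add_left h2 1)
      · exact low_le_of_step (by omega) h2
      · have h5 := h2.card_tails
        by_cases h6 : Sᶜ.card = (S ∪ closedNbhd G x)ᶜ.card + 3
        · exact low_le_of_step h1 fun _ => (ih _ (card_compl_lt hx) h2 rfl).2 (by omega) h3
        -- Here Dominator has wasted a vertex, which makes up for the one he may gain later at the
        -- centre.
        · have h4 := h2.low_sub_one_le.2 h3
          unfold low at *
          omega
    · intro h4 hf
      obtain ⟨l, A₀, rfl, hl, h0⟩ := h.exists_flanked_tail hf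
      obtain ⟨x, hx, h1, h2 | ⟨l', h5, h2, h3⟩⟩ := h.exists_flank hl
      · refine le_trans (Nat.add_le_add_left ?_ 1) (le_staller hx)
        exact (low_mono (by omega)).trans h2
      · refine le_trans (Nat.add_le_add_left ?_ 1) (le_staller hx)
        have h4 := (ih _ (card_compl_lt hx) h2 rfl).1 (by omega)
          (h0 l' h5 (h2.ne_nil l' (by simp))) (.inr ⟨l', by simp, h3⟩)
        rwa [h1]

/-! ### The spiders -/

theorem Tri.of_isRuns (h : IsRuns G (insert c ∅) A)
    (hn : ∀ y ≠ c, (y ∈ closedNbhd G c ↔ ∃ l ∈ A, y ∈ l.head?)) (h4 : ∀ l ∈ A, 4 ∣ l.length)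
    (hne : ∀ l ∈ A, l ≠ []) (hA : A.card = 3) : Tri G ∅ c A 0 where
  notMem := by simp
  adj := by simp
  card := hA
  ne_nil := hne
  free := by simp
  conf :=
    { runs := by rwa [add_zero]
      mem := by simp
      nbr := fun y hy => hn y (by simpa using hy)
      single := by simp
      last := by simp
      flankA := fun l hl => .inl (h4 l hl)
      flankR := by simp }

theorem Tri.exists_length (h : Tri G S c A R) (h4 : ∀ l ∈ A, 4 ∣ l.length) {l : List V}
    (hl : l ∈ A) : ∃ s, l.length = 4 * s + 4 := by
  obtain ⟨s, hs⟩ := h4 l hl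
  have := List.length_pos_of_ne_nil (h.ne_nil l hl)
  exact ⟨s - 1, by omega⟩

theorem Tri.eq_cons (h : Tri G S c A R) {l : List V} {A₀ : Multiset (List V)} (hA : A = l ::ₘ A₀) :
    ∃ k j, A₀ = {k, j} :=
  Multiset.card_eq_two.1 (by simpa [hA] using h.card)

theorem tail_length_of_eq {l : List V} {s : ℕ} (h : l.length = 4 * s + 4) :
    l.tail.length = 4 * s + 3 := by
  rw [List.length_tail]
  omega

/-- The number of vertices is one more than four times `quarters A`, and the tails of the legs have
residue 3, so the exceptional case of `Tri.low_le` does not occur. -/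
theorem Tri.le_gameNumber_dominator (h : Tri G ∅ c A 0) (h4 : ∀ l ∈ A, 4 ∣ l.length) :
    2 * quarters A + 1 ≤ gameNumber G .dominator ∅ := by
  have e := h.card_compl
  rw [add_zero, card_verts, residues_eq_zero h4 one_pos, residues_eq_zero h4 two_pos,
    residues_eq_zero h4 three_pos] at e
  obtain ⟨l, k, j, rfl⟩ := Multiset.card_eq_three.1 h.card
  obtain ⟨s, hs⟩ := h.exists_length h4 (l := l) (by simp)
  refine le_trans ?_ (h.low_le.1 (by omega)
    (not_oneResidue_of_mem (l := l.tail) (by simp) ?_) (.inl rfl))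
  · rw [e]
    unfold low
    omega
  · rw [tail_length_of_eq hs]
    omega

/-- Dominator opens at the centre and leaves three runs of residue 3. -/
theorem Tri.gameNumber_dominator_le (h : Tri G ∅ c A 0) (h4 : ∀ l ∈ A, 4 ∣ l.length) :
    gameNumber G .dominator ∅ ≤ 2 * quarters A + 1 := by
  refine h.dominator_le_centre.trans ?_
  obtain ⟨l, k, j, rfl⟩ := Multiset.card_eq_three.1 h.card
  obtain ⟨s, hs⟩ := h.exists_length h4 (l := l) (by simp)
  obtain ⟨t, ht⟩ := h.exists_length h4 (l := k) (by simp)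
  obtain ⟨u, hu⟩ := h.exists_length h4 (l := j) (by simp)
  simp [valueS, -List.length_tail, tail_length_of_eq, hs, ht, hu, resInd_four_mul_add, four_mul_add_div]
  norm_num [resInd, runsS]
  omega

theorem Tri.le_gameNumber_staller (h : Tri G ∅ c A 0) (h4 : ∀ l ∈ A, 4 ∣ l.length) :
    2 * quarters A + 1 ≤ gameNumber G .staller ∅ := by
  obtain ⟨l, A₀, rfl⟩ : ∃ l A₀, A = l ::ₘ A₀ := by
    obtain ⟨l, k, j, rfl⟩ := Multiset.card_eq_three.1 h.card
    exact ⟨l, {k, j}, rfl⟩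
  obtain ⟨s, hs⟩ := h.exists_length h4 (l := l) (by simp)
  -- Staller opens at the second vertex `x` of a leg. This makes `w` a dominated neighbour of the
  -- centre and leaves a run of residue 1 besides two untouched legs.
  rcases l with _ | ⟨w, _ | ⟨x, q⟩⟩
  · simp at hs
  · simp at hs
  have hm : w :: x :: q ∈ ((w :: x :: q) ::ₘ A₀) + 0 := by simp
  have hw : w ∈ closedNbhd G x := by
    rw [h.conf.runs.inner [w] x q hm w (h.conf.runs.notMem hm (by simp))]
    simp
  have hx : c ∉ closedNbhd G x := by
    have hd := nodup_of_mem h.conf.runs.nodup hm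
    rw [mem_closedNbhd_comm, h.conf.nbr x (h.conf.runs.notMem hm (by simp))]
    rintro ⟨k, hk, hxk⟩
    obtain rfl := eq_of_mem_of_mem h.conf.runs.nodup (Multiset.mem_add.2 (.inl hk)) hm
      (List.mem_of_mem_head? hxk) (by simp)
    obtain rfl : w = x := by simpa using hxk
    simp at hd
  obtain ⟨h1, h2, h3⟩ := h.of_nil (h.of_move hx (Conf.play_centre_run (p := [w]) h.conf)) hw
  refine le_trans ?_ (le_staller (mem_legalMoves_of_notMem (x := x) (by simp)))
  have h5 : ∀ l ∈ A₀, 4 ∣ l.length := fun l hl => h4 l (by simp [hl])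
  refine le_trans ?_ (Nat.add_le_add_left (h1.le_gameNumber h2 h5 h3).1 1)
  simp only [List.length_cons] at hs
  have hq : q.tail.length = 4 * s + 1 := by
    rw [List.length_tail]
    omega
  simp [-List.length_tail, hq, show q.length + 1 + 1 = 4 * (s + 1) by omega, resInd_four_mul_add, four_mul_add_div]
  norm_num [resInd, runsD]
  omega

theorem runs_staller_tri {a b s t u : ℕ} (h : a + b + 3 = 4 * s ∨ b = 0 ∧ a + 2 = 4 * s) :
    2 + runsS ((a - 1) / 4 + (t + (u + b / 4)))
        (resInd 1 (a - 1) + resInd 1 b) (resInd 2 (a - 1) + resInd 2 b)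
        (resInd 3 (a - 1) + (1 + (1 + resInd 3 b))) ≤
      2 * (s + (t + 1 + (u + 1))) + 1 := by
  rcases eq_zero_or_eq_succ a with rfl | ⟨j, i, hi, rfl⟩
  · obtain ⟨j, rfl⟩ : ∃ j, b = 4 * j + 1 := ⟨b / 4, by omega⟩
    simp only [resInd_four_mul_add, four_mul_add_div]
    norm_num [resInd]
    unfold runsS
    omega
  · rw [Nat.add_sub_cancel]
    rcases h with h | ⟨rfl, h⟩
    · obtain ⟨j', rfl⟩ : ∃ j', b = 4 * j' + (4 - i) % 4 := ⟨b / 4, by omega⟩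
      interval_cases i <;> simp only [resInd_four_mul_add, four_mul_add_div] <;>
        norm_num [resInd] <;> unfold runsS <;> omega
    · obtain rfl : i = 1 := by omega
      simp only [resInd_four_mul_add, four_mul_add_div]
      norm_num [resInd]
      unfold runsS
      omega

/-- Unless Staller opens at the centre, Dominator answers there; then only disjoint runs are left.
-/
theorem Tri.gameNumber_staller_le (h : Tri G ∅ c A 0) (h4 : ∀ l ∈ A, 4 ∣ l.length) :
    gameNumber G .staller ∅ ≤ 2 * quarters A + 1 := by
  refine staller_le fun x hx => ?_
  rcases h.toOpen.move hx with ⟨-, h1⟩ | ⟨h1, -⟩ | ⟨q, A₀, rfl, h1⟩ | ⟨p, q, A₀, hp, rfl, h1⟩ |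
    ⟨p, q, R₀, h1, -⟩ | ⟨h1, -⟩ | ⟨h1, -⟩
  · refine (Nat.add_le_add_left h1.runs.gameNumber_le.1 1).trans ?_
    obtain ⟨l, k, j, rfl⟩ := Multiset.card_eq_three.1 h.card
    obtain ⟨s, hs⟩ := h.exists_length h4 (l := l) (by simp)
    obtain ⟨t, ht⟩ := h.exists_length h4 (l := k) (by simp)
    obtain ⟨u, hu⟩ := h.exists_length h4 (l := j) (by simp)
    simp [valueD, -List.length_tail, tail_length_of_eq, hs, ht, hu, resInd_four_mul_add, four_mul_add_div]
    norm_num [resInd, runsD]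
    omega
  · simp at h1
  · obtain ⟨k, j, rfl⟩ := h.eq_cons rfl
    obtain ⟨s, hs⟩ := h.exists_length h4 (l := x :: q) (by simp)
    obtain ⟨t, ht⟩ := h.exists_length h4 (l := k) (by simp)
    obtain ⟨u, hu⟩ := h.exists_length h4 (l := j) (by simp)
    have hc : c ∈ legalMoves G (∅ ∪ closedNbhd G x) :=
      h1.legal_centre (l := k) (by simp) (h.ne_nil k (by simp))
    refine (Nat.add_le_add_left ((dominator_le hc).trans
      (Nat.add_le_add_left h1.play_centre.runs.gameNumber_le.2 1)) 1).trans ?_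
    have hs' := hs
    rw [List.length_cons] at hs'
    have hq : q.tail.length = 4 * s + 2 := by
      rw [List.length_tail]
      omega
    simp [valueS, -List.length_tail, -List.length_cons, tail_length_of_eq, hs, hq, ht, hu, resInd_four_mul_add, four_mul_add_div]
    norm_num [resInd, runsS]
    omega
  · obtain ⟨k, j, rfl⟩ := h.eq_cons rfl
    obtain ⟨s, hs⟩ := h4 (p ++ x :: q) (by simp)
    obtain ⟨t, ht⟩ := h.exists_length h4 (l := k) (by simp)
    obtain ⟨u, hu⟩ := h.exists_length h4 (l := j) (by simp)
    refine (Nat.add_le_add_left h1.dominator_le_centre 1).trans ?_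
    have hp' := List.length_pos_of_ne_nil hp
    have hs' := hs
    rw [List.length_append, List.length_cons] at hs'
    have := runs_staller_tri (a := p.length - 1) (b := q.length - 1) (s := s) (t := t) (u := u)
      (by omega)
    rw [← add_assoc]
    have hk := tail_length_of_eq ht
    have hj := tail_length_of_eq hu
    rw [List.length_tail] at hk hj
    have e1 : resInd 1 3 = 0 := rfl
    have e2 : resInd 2 3 = 0 := rfl
    have e3 : resInd 3 3 = 1 := rfl
    simpa [-List.length_append, valueS, hs, hk, hj, ht, hu, resInd_four_mul_add, four_mul_add_div,
      add_assoc, e1, e2, e3] using this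
  · simp at h1
  · simp at h1
  · simp at h1

/-! ### The spider with one vertex already dominated -/

theorem Tri.gameNumber_centre_le (h : Tri G ∅ c A 0) (h4 : ∀ l ∈ A, 4 ∣ l.length) :
    gameNumber G .dominator {c} ≤ 2 * quarters A := by
  have h1 := h.conf.runs.gameNumber_le.1
  rw [insert_empty_eq, add_zero, valueD, residues_eq_zero h4 one_pos, residues_eq_zero h4 two_pos,
    residues_eq_zero h4 three_pos] at h1
  exact h1

theorem Tri.le_of_play_centre {A₀ : Multiset (List V)} {p q : List V} {v w : V}
    (h : Tri G ∅ c ((w :: (p ++ v :: q)) ::ₘ A₀) 0) :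
    gameNumber G .dominator {v} ≤ 1 + valueS (p ::ₘ q ::ₘ A₀.map List.tail) := by
  have hv : v ≠ c := by
    rintro rfl
    exact h.conf.runs.notMem (l := w :: (p ++ v :: q)) (by simp) (show v ∈ _ by simp) (by simp)
  have h1 := h.conf.play_centre.runs
  rw [zero_add, Multiset.map_cons, add_zero, List.tail_cons] at h1
  refine (dominator_le (mem_legalMoves_of_notMem (x := c) (by simpa using hv.symm))).trans
    (Nat.add_le_add_left ?_ 1)
  have h2 := h1.predominate.gameNumber_le.2
  rwa [insert_union_closedNbhd_of_mem (self_mem_closedNbhd c), ← Finset.insert_union,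
    insert_empty_eq] at h2

theorem Tri.le_of_play_head {A₀ : Multiset (List V)} {p q : List V} {v w y : V}
    (h : Tri G ∅ c ((w :: y :: (p ++ v :: q)) ::ₘ A₀) 0) :
    gameNumber G .dominator {v} ≤ 1 + valueS (p ::ₘ q ::ₘ A₀) := by
  have hd := nodup_of_mem h.conf.runs.nodup (l := w :: y :: (p ++ v :: q)) (by simp)
  have hv : w ≠ v := by
    rintro rfl
    simp at hd
  have h1 := h.play_head.2.of_nil_cons.runs
  rw [List.tail_cons, Multiset.add_cons, add_zero] at h1
  refine (dominator_le (mem_legalMoves_of_notMem (x := w) (by simpa using hv))).trans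
    (Nat.add_le_add_left ?_ 1)
  have h2 := h1.predominate.gameNumber_le.2
  rwa [← Finset.insert_union, insert_empty_eq] at h2

theorem Tri.le_of_play_third {A₀ : Multiset (List V)} {q : List V} {v x y z : V}
    (h : Tri G ∅ c ((v :: x :: y :: z :: q) ::ₘ A₀) 0) (h4 : ∀ l ∈ A₀, 4 ∣ l.length) :
    gameNumber G .dominator {v} ≤ 1 + runsS (quarters A₀ + q.length / 4)
      (resInd 1 q.length + 1) (resInd 2 q.length) (resInd 3 q.length) := by
  have hm : v :: x :: y :: z :: q ∈ ((v :: x :: y :: z :: q) ::ₘ A₀) + 0 := by simp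
  have hd := nodup_of_mem h.conf.runs.nodup hm
  have hA : A₀.card = 2 := by simpa using h.card
  have hS := fun u hu => h.conf.runs.notMem (v := u) hm hu
  have hc : ∀ u ∈ x :: y :: z :: q, c ∉ closedNbhd G u := by
    intro u hu
    rw [mem_closedNbhd_comm, h.conf.nbr u (hS u (List.mem_cons_of_mem _ hu))]
    rintro ⟨k, hk, hxk⟩
    obtain rfl := eq_of_mem_of_mem h.conf.runs.nodup (Multiset.mem_add.2 (.inl hk)) hm
      (List.mem_of_mem_head? hxk) (List.mem_cons_of_mem _ hu)
    obtain rfl : v = u := by simpa using hxk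
    exact (List.nodup_cons.1 hd).1 hu
  have hx := h.conf.runs.inner [v] x (y :: z :: q) hm
  have hy := h.conf.runs.inner [v, x] y (z :: q) hm
  have hvx : v ∈ closedNbhd G x := by rw [hx v (hS v (by simp))]; simp
  have hyx : y ∈ closedNbhd G x := by rw [hx y (hS y (by simp))]; simp
  have hzy : z ∈ closedNbhd G y := by rw [hy z (hS z (by simp))]; simp
  have hxy : x ∈ closedNbhd G y := mem_closedNbhd_comm.1 hyx
  have hyc : y ≠ c := by
    rintro rfl
    exact hS y (by simp) (by simp)
  have h1 := h.of_move (hc x (by simp)) (Conf.play_centre_run (p := [v]) h.conf)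
  obtain ⟨l, hl, h2⟩ := h1.conf.play_flank_run (x := y) (y := z)
    (Finset.mem_insert_of_mem (Finset.mem_union_right _ hyx)) hyc (by simp) hzy
  have h3 := (h1.of_move (hc y (by simp)) h2).of_nil_cons
  have hvy : y ∉ ({v} : Finset V) := by
    rw [Finset.mem_singleton]
    rintro rfl
    simp at hd
  -- Dominator's move at `y` in `G|v` produces the same dominated set as the moves `x` and `y` in
  -- `G`, to which the lemmas on moves apply.
  have e : ∅ ∪ closedNbhd G x ∪ closedNbhd G y = {v} ∪ closedNbhd G y := by
    ext u
    simp only [Finset.mem_union, Finset.notMem_empty, false_or, Finset.mem_singleton]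
    constructor
    · rintro (hu | hu)
      · by_cases huc : u = c
        · subst huc
          exact absurd hu (hc x (by simp))
        rcases (hx u (by simpa using huc)).1 hu with rfl | hu | hu
        · exact .inr hxy
        · exact .inl (by simpa using hu.symm)
        · obtain rfl : y = u := by simpa using hu
          exact .inr (self_mem_closedNbhd _)
      · exact .inr hu
    · rintro (rfl | hu)
      · exact .inl hvx
      · exact .inr hu
  refine (dominator_le (mem_legalMoves_of_notMem hvy)).trans (Nat.add_le_add_left ?_ 1)
  rw [← e]
  have h5 := (h3.gameNumber_le hA h4).2
  have hl' : l.length = q.length := by simpa using hl.symm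
  simpa [hl'] using h5

theorem Tri.gameNumber_singleton_le (h : Tri G ∅ c A 0) (h4 : ∀ l ∈ A, 4 ∣ l.length) (v : V) :
    gameNumber G .dominator {v} ≤ 2 * quarters A := by
  by_cases hv : v = c
  · subst hv
    exact h.gameNumber_centre_le h4
  obtain ⟨l, hl, hvl⟩ := h.conf.runs.exists_mem (v := v) (by simpa using hv)
  rw [add_zero] at hl
  obtain ⟨A₀, rfl⟩ := Multiset.exists_cons_of_mem hl
  obtain ⟨k, j, rfl⟩ := h.eq_cons rfl
  obtain ⟨s, hs⟩ := h.exists_length h4 (l := l) (by simp)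
  obtain ⟨t, ht⟩ := h.exists_length h4 (l := k) (by simp)
  obtain ⟨u, hu⟩ := h.exists_length h4 (l := j) (by simp)
  have hk := tail_length_of_eq ht
  have hj := tail_length_of_eq hu
  obtain ⟨p, q, rfl⟩ := List.append_of_mem hvl
  rw [List.length_append, List.length_cons] at hs
  have e0 : (p ++ v :: q).length = 4 * s + 4 := by rw [List.length_append, List.length_cons, hs]
  have e1 : resInd 1 3 = 0 := rfl
  have e2 : resInd 2 3 = 0 := rfl
  have e3 : resInd 3 3 = 1 := rfl
  have e4 (i : ℕ) : resInd i 4 = resInd i 0 := resInd_four_mul_add i 1 0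
  have e5 (i n : ℕ) : resInd i (4 * n + 4) = resInd i 0 := resInd_four_mul i (n + 1)
  rw [quarters_cons, e0]
  rcases p with _ | ⟨w, p⟩
  · rcases q with _ | ⟨x, _ | ⟨y, _ | ⟨z, q⟩⟩⟩
    iterate 3
      simp at hs
      try omega
    refine (h.le_of_play_third fun l hl => h4 l (Multiset.mem_cons_of_mem hl)).trans ?_
    obtain hq : q.length = 4 * s := by
      simp at hs
      omega
    simp [hq, ht, hu, resInd_four_mul, resInd_zero, runsS]
    omega
  · rw [List.length_cons] at hs
    -- The lengths of `p` and `q` add up to 2 modulo four. A move at the centre is good enough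
    -- unless both have residue 1; in that case a move at the head `w` shortens `p` to residue 0.
    by_cases hp : p.length % 4 = 1
    · rcases p with _ | ⟨y, p⟩
      · simp at hp
      refine h.le_of_play_head.trans ?_
      rw [List.length_cons] at hs hp
      obtain ⟨i, hi⟩ : ∃ i, p.length = 4 * i := ⟨p.length / 4, by omega⟩
      obtain ⟨i', hi'⟩ : ∃ i, q.length = 4 * i + 1 := ⟨q.length / 4, by omega⟩
      simp [valueS, hi, hi', ht, hu, resInd_four_mul, resInd_four_mul_add, four_mul_add_div, e5]
      norm_num [resInd, runsS]
      omega
    · refine h.le_of_play_centre.trans ?_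
      obtain ⟨i, e, he, hi⟩ : ∃ i e, e < 4 ∧ p.length = 4 * i + e :=
        ⟨p.length / 4, p.length % 4, Nat.mod_lt _ (by norm_num), by omega⟩
      obtain ⟨i', hi'⟩ : ∃ i', q.length = 4 * i' + (6 - e) % 4 := ⟨q.length / 4, by omega⟩
      simp only [valueS, quarters_cons, quarters_singleton, residues_cons, residues_singleton,
        Multiset.map_cons, Multiset.map_singleton, Multiset.insert_eq_cons, hi, hi', hk, hj, ht,
        hu, resInd_four_mul_add, four_mul_add_div]
      interval_cases e <;> norm_num [resInd, runsS] <;> omega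

/-! ### The legs of the concrete spider as runs around its centre -/

/-- The vertices of a leg, starting next to the centre. -/
def leg (n : Fin 3 → ℕ) (i : Fin 3) : List (SpiderVertex n) :=
  (List.finRange (n i)).map fun j => some ⟨i, j⟩

variable {n : Fin 3 → ℕ}

@[simp] theorem length_leg (i : Fin 3) : (leg n i).length = n i := by
  simp [leg]

theorem mem_leg {i i' : Fin 3} {j : Fin (n i')} : some ⟨i', j⟩ ∈ leg n i ↔ i' = i := by
  simp only [leg, List.mem_map, List.mem_finRange, true_and, Option.some.injEq]
  constructor
  · rintro ⟨a, h⟩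
    exact (congrArg Sigma.fst h).symm
  · rintro rfl
    exact ⟨j, rfl⟩

theorem none_notMem_leg (i : Fin 3) : none ∉ leg n i := by
  simp [leg]

theorem mem_getElem?_leg {i i' : Fin 3} {j : Fin (n i')} {k : ℕ} :
    some ⟨i', j⟩ ∈ (leg n i)[k]? ↔ i' = i ∧ j.val = k := by
  simp only [leg, List.getElem?_map, Option.mem_def, Option.map_eq_some_iff,
    List.getElem?_eq_some_iff]
  constructor
  · rintro ⟨a, ⟨hk, rfl⟩, h⟩
    obtain ⟨rfl, h⟩ := Sigma.mk.inj (Option.some.inj h)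
    obtain rfl := eq_of_heq h
    simp
  · rintro ⟨rfl, rfl⟩
    exact ⟨j, ⟨by simp, by simp⟩, rfl⟩

theorem some_mem_closedNbhd_spider {i i' : Fin 3} {j : Fin (n i)} {j' : Fin (n i')} :
    some ⟨i', j'⟩ ∈ closedNbhd (spider n) (some ⟨i, j⟩) ↔
      i' = i ∧ (j'.val = j.val ∨ j'.val + 1 = j.val ∨ j'.val = j.val + 1) := by
  rw [mem_closedNbhd]
  change _ ∨ (i = i' ∧ (j.val + 1 = j'.val ∨ j'.val + 1 = j.val)) ↔ _
  constructor
  · rintro (h | ⟨rfl, h⟩)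
    · obtain ⟨rfl, h⟩ := Sigma.mk.inj (Option.some.inj h)
      obtain rfl := eq_of_heq h
      simp
    · exact ⟨rfl, by omega⟩
  · rintro ⟨rfl, h | h | h⟩
    · exact .inl (by rw [Fin.ext h])
    · exact .inr ⟨rfl, .inr h⟩
    · exact .inr ⟨rfl, .inl h.symm⟩

theorem some_mem_closedNbhd_none {i : Fin 3} {j : Fin (n i)} :
    some ⟨i, j⟩ ∈ closedNbhd (spider n) none ↔ j.val = 0 := by
  rw [mem_closedNbhd]
  change _ ∨ j.val = 0 ↔ _
  simp

/-- The legs of a spider. -/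
def legs (n : Fin 3 → ℕ) : Multiset (List (SpiderVertex n)) :=
  {leg n 0, leg n 1, leg n 2}

theorem mem_legs {l : List (SpiderVertex n)} : l ∈ legs n ↔ ∃ i, l = leg n i := by
  simp [legs, Fin.exists_fin_succ]

theorem isRuns_legs : IsRuns (spider n) (insert none ∅) (legs n) where
  nodup := by
    have h1 (i) : (leg n i).Nodup := by
      refine (List.nodup_finRange _).map fun a b h => ?_
      simpa using h
    have h2 {i i' : Fin 3} (h : i ≠ i') : ∀ v ∈ leg n i, v ∉ leg n i' := by
      rintro (_ | ⟨k, j⟩) hv hv'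
      · exact none_notMem_leg _ hv
      · exact h ((mem_leg.1 hv).symm.trans (mem_leg.1 hv'))
    have h01 := h2 (i := 0) (i' := 1) (by decide)
    have h02 := h2 (i := 0) (i' := 2) (by decide)
    have h12 := h2 (i := 1) (i' := 2) (by decide)
    rw [legs, Multiset.insert_eq_cons, Multiset.insert_eq_cons, nodup_verts_cons, nodup_verts_cons]
    refine ⟨h1 0, ⟨h1 1, by simpa [verts] using h1 2, by simpa using h12⟩, ?_⟩
    intro v hv k hk
    rcases Multiset.mem_cons.1 hk with rfl | hk
    · exact h01 v hv
    · rw [Multiset.mem_singleton.1 hk]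
      exact h02 v hv
  mem_iff := by
    rintro (_ | ⟨i, j⟩)
    · simp only [mem_verts, mem_legs]
      constructor
      · rintro ⟨_, ⟨i, rfl⟩, h⟩
        exact absurd h (none_notMem_leg i)
      · simp
    · simp only [mem_verts, mem_legs]
      exact ⟨fun _ => by simp, fun _ => ⟨_, ⟨i, rfl⟩, mem_leg.2 rfl⟩⟩
  inner := by
    intro p x q hl y hy
    obtain ⟨i, hl⟩ := mem_legs.1 hl
    have hx : x ∈ (leg n i)[p.length]? := by simp [← hl]
    have hq : q.head? = (leg n i)[p.length + 1]? := by
      rw [← hl, List.head?_eq_getElem?, List.getElem?_append_right (by omega)]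
      simp
    have hp : p = [] ∧ p.length = 0 ∨ p.getLast? = (leg n i)[p.length - 1]? ∧ 0 < p.length := by
      rcases List.eq_nil_or_concat p with rfl | ⟨t, w, rfl⟩
      · exact .inl ⟨rfl, rfl⟩
      · right
        simp [← hl]
    rcases y with _ | ⟨i', j'⟩
    · simp at hy
    rcases x with _ | ⟨i'', j⟩
    · exact absurd (List.mem_of_getElem? hx) (none_notMem_leg i)
    obtain ⟨rfl, hj⟩ := mem_getElem?_leg.1 hx
    rw [hq, mem_getElem?_leg, some_mem_closedNbhd_spider]
    have e : some (⟨i', j'⟩ : Σ i, Fin (n i)) = some ⟨i'', j⟩ ↔ i' = i'' ∧ j'.val = j.val := by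
      constructor
      · intro h
        obtain ⟨rfl, h⟩ := Sigma.mk.inj (Option.some.inj h)
        obtain rfl := eq_of_heq h
        simp
      · rintro ⟨rfl, h⟩
        rw [Fin.ext h]
    rw [e]
    rcases hp with ⟨rfl, hp⟩ | ⟨hp, hp'⟩
    · simp only [List.getLast?_nil, Option.mem_def, reduceCtorEq, false_or]
      omega
    · rw [hp, mem_getElem?_leg]
      omega
  outer := by
    intro x hx l hl
    obtain ⟨i, rfl⟩ := mem_legs.1 hl
    obtain rfl : x = none := by simpa using hx
    rcases hl : leg n i with _ | ⟨u, t⟩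
    · exact .inl (by simp)
    · refine .inr (.inl ⟨u, t, rfl, ?_, ?_⟩)
      · have hu : u ∈ (leg n i)[0]? := by simp [hl]
        rcases u with _ | ⟨i', j⟩
        · exact self_mem_closedNbhd _
        · exact some_mem_closedNbhd_none.2 (mem_getElem?_leg.1 hu).2
      · intro y hy
        obtain ⟨k, hk⟩ := List.mem_iff_getElem?.1 hy
        have hu : y ∈ (leg n i)[k + 1]? := by simp [hl, hk]
        rcases y with _ | ⟨i', j⟩
        · exact absurd (List.mem_of_getElem? hu) (none_notMem_leg i)
        · rw [some_mem_closedNbhd_none, (mem_getElem?_leg.1 hu).2]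
          omega

theorem tri_legs (h4 : ∀ i, 4 ∣ n i) (h0 : ∀ i, 0 < n i) : Tri (spider n) ∅ none (legs n) 0 := by
  refine .of_isRuns isRuns_legs ?_ ?_ ?_ rfl
  · rintro (_ | ⟨i, j⟩) hy
    · exact absurd rfl hy
    rw [some_mem_closedNbhd_none]
    simp only [mem_legs]
    constructor
    · intro h
      refine ⟨_, ⟨i, rfl⟩, ?_⟩
      rw [List.head?_eq_getElem?]
      exact mem_getElem?_leg.2 ⟨rfl, h⟩
    · rintro ⟨_, ⟨i', rfl⟩, h⟩
      rw [List.head?_eq_getElem?] at h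
      exact (mem_getElem?_leg.1 h).2
  · intro l hl
    obtain ⟨i, rfl⟩ := mem_legs.1 hl
    simpa using h4 i
  · intro l hl
    obtain ⟨i, rfl⟩ := mem_legs.1 hl
    rw [← List.length_pos_iff, length_leg]
    exact h0 i

end DominationGame

theorem theorem4p1 (p q r : ℕ) (hp : 1 ≤ p) (hq : 1 ≤ q) (hr : 1 ≤ r) :
    DominationGame.IsKCritical (2 * (p + q + r) + 1) (DominationGame.spiderT p q r) ∧
      (∀ v, DominationGame.gammaG (DominationGame.spiderT p q r) {v} ≤ 2 * (p + q + r)) ∧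
      DominationGame.gammaG' (DominationGame.spiderT p q r) ∅ = 2 * (p + q + r) + 1 := by
  have h4 : ∀ i, 4 ∣ ![4 * p, 4 * q, 4 * r] i := by simp [Fin.forall_fin_succ]
  have h0 : ∀ i, 0 < ![4 * p, 4 * q, 4 * r] i := by
    simp [Fin.forall_fin_succ]
    omega
  have h := DominationGame.tri_legs h4 h0
  have hl : ∀ l ∈ DominationGame.legs ![4 * p, 4 * q, 4 * r], 4 ∣ l.length := by
    intro l hl
    obtain ⟨i, rfl⟩ := DominationGame.mem_legs.1 hl
    simpa using h4 i
  have e : DominationGame.quarters (DominationGame.legs ![4 * p, 4 * q, 4 * r]) = p + q + r := by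
    simp [DominationGame.legs, add_assoc]
  have h1 := h.le_gameNumber_dominator hl
  have h2 := h.gameNumber_dominator_le hl
  have h3 := h.le_gameNumber_staller hl
  have h5 := h.gameNumber_staller_le hl
  have h6 := h.gameNumber_singleton_le hl
  rw [e] at h1 h2 h3 h5 h6
  have h7 : DominationGame.gammaG (DominationGame.spiderT p q r) ∅ = 2 * (p + q + r) + 1 :=
    le_antisymm h2 h1
  exact ⟨⟨fun v => h7 ▸ Nat.lt_succ_of_le (h6 v), h7⟩, h6, le_antisymm h5 h3⟩
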